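/- **Conventions.** Fix real numbers $F\ge1$, $K\ge0$, $G\ge1$, $H\ge2$. All C*-algebras are unital with $1\neq0$, and all *-morphisms are unital. $S(\mathfrak A)$ is the state space of $\mathfrak A$ and $\mathfrak{sa}(\mathfrak A)$ its self-adjoint part; a seminorm defined on a subspace is given the value $\infty$ off its domain. $\Re a=\frac{a+a^*}{2}$, $\Im a=\frac{a-a^*}{2i}$. For a symmetric $d\ge 0$ and nonempty sets $S,T$, $\mathrm{Haus}_d(S,T)=\max\{\sup_{x\in S}\inf_{y\in T}d(x,y),\ \sup_{y\in T}\inf_{x\in S}d(y,x)\}\in[0,\infty]$. A *quantum compact metric space* $(\mathfrak A,L)$ is a C*-algebra $\mathfrak A$ with a seminorm $L$ on a dense subspace of $\mathfrak{sa}(\mathfrak A)$ such that $L(1)=0$; $\mathrm{mk}_L(\varphi,\psi)=\sup\{|\varphi(a)-\psi(a)|:L(a)\le1\}$ is a (finite) metric on $S(\mathfrak A)$ inducing the weak* topology; $\max\{L(\Re(ab)),L(\Im(ab))\}\le F(L(a)\|b\|+\|a\|L(b))+KL(a)L(b)$ for $a,b\in\mathrm{dom}(L)$; and $\{L\le1\}$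 is closed. A *metrical C\*-correspondence* $\mathbb A=(\mathscr M,D,\mathfrak A,L,\mathfrak B,S)$ consists of quantum compact metric spaces $(\mathfrak A,L)$, $(\mathfrak B,S)$, a right Hilbert $\mathfrak B$-module $\mathscr M$, a *-morphism from $\mathfrak A$ to the C*-algebra $\mathcal L(\mathbb A)$ of adjoinable (i.e. adjointable) $\mathfrak B$-linear operators of $\mathscr M$, and a norm $D$ on a dense complex subspace of $\mathscr M$ with $D(\omega)\ge\|\omega\|_{\mathscr M}$, $\{D\le1\}$ norm compact, $D(a\omega)\le G(\|a\|+L(a))D(\omega)$ for $a\in\mathrm{dom}(L)$, $\omega\in\mathrm{dom}(D)$, and $\max\{S(\Re\langle\omega,\eta\rangle),S(\Im\langle\omega,\eta\rangle)\}\le H\,D(\omega)D(\eta)$ for $\omega,\eta\in\mathrm{dom}(D)$. A *modular quantum isometry* $(\Pi,\pi,\theta):\mathbb A_1\to\mathbb A_2$ is given by a continuous linear $\Pi:\mathscr M_1\to\mathscr M_2$ and *-morphisms $\pi:\mathfrak A_1\to\mathfrak A_2$, $\theta:\mathfrak B_1\to\mathfrak B_2$ with $\Pi(a\omega)=\pi(a)\Pi(\omega)$,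 $\Pi(\omega b)=\Pi(\omega)\theta(b)$, $\theta(\langle\omega,\eta\rangle)=\langle\Pi\omega,\Pi\eta\rangle$, mapping the domains of $L_1,S_1,D_1$ into those of $L_2,S_2,D_2$, and such that $L_2,S_2,D_2$ are, on their domains, the quotients of $L_1,S_1,D_1$ along $\pi,\theta,\Pi$: $L_2(a)=\inf\{L_1(d):d\in\mathrm{dom}(L_1),\ \pi(d)=a\}$, and likewise for $S_2$ and $D_2$. It is *full* when $\Pi,\pi,\theta$ are bijections with $L_2\circ\pi=L_1$, $S_2\circ\theta=S_1$, $D_2\circ\Pi=D_1$. A *tunnel* $\tau$ from $\mathbb A_1$ to $\mathbb A_2$ is a metrical C*-correspondence $\mathbb P=(\mathscr P,D_{\mathbb P},\mathfrak D,L_{\mathfrak D},\mathfrak E,L_{\mathfrak E})$ with modular quantum isometries $(\Pi_k,\pi_k,\theta_k):\mathbb P\to\mathbb A_k$, $k=1,2$. Its *extent* $\chi(\tau)$ is the maximum over $k\in\{1,2\}$ of $\mathrm{Haus}_{\mathrm{mk}_{L_{\mathfrak D}}}(\{\varphi\circ\pi_k:\varphi\in S(\mathfrak A_k)\},S(\mathfrak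 D))$ and $\mathrm{Haus}_{\mathrm{mk}_{L_{\mathfrak E}}}(\{\psi\circ\theta_k:\psi\in S(\mathfrak B_k)\},S(\mathfrak E))$. The *pseudo-states* of $\mathbb A$ are the functionals $\xi\mapsto\mu(\langle\omega,\xi\rangle)$ with $\mu\in S(\mathfrak B)$, $D(\omega)\le1$; their set is $\tilde S(\mathbb A)$. Let $J$ be a nonempty set. For families $a\in\mathcal L(\mathbb A_1)^J$ and $b\in\mathcal L(\mathbb A_2)^J$, the *separation* $\mathrm{sep}(a,b|\tau)$ is the Hausdorff distance between $\{(\varphi\circ a_j\circ\Pi_1)_{j\in J}:\varphi\in\tilde S(\mathbb A_1)\}$ and $\{(\psi\circ b_j\circ\Pi_2)_{j\in J}:\psi\in\tilde S(\mathbb A_2)\}$ for the distance $\sup_{j\in J}\sup\{|f_j(\zeta)-g_j(\zeta)|:D_{\mathbb P}(\zeta)\le1\}$ between families of functionals on $\mathscr P$. The *operational propinquity* is $$\Lambda(a,b)=\inf_\tau\max\{\chi(\tau),\mathrm{sep}(a,b|\tau)\}\in[0,\infty],$$ the infimum being over all tunnels $\tau$ from $\mathbb A_1$ to $\mathbb A_2$.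 A family $a$ is *bounded* when $\sup_{j\in J}\|a_j\|<\infty$. **Theorem.** Let $J$ be a nonempty set. 1. $\Lambda(a,a)=0$ and $\Lambda(a,b)=\Lambda(b,a)$ for all families $a,b$ of adjoinable operators on metrical C*-correspondences indexed by $J$; $\Lambda(a,c)\le\Lambda(a,b)+\Lambda(b,c)$ for all such families $a,b,c$ with $b$ bounded; and $\Lambda(a,b)<\infty$ if $a$ and $b$ are bounded. In particular, $\Lambda$ is a pseudo-metric on the class of bounded families of adjoinable operators indexed by $J$. 2. Fix $j_0\in J$. Let $a\in\mathcal L(\mathbb A)^J$ and $b\in\mathcal L(\mathbb B)^J$ be families, bounded or not, with $a_{j_0}=\mathrm{id}$ and $b_{j_0}=\mathrm{id}$. Then $\Lambda(a,b)=0$ if and only if there is a full modular quantum isometry $(\Pi,\pi,\theta)$ from $\mathbb A$ to $\mathbb B$ with $\Pi\circ a_j=b_j\circ\Pi$ for all $j\in J$. -/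

import Mathlib

open scoped ENNReal NNReal Topology ComplexStarModule

universe u v

noncomputable section

namespace OpPropinquity

/-! ### States, quantum compact metric spaces -/

/-- The state space of a unital C*-algebra: positive linear functionals which map `1` to `1`.
It carries the weak* topology (the subspace topology inherited from `WeakDual`). -/
abbrev StateSpace (A : Type u) [CStarAlgebra A] : Type u :=
  {φ : WeakDual ℂ A // φ 1 = 1 ∧ ∀ a : A, 0 ≤ (φ (star a * a)).re ∧ (φ (star a * a)).im = 0}

/-- The restriction of a unital *-morphism to self-adjoint elements. -/
def saMap {A B : Type u} [CStarAlgebra A] [CStarAlgebra B] (π : A →⋆ₐ[ℂ] B)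
    (a : selfAdjoint A) : selfAdjoint B :=
  ⟨π (a : A), by
    rw [selfAdjoint.mem_iff, ← map_star, selfAdjoint.star_val_eq]⟩

/-- The composition `φ ∘ π` of a state with a unital *-morphism. -/
def StateSpace.comp {A B : Type u} [CStarAlgebra A] [CStarAlgebra B] (φ : StateSpace B)
    (π : A →⋆ₐ[ℂ] B) : StateSpace A :=
  ⟨StrongDual.toWeakDual ((WeakDual.toStrongDual φ.1).comp
      ⟨π.toAlgHom.toLinearMap, AddMonoidHomClass.continuous_of_bound π 1
        (fun a => by simpa using NonUnitalStarAlgHom.norm_apply_le π a)⟩), by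
    constructor
    · have h : φ.1 (π 1) = 1 := by rw [map_one]; exact φ.2.1
      exact h
    · intro a
      have h := φ.2.2 (π a)
      rw [← map_star, ← map_mul] at h
      exact h⟩

/-- The Monge-Kantorovich distance between two states, for an extended seminorm `L` on the
self-adjoint elements. -/
def mkState {A : Type u} [CStarAlgebra A] (L : selfAdjoint A → ℝ≥0∞) (φ ψ : StateSpace A) :
    ℝ≥0∞ :=
  ⨆ (a : selfAdjoint A) (_ : L a ≤ 1), ‖φ.1 (a : A) - ψ.1 (a : A)‖ₑ

/-- An `(F,K)`-quantum compact metric space. A seminorm on a dense subspace is encoded as a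
`[0,∞]`-valued function which is `∞` exactly off the domain. -/
structure QuantumCMS (F K : ℝ≥0) where
  carrier : Type u
  [cstar : CStarAlgebra carrier]
  [nontriv : Nontrivial carrier]
  lip : selfAdjoint carrier → ℝ≥0∞
  lip_smul : ∀ (t : ℝ) (a : selfAdjoint carrier), lip (t • a) = ‖t‖ₑ * lip a
  lip_add_le : ∀ a b : selfAdjoint carrier, lip (a + b) ≤ lip a + lip b
  dense_dom : Dense {a : selfAdjoint carrier | lip a < ∞}
  lip_one : lip 1 = 0
  mk_lt_top : ∀ φ ψ : StateSpace carrier, mkState lip φ ψ < ∞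
  /-- The Monge-Kantorovich metric induces the weak* topology on the state space. -/
  mk_basis : ∀ φ : StateSpace carrier,
    (𝓝 φ).HasBasis (fun ε : ℝ≥0∞ => 0 < ε) (fun ε => {ψ | mkState lip ψ φ < ε})
  leibniz : ∀ a b : selfAdjoint carrier, lip a < ∞ → lip b < ∞ →
    max (lip (ℜ ((a : carrier) * (b : carrier)))) (lip (ℑ ((a : carrier) * (b : carrier)))) ≤
      F * (lip a * ‖(b : carrier)‖ₑ + ‖(a : carrier)‖ₑ * lip b) + K * lip a * lip b
  isClosed_ball : IsClosed {a : selfAdjoint carrier | lip a ≤ 1}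

attribute [instance] QuantumCMS.cstar QuantumCMS.nontriv

instance (F K : ℝ≥0) : CoeSort (QuantumCMS.{u} F K) (Type u) := ⟨QuantumCMS.carrier⟩

/-! ### Hilbert modules and adjoinable operators -/

/-- A right Hilbert C*-module `M` over `B` (complete for its norm, which is the one of the inner
product). The element `ω · b` is `MulOpposite.op b • ω`; positive elements of `B` are the
elements of the form `b* b`. -/
class HilbertModule (B M : Type u) [CStarAlgebra B] [NormedAddCommGroup M] [NormedSpace ℂ M]
    [Module Bᵐᵒᵖ M] [CompleteSpace M] where
  inner : M → M → B
  inner_add_right : ∀ ω η ζ, inner ω (η + ζ) = inner ω η + inner ω ζ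
  inner_smul_right : ∀ (z : ℂ) (ω η), inner ω (z • η) = z • inner ω η
  inner_op_smul_right : ∀ (b : B) (ω η), inner ω (MulOpposite.op b • η) = inner ω η * b
  star_inner : ∀ ω η, star (inner ω η) = inner η ω
  inner_self_nonneg : ∀ ω, ∃ b : B, inner ω ω = star b * b
  inner_self_eq_zero : ∀ ω, inner ω ω = 0 ↔ ω = 0
  norm_eq : ∀ ω : M, ‖ω‖ = √‖inner ω ω‖

section

variable (B M : Type u) [CStarAlgebra B] [NormedAddCommGroup M] [NormedSpace ℂ M]
    [Module Bᵐᵒᵖ M] [CompleteSpace M] [HilbertModule B M]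

/-- `S` is an adjoint of `T` for the `B`-valued inner product. -/
def IsAdjointPair (T S : M →L[ℂ] M) : Prop :=
  ∀ ω η : M, HilbertModule.inner (B := B) (T ω) η = HilbertModule.inner (B := B) ω (S η)

/-- `B`-linearity of an operator. -/
def IsRightLinear (T : M →L[ℂ] M) : Prop :=
  ∀ (b : B) (ω : M), T (MulOpposite.op b • ω) = MulOpposite.op b • T ω

/-- The adjoinable `B`-linear continuous operators on a right Hilbert `B`-module. -/
structure Adjoinable where
  toCLM : M →L[ℂ] M
  right_linear : IsRightLinear B M toCLM
  exists_adjoint : ∃ S : M →L[ℂ] M, IsRightLinear B M S ∧ IsAdjointPair B M toCLM S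

/-- The identity as an adjoinable operator. -/
def Adjoinable.id : Adjoinable B M where
  toCLM := ContinuousLinearMap.id ℂ M
  right_linear := fun _ _ => rfl
  exists_adjoint := ⟨ContinuousLinearMap.id ℂ M, fun _ _ => rfl, fun _ _ => rfl⟩

end

/-! ### Metrical C*-correspondences and their morphisms -/

/-- An `(F,K,G,H)`-metrical C*-correspondence. The field `lact` is the unital *-morphism from `A`
to the adjoinable operators on `M`. The D-norm is `∞` exactly off its domain. -/
structure MetricalCorr (F K G H : ℝ≥0) where
  A : QuantumCMS.{u} F K
  B : QuantumCMS.{u} F K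
  M : Type u
  [normedGroup : NormedAddCommGroup M]
  [normedSpace : NormedSpace ℂ M]
  [rightModule : Module (B.carrier)ᵐᵒᵖ M]
  [complete : CompleteSpace M]
  [hilbert : HilbertModule B.carrier M]
  lact : A.carrier →ₐ[ℂ] (M →L[ℂ] M)
  lact_right_linear : ∀ a : A.carrier, IsRightLinear B.carrier M (lact a)
  lact_star : ∀ a : A.carrier, IsAdjointPair B.carrier M (lact a) (lact (star a))
  dnorm : M → ℝ≥0∞
  dnorm_smul : ∀ (z : ℂ) (ω : M), dnorm (z • ω) = ‖z‖ₑ * dnorm ω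
  dnorm_add_le : ∀ ω η : M, dnorm (ω + η) ≤ dnorm ω + dnorm η
  dense_dom : Dense {ω : M | dnorm ω < ∞}
  norm_le_dnorm : ∀ ω : M, ‖ω‖ₑ ≤ dnorm ω
  isCompact_ball : IsCompact {ω : M | dnorm ω ≤ 1}
  modular_leibniz : ∀ (a : selfAdjoint A.carrier) (ω : M), A.lip a < ∞ → dnorm ω < ∞ →
    dnorm (lact (a : A.carrier) ω) ≤ G * (‖(a : A.carrier)‖ₑ + A.lip a) * dnorm ω
  inner_leibniz : ∀ ω η : M, dnorm ω < ∞ → dnorm η < ∞ →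
    max (B.lip (ℜ (HilbertModule.inner (B := B.carrier) ω η)))
      (B.lip (ℑ (HilbertModule.inner (B := B.carrier) ω η))) ≤ H * dnorm ω * dnorm η

attribute [instance] MetricalCorr.normedGroup MetricalCorr.normedSpace MetricalCorr.rightModule
  MetricalCorr.complete MetricalCorr.hilbert

variable {F K G H : ℝ≥0}

/-- The `B`-valued inner product of a metrical C*-correspondence. -/
abbrev MetricalCorr.ip (X : MetricalCorr.{u} F K G H) (ω η : X.M) : X.B :=
  HilbertModule.inner ω η

/-- The adjoinable operators of the underlying Hilbert module. -/
abbrev MetricalCorr.Op (X : MetricalCorr.{u} F K G H) : Type u := Adjoinable X.B.carrier X.M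

/-- Lipschitz morphisms of metrical C*-correspondences. -/
structure LipschitzMorphism (X Y : MetricalCorr.{u} F K G H) where
  modMap : X.M →L[ℂ] Y.M
  leftMap : X.A →⋆ₐ[ℂ] Y.A
  rightMap : X.B →⋆ₐ[ℂ] Y.B
  map_lact : ∀ (a : X.A) (ω : X.M), modMap (X.lact a ω) = Y.lact (leftMap a) (modMap ω)
  map_right : ∀ (b : X.B) (ω : X.M),
    modMap (MulOpposite.op b • ω) = MulOpposite.op (rightMap b) • modMap ω
  map_ip : ∀ ω η : X.M, rightMap (X.ip ω η) = Y.ip (modMap ω) (modMap η)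
  left_dom : ∀ a : selfAdjoint X.A, X.A.lip a < ∞ → Y.A.lip (saMap leftMap a) < ∞
  right_dom : ∀ b : selfAdjoint X.B, X.B.lip b < ∞ → Y.B.lip (saMap rightMap b) < ∞
  mod_dom : ∀ ω : X.M, X.dnorm ω < ∞ → Y.dnorm (modMap ω) < ∞

/-- Modular quantum isometries: the seminorms and the D-norm of the codomain are the quotients of
those of the domain. -/
structure ModularQuantumIsometry (X Y : MetricalCorr.{u} F K G H) extends
    LipschitzMorphism X Y where
  left_quot : ∀ a : selfAdjoint Y.A, Y.A.lip a < ∞ →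
    Y.A.lip a = ⨅ (d : selfAdjoint X.A) (_ : X.A.lip d < ∞) (_ : saMap leftMap d = a), X.A.lip d
  right_quot : ∀ b : selfAdjoint Y.B, Y.B.lip b < ∞ →
    Y.B.lip b = ⨅ (d : selfAdjoint X.B) (_ : X.B.lip d < ∞) (_ : saMap rightMap d = b), X.B.lip d
  mod_quot : ∀ ω : Y.M, Y.dnorm ω < ∞ →
    Y.dnorm ω = ⨅ (η : X.M) (_ : X.dnorm η < ∞) (_ : modMap η = ω), X.dnorm η

/-- A modular quantum isometry is full when its three maps are bijections which preserve the
Lipschitz seminorms and the D-norm. -/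
structure ModularQuantumIsometry.IsFull {X Y : MetricalCorr.{u} F K G H}
    (Φ : ModularQuantumIsometry X Y) : Prop where
  bij_mod : Function.Bijective Φ.modMap
  bij_left : Function.Bijective Φ.leftMap
  bij_right : Function.Bijective Φ.rightMap
  lip_left : ∀ a : selfAdjoint X.A, Y.A.lip (saMap Φ.leftMap a) = X.A.lip a
  lip_right : ∀ b : selfAdjoint X.B, Y.B.lip (saMap Φ.rightMap b) = X.B.lip b
  dnorm_mod : ∀ ω : X.M, Y.dnorm (Φ.modMap ω) = X.dnorm ω

/-! ### Tunnels, extent, separation, operational propinquity -/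

/-- The Hausdorff distance between two sets, for a symmetric function `d`. -/
def hausdorff {E : Type*} (d : E → E → ℝ≥0∞) (S T : Set E) : ℝ≥0∞ :=
  max (⨆ x ∈ S, ⨅ y ∈ T, d x y) (⨆ y ∈ T, ⨅ x ∈ S, d y x)

/-- Metrical tunnels from `X` to `Y`. -/
structure Tunnel (X Y : MetricalCorr.{u} F K G H) where
  P : MetricalCorr.{u} F K G H
  toX : ModularQuantumIsometry P X
  toY : ModularQuantumIsometry P Y

/-- The Hausdorff distances involved in the extent, for one of the two legs of a tunnel. -/
def legExtent {P X : MetricalCorr.{u} F K G H} (Φ : ModularQuantumIsometry P X) : ℝ≥0∞ :=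
  max
    (hausdorff (mkState P.A.lip) (Set.range fun φ : StateSpace X.A => φ.comp Φ.leftMap) Set.univ)
    (hausdorff (mkState P.B.lip) (Set.range fun φ : StateSpace X.B => φ.comp Φ.rightMap) Set.univ)

/-- The extent of a metrical tunnel. -/
def Tunnel.extent {X Y : MetricalCorr.{u} F K G H} (τ : Tunnel X Y) : ℝ≥0∞ :=
  max (legExtent τ.toX) (legExtent τ.toY)

/-- The Monge-Kantorovich distance on the dual of the module, for the D-norm. -/
def MetricalCorr.mkDual (X : MetricalCorr.{u} F K G H) (φ ψ : X.M →L[ℂ] ℂ) : ℝ≥0∞ :=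
  ⨆ (ξ : X.M) (_ : X.dnorm ξ ≤ 1), ‖φ ξ - ψ ξ‖ₑ

/-- The Monge-Kantorovich distance between families of functionals. -/
def MetricalCorr.mkFamily (X : MetricalCorr.{u} F K G H) {J : Type v}
    (φ ψ : J → (X.M →L[ℂ] ℂ)) : ℝ≥0∞ :=
  ⨆ j, X.mkDual (φ j) (ψ j)

/-- The pseudo-states `ξ ↦ μ ⟨ω, ξ⟩`, for `μ` a state of `B` and `ω` of D-norm at most `1`. -/
def MetricalCorr.pseudoStates (X : MetricalCorr.{u} F K G H) : Set (X.M →L[ℂ] ℂ) :=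
  {φ | ∃ (μ : StateSpace X.B) (ω : X.M), X.dnorm ω ≤ 1 ∧ ∀ ξ, φ ξ = μ.1 (X.ip ω ξ)}

/-- The families `(φ ∘ a j ∘ Π)`, for `φ` ranging over the pseudo-states of `X`, where `Π` is the
module map of a leg of a tunnel. -/
def legFamilies {P X : MetricalCorr.{u} F K G H} (Φ : ModularQuantumIsometry P X) {J : Type v}
    (a : J → X.Op) : Set (J → (P.M →L[ℂ] ℂ)) :=
  (fun (φ : X.M →L[ℂ] ℂ) (j : J) => (φ.comp (a j).toCLM).comp Φ.modMap) '' X.pseudoStates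

/-- The separation of two families of adjoinable operators according to a tunnel. -/
def Tunnel.separation {X Y : MetricalCorr.{u} F K G H} (τ : Tunnel X Y) {J : Type v}
    (a : J → X.Op) (b : J → Y.Op) : ℝ≥0∞ :=
  hausdorff τ.P.mkFamily (legFamilies τ.toX a) (legFamilies τ.toY b)

/-- The dispersion of two families of adjoinable operators according to a tunnel. -/
def Tunnel.dispersion {X Y : MetricalCorr.{u} F K G H} (τ : Tunnel X Y) {J : Type v}
    (a : J → X.Op) (b : J → Y.Op) : ℝ≥0∞ :=
  max τ.extent (τ.separation a b)

/-- The operational propinquity. -/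
def opPropinquity {X Y : MetricalCorr.{u} F K G H} {J : Type v} (a : J → X.Op) (b : J → Y.Op) :
    ℝ≥0∞ :=
  ⨅ τ : Tunnel X Y, τ.dispersion a b

/-- Uniformly bounded families of operators. -/
def IsBoundedFamily {X : MetricalCorr.{u} F K G H} {J : Type v} (a : J → X.Op) : Prop :=
  ∃ C : ℝ, ∀ j, ‖(a j).toCLM‖ ≤ C

end OpPropinquity

end

noncomputable section

namespace OpPropinquity

section

/-! ### Positive functionals and states -/

section States

variable {A : Type u} [CStarAlgebra A]

/-! Triangle inequality. Two tunnels through `Y` are glued by keeping the direct sum of their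
correspondences and adding to the maximum of the seminorms the term `‖Φ x - Ψ y‖ / ε`, where `Φ` and
`Ψ` are the two legs onto `Y`. Elements with the same image in `Y` pay nothing for this term, so
both projections are still quotients. Elements of the unit ball have images at most `ε` apart, so
extents add up to an error `ε`. In the separation, the error comes from applying `ψ ∘ b j` to two
vectors of `Y` at distance at most `ε`; this is where `b` must be bounded. The term is a bounded
linear map `T` with a Leibniz inequality, and the structures `Coupling` and `ModuleCoupling` show
once and for all that such a direct sum is a metrical C*-correspondence.

Finiteness. Some tunnel must exist. The same construction is used with `T` a small multiple of the
quotient by the scalars on the algebras and of the identity on the module (`nonempty_tunnel`).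
Diameters of state spaces are finite, so every extent is, and boundedness of the families controls
the separation.

The axioms of a quantum compact metric space are checked by Rieffel's criterion: the
Monge-Kantorovich metric induces the weak* topology when the Lipschitz ball, cut by the kernel of a
state, is totally bounded (`nhds_hasBasis_mkState`). The converse,
`QuantumCMS.totallyBounded_centeredBall`, is Arzelà-Ascoli on the state space.

Coincidence. Take tunnels with dispersion below `1 / (n + 1)`, and pairs of limits, along an
ultrafilter, of the two images of a sequence of uniformly bounded seminorm. Small extent makes the
two limits equal in norm, compactness provides a limit on one side for each Lipschitz element on the
other, and the Leibniz inequalities make the pairs stable under the algebraic operations. Their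
closure is the graph of an isomorphism (`BridgeSequence.exists_starHom`,
`TunnelSequence.exists_isFull`). Pseudo-states also pass to the limit: one pseudo-state of `X` is
matched with a single functional on `Y` for all indices at once (`exists_pseudoState_eq`). The index
`j₀`, where the operators are identities, shows that this functional is the transported
pseudo-state; the other indices then give the intertwining, since pseudo-states separate vectors. -/

/-- Positivity in `StateSpace` refers only to elements `star b * b`; this turns the spectral bound
`a ≤ ‖a‖` into that form, so that no order has to be carried on `A`. -/
lemma exists_star_mul_self_eq_norm_sub {a : A} (ha : IsSelfAdjoint a) :
    ∃ b : A, star b * b = (‖a‖ : ℂ) • (1 : A) - a := by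
  let _ := CStarAlgebra.spectralOrder A
  have := CStarAlgebra.spectralOrderedRing A
  have h : 0 ≤ (‖a‖ : ℂ) • (1 : A) - a := by
    rw [sub_nonneg]
    simpa [Algebra.algebraMap_eq_smul_one] using IsSelfAdjoint.le_algebraMap_norm_self ha
  obtain ⟨b, hb⟩ := CStarAlgebra.nonneg_iff_eq_star_mul_self.mp h
  exact ⟨b, hb.symm⟩

/-- A positive linear functional is real on self-adjoint elements and bounded by its value
at `1`. -/
lemma positive_apply_selfAdjoint (f : A →ₗ[ℂ] ℂ)
    (hf : ∀ a : A, 0 ≤ (f (star a * a)).re ∧ (f (star a * a)).im = 0) {a : A}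
    (ha : IsSelfAdjoint a) : (f a).im = 0 ∧ |(f a).re| ≤ ‖a‖ * (f 1).re := by
  obtain ⟨b, hb⟩ := exists_star_mul_self_eq_norm_sub ha
  obtain ⟨c, hc⟩ := exists_star_mul_self_eq_norm_sub ha.neg
  have h1 := (hf 1).2
  have hb' := hf b
  have hc' := hf c
  rw [hb] at hb'
  rw [hc] at hc'
  simp only [star_one, mul_one] at h1
  simp only [map_sub, map_smul, map_neg, smul_eq_mul, norm_neg, Complex.sub_re, Complex.sub_im,
    Complex.neg_re, Complex.re_ofReal_mul, Complex.im_ofReal_mul, h1, mul_zero] at hb' hc'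
  refine ⟨by linarith [hb'.2], abs_le.2 ⟨by linarith [hc'.1], by linarith [hb'.1]⟩⟩

/-- Rotating `a` by a phase makes `f a` a nonnegative real, hence equal to the value of `f` at the
real part of the rotated element, whose norm is at most `‖a‖`. The self-adjoint case concludes. -/
lemma positive_norm_apply_le (f : A →ₗ[ℂ] ℂ)
    (hf : ∀ a : A, 0 ≤ (f (star a * a)).re ∧ (f (star a * a)).im = 0) (a : A) :
    ‖f a‖ ≤ ‖a‖ * (f 1).re := by
  obtain ⟨z, hz, hza⟩ : ∃ z : ℂ, ‖z‖ = 1 ∧ z * f a = ‖f a‖ := by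
    obtain h | h := eq_or_ne (f a) 0
    · exact ⟨1, by simp, by simp [h]⟩
    · refine ⟨(starRingEnd ℂ) (f a) / ‖f a‖, by simp [h], ?_⟩
      have : (‖f a‖ : ℂ) ≠ 0 := by simpa using h
      rw [div_mul_eq_mul_div, div_eq_iff this, Complex.conj_mul', sq]
  have key : f (z • a) = f (ℜ (z • a)) + Complex.I * f (ℑ (z • a)) := by
    conv_lhs => rw [← realPart_add_I_smul_imaginaryPart (z • a)]
    rw [map_add, map_smul (f := f) Complex.I, smul_eq_mul]
  have hre := positive_apply_selfAdjoint f hf (ℜ (z • a)).2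
  have him := positive_apply_selfAdjoint f hf (ℑ (z • a)).2
  have h1 : (0 : ℝ) ≤ (f 1).re := by simpa using (hf 1).1
  have : ‖f a‖ = (f (ℜ (z • a))).re := by
    have := congrArg Complex.re key
    rw [map_smul, smul_eq_mul, hza] at this
    simpa [him.1] using this
  rw [this]
  refine (le_abs_self _).trans (hre.2.trans (mul_le_mul_of_nonneg_right ?_ h1))
  refine (realPart.norm_le (z • a)).trans ?_
  rw [norm_smul, hz, one_mul]

namespace StateSpace

variable (φ : StateSpace A)

lemma norm_apply_le (a : A) : ‖φ.1 a‖ ≤ ‖a‖ := by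
  simpa [φ.2.1] using positive_norm_apply_le (WeakDual.toStrongDual φ.1).toLinearMap φ.2.2 a

lemma im_apply (a : selfAdjoint A) : (φ.1 (a : A)).im = 0 :=
  (positive_apply_selfAdjoint (WeakDual.toStrongDual φ.1).toLinearMap φ.2.2 a.2).1

lemma ofReal_re_apply (a : selfAdjoint A) : ((φ.1 (a : A)).re : ℂ) = φ.1 (a : A) :=
  Complex.ext (by simp) (by simp [im_apply])

lemma isClosed_range_val : IsClosed {φ : WeakDual ℂ A |
    φ 1 = 1 ∧ ∀ a : A, 0 ≤ (φ (star a * a)).re ∧ (φ (star a * a)).im = 0} := by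
  have hc : ∀ a : A, Continuous fun φ : WeakDual ℂ A => φ a := WeakDual.eval_continuous
  simp only [Set.ofPred_and, Set.ofPred_forall]
  refine (isClosed_eq (hc 1) continuous_const).inter (isClosed_iInter fun a => ?_)
  exact (isClosed_le continuous_const (Complex.continuous_re.comp (hc _))).inter
    (isClosed_eq (Complex.continuous_im.comp (hc _)) continuous_const)

/-- Banach-Alaoglu: the states form a weak* closed subset of the unit ball of the dual. -/
instance : CompactSpace (StateSpace A) := by
  refine isCompact_iff_compactSpace.1 ?_
  refine (WeakDual.isCompact_closedBall (𝕜 := ℂ) (E := A) 0 1).of_isClosed_subset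
    isClosed_range_val fun φ hφ => ?_
  simp only [Set.mem_preimage, mem_closedBall_zero_iff]
  exact ContinuousLinearMap.opNorm_le_bound _ zero_le_one fun a => by
    simpa using norm_apply_le ⟨φ, hφ⟩ a

lemma continuous_eval (a : A) : Continuous fun φ : StateSpace A => φ.1 a :=
  (WeakDual.eval_continuous a).comp continuous_subtype_val

end StateSpace

/-- A functional of norm at most one which maps `1` to `1` is a state. -/
def stateOfNormLe (g : StrongDual ℂ A) (hg : ‖g‖ ≤ 1) (h1 : g 1 = 1) : StateSpace A :=
  ⟨StrongDual.toWeakDual g, h1, by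
    have hle : ∀ a, ‖g a‖ ≤ ‖a‖ := fun a => by
      simpa using g.le_of_opNorm_le hg a
    have him : ∀ a : A, IsSelfAdjoint a → (g a).im = 0 := by
      intro a ha
      -- Evaluate `g` at `a + i t`. The square of its norm is at most `‖a‖ ^ 2 + t ^ 2`, with no
      -- term linear in `t`, whereas the left side has the cross term `2 t (g a).im`. The factor
      -- `‖1‖` is kept because `A` is not assumed nontrivial here.
      have hsq : ∀ t : ℝ, ((g a).im + t) ^ 2 ≤ ‖a‖ ^ 2 * ‖(1 : A)‖ + t ^ 2 * ‖(1 : A)‖ := by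
        intro t
        set b : A := a + (t * Complex.I) • (1 : A) with hb
        have hstar : star b * b = a * a + ((t ^ 2 : ℝ) : ℂ) • (1 : A) := by
          have h2 : star ((t : ℂ) * Complex.I) = -((t : ℂ) * Complex.I) := by simp
          simp only [hb, star_add, star_smul, ha.star_eq, star_one, h2, mul_add, add_mul,
            smul_mul_assoc, mul_smul_comm, one_mul, mul_one, smul_neg, smul_add, smul_smul, neg_smul,
            neg_mul]
          rw [add_assoc, neg_add_cancel_left, ← neg_smul]
          congr 2
          have := Complex.I_mul_I
          push_cast
          linear_combination (-(t : ℂ) ^ 2) * this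
        have hnb : ‖b‖ ^ 2 ≤ ‖a‖ ^ 2 * ‖(1 : A)‖ + t ^ 2 * ‖(1 : A)‖ := by
          rw [sq, ← CStarRing.norm_star_mul_self, hstar]
          refine (norm_add_le _ _).trans (add_le_add ?_ ?_)
          · rcases subsingleton_or_nontrivial A with hA | hA
            · simp [Subsingleton.elim a 0]
            · simpa [sq] using norm_mul_le a a
          · rw [norm_smul]; simp
        have h3 : |(g b).im| ^ 2 ≤ ‖b‖ ^ 2 :=
          pow_le_pow_left₀ (abs_nonneg _) ((Complex.abs_im_le_norm _).trans (hle b)) 2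
        have h4 : (g b).im = (g a).im + t := by simp [hb, h1]
        rw [sq_abs, h4] at h3
        exact h3.trans hnb
      have hone : ‖(1 : A)‖ ≤ 1 := by
        rcases subsingleton_or_nontrivial A with hA | hA
        · simp [Subsingleton.elim (1 : A) 0]
        · simp
      by_contra hne
      -- This value of `t` makes the cross term equal to `‖a‖ ^ 2 + 1`, one more than what the
      -- inequality allows.
      have h5 := hsq ((‖a‖ ^ 2 + 1) / (2 * (g a).im))
      have h6 : 2 * (g a).im * ((‖a‖ ^ 2 + 1) / (2 * (g a).im)) = ‖a‖ ^ 2 + 1 := by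
        field_simp
      nlinarith [sq_nonneg ‖a‖, sq_nonneg ((‖a‖ ^ 2 + 1) / (2 * (g a).im)), sq_nonneg (g a).im]
    intro a
    refine ⟨?_, him _ (IsSelfAdjoint.star_mul_self a)⟩
    let _ := CStarAlgebra.spectralOrder A
    have := CStarAlgebra.spectralOrderedRing A
    have hpos : 0 ≤ star a * a := star_mul_self_nonneg a
    -- For a positive `p`, the element `‖p‖ - p` lies between `0` and `‖p‖`. As `g` is contractive
    -- and `g 1 = 1`, this forces `‖p‖ - Re (g p) ≤ ‖p‖`.
    have hn : ‖(‖star a * a‖ : ℂ) • (1 : A) - star a * a‖ ≤ ‖star a * a‖ := by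
      obtain ⟨b, hb⟩ := exists_star_mul_self_eq_norm_sub (IsSelfAdjoint.star_mul_self a)
      have hb0 : 0 ≤ (‖star a * a‖ : ℂ) • (1 : A) - star a * a := hb ▸ star_mul_self_nonneg b
      refine (CStarAlgebra.norm_le_iff_le_algebraMap _ (norm_nonneg _) hb0).2 ?_
      have : algebraMap ℝ A ‖star a * a‖ = (‖star a * a‖ : ℂ) • (1 : A) := by
        simp [Algebra.algebraMap_eq_smul_one]
      rw [this]
      exact sub_le_self _ hpos
    have h7 := (Complex.re_le_norm _).trans ((hle _).trans hn)
    simp only [map_sub, map_smul, h1, smul_eq_mul, mul_one, Complex.sub_re,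
      Complex.ofReal_re] at h7
    change 0 ≤ (g (star a * a)).re
    linarith⟩

variable [Nontrivial A]

/-- Gelfand theory gives a character of the C*-algebra generated by `a` with value `z` at `a`. A
Hahn-Banach extension of the same norm still sends `1` to `1`, so it is a state. -/
lemma exists_state_of_mem_spectrum {a : A} (ha : IsSelfAdjoint a) {z : ℂ}
    (hz : z ∈ spectrum ℂ a) : ∃ φ : StateSpace A, φ.1 a = z := by
  have : IsStarNormal a := ha.isStarNormal
  let S : StarSubalgebra ℂ A := StarAlgebra.elemental ℂ a
  have hS : IsClosed (S : Set A) := StarAlgebra.elemental.isClosed ℂ a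
  let a' : StarAlgebra.elemental ℂ a := ⟨a, StarAlgebra.elemental.self_mem ℂ a⟩
  have hz' : z ∈ spectrum ℂ a' :=
    (StarSubalgebra.mem_spectrum_iff (hS := hS) (StarAlgebra.elemental ℂ a)).2 hz
  obtain ⟨χ, hχ⟩ := WeakDual.CharacterSpace.mem_spectrum_iff_exists.1 hz'
  have hχn : ∀ s : StarAlgebra.elemental ℂ a, ‖χ s‖ ≤ ‖s‖ := fun s =>
    (spectrum.norm_le_norm_of_mem (AlgHom.apply_mem_spectrum χ s))
  let f : StrongDual ℂ S.toSubalgebra.toSubmodule :=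
    LinearMap.mkContinuous
      { toFun := fun s => χ (⟨s.1, s.2⟩ : StarAlgebra.elemental ℂ a)
        map_add' := fun s t => map_add χ (⟨s.1, s.2⟩ : StarAlgebra.elemental ℂ a) ⟨t.1, t.2⟩
        map_smul' := fun c s => map_smul χ c (⟨s.1, s.2⟩ : StarAlgebra.elemental ℂ a) } 1
      fun s => (hχn ⟨s.1, s.2⟩).trans_eq (one_mul _).symm
  obtain ⟨g, hgf, hgn⟩ := exists_extension_norm_eq _ f
  have hfn : ‖f‖ ≤ 1 := LinearMap.mkContinuous_norm_le _ zero_le_one _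
  refine ⟨stateOfNormLe g (hgn.trans_le hfn) ?_, ?_⟩
  · exact (hgf ⟨1, S.one_mem⟩).trans (map_one χ)
  · exact (hgf ⟨a, StarAlgebra.elemental.self_mem ℂ a⟩).trans hχ

lemma exists_state_norm_eq (a : selfAdjoint A) :
    ∃ φ : StateSpace A, ‖φ.1 (a : A)‖ = ‖(a : A)‖ := by
  let _ := CStarAlgebra.spectralOrder A
  have := CStarAlgebra.spectralOrderedRing A
  obtain h | h := CStarAlgebra.norm_or_neg_norm_mem_spectrum a.2
  all_goals
    have h' := spectrum.algebraMap_mem ℂ h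
    obtain ⟨φ, hφ⟩ := exists_state_of_mem_spectrum a.2 h'
    exact ⟨φ, by simp [hφ]⟩

instance : Nonempty (StateSpace A) := ⟨(exists_state_norm_eq (0 : selfAdjoint A)).choose⟩

lemma norm_le_of_forall_state {a : selfAdjoint A} {r : ℝ}
    (h : ∀ φ : StateSpace A, ‖φ.1 (a : A)‖ ≤ r) : ‖(a : A)‖ ≤ r := by
  obtain ⟨φ, hφ⟩ := exists_state_norm_eq a
  exact hφ ▸ h φ

lemma eq_zero_of_forall_state {a : A} (h : ∀ φ : StateSpace A, φ.1 a = 0) : a = 0 := by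
  have key : ∀ φ : StateSpace A, φ.1 (ℜ a : A) = 0 ∧ φ.1 (ℑ a : A) = 0 := by
    intro φ
    have h0 := h φ
    rw [← realPart_add_I_smul_imaginaryPart a, map_add, map_smul, smul_eq_mul,
      ← StateSpace.ofReal_re_apply, ← StateSpace.ofReal_re_apply φ (ℑ a)] at h0
    rw [← StateSpace.ofReal_re_apply, ← StateSpace.ofReal_re_apply φ (ℑ a)]
    have h1 := congrArg Complex.re h0
    have h2 := congrArg Complex.im h0
    simp only [Complex.add_re, Complex.add_im, Complex.mul_re, Complex.mul_im, Complex.I_re,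
      Complex.I_im, Complex.ofReal_re, Complex.ofReal_im, Complex.zero_re, Complex.zero_im,
      zero_mul, mul_zero, one_mul, sub_zero, zero_add, add_zero] at h1 h2
    exact ⟨by rw [h1, Complex.ofReal_zero], by rw [h2, Complex.ofReal_zero]⟩
  have hre : ‖(ℜ a : A)‖ ≤ 0 := norm_le_of_forall_state fun φ => by rw [(key φ).1, norm_zero]
  have him : ‖(ℑ a : A)‖ ≤ 0 := norm_le_of_forall_state fun φ => by rw [(key φ).2, norm_zero]
  rw [← realPart_add_I_smul_imaginaryPart a, norm_le_zero_iff.1 hre,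
    norm_le_zero_iff.1 him, smul_zero, add_zero]

lemma eq_of_forall_state {a b : A} (h : ∀ φ : StateSpace A, φ.1 a = φ.1 b) : a = b :=
  sub_eq_zero.1 <| eq_zero_of_forall_state fun φ => by rw [map_sub, h, sub_self]

end States

/-! ### States of a product -/

section Prod

variable {A B : Type u} [CStarAlgebra A] [CStarAlgebra B]

/-- Normalization of a nonzero positive functional. -/
lemma exists_state_of_positive [Nontrivial A] (f : A →ₗ[ℂ] ℂ)
    (hf : ∀ a : A, 0 ≤ (f (star a * a)).re ∧ (f (star a * a)).im = 0) :
    ∃ φ : StateSpace A, ∀ a, f a = (f 1).re * φ.1 a := by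
  have h1 : (0 : ℝ) ≤ (f 1).re := by simpa using (hf 1).1
  have h1' : (f 1).im = 0 := by simpa using (hf 1).2
  obtain h0 | h0 := h1.eq_or_lt
  · refine ⟨Classical.arbitrary _, fun a => ?_⟩
    have := positive_norm_apply_le f hf a
    rw [← h0, mul_zero, norm_le_zero_iff] at this
    simp [this, ← h0]
  · have hne : ((f 1).re : ℂ) ≠ 0 := by exact_mod_cast h0.ne'
    let g : StrongDual ℂ A := LinearMap.mkContinuous (((f 1).re : ℂ)⁻¹ • f) 1 fun a => by
      have := positive_norm_apply_le f hf a
      rw [LinearMap.smul_apply, norm_smul, norm_inv, Complex.norm_real, Real.norm_of_nonneg h1,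
        one_mul, inv_mul_le_iff₀ h0, mul_comm]
      exact this
    refine ⟨⟨StrongDual.toWeakDual g, ?_, fun a => ?_⟩, fun a => ?_⟩
    · change ((f 1).re : ℂ)⁻¹ * f 1 = 1
      rw [inv_mul_eq_one₀ hne]
      exact Complex.ext (by simp) (by simp [h1'])
    · change 0 ≤ (((f 1).re : ℂ)⁻¹ * f (star a * a)).re ∧ (((f 1).re : ℂ)⁻¹ * f (star a * a)).im = 0
      rw [← Complex.ofReal_inv, Complex.re_ofReal_mul, Complex.im_ofReal_mul, (hf a).2, mul_zero]
      exact ⟨mul_nonneg (inv_nonneg.2 h1) (hf a).1, rfl⟩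
    · change f a = (f 1).re * (((f 1).re : ℂ)⁻¹ * f a)
      field_simp

/-- The restrictions to the two summands are positive functionals whose masses add up to `1`; each
is its mass times a state. A summand of mass zero receives an arbitrary state. -/
lemma exists_state_prod_decomp [Nontrivial A] [Nontrivial B] (φ : StateSpace (A × B)) :
    ∃ (t : ℝ) (φ₁ : StateSpace A) (φ₂ : StateSpace B), 0 ≤ t ∧ t ≤ 1 ∧
      ∀ a : A × B, φ.1 a = t * φ₁.1 a.1 + (1 - t : ℝ) * φ₂.1 a.2 := by
  let f := (WeakDual.toStrongDual φ.1).toLinearMap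
  let f₁ : A →ₗ[ℂ] ℂ := f ∘ₗ LinearMap.inl ℂ A B
  let f₂ : B →ₗ[ℂ] ℂ := f ∘ₗ LinearMap.inr ℂ A B
  have h₁ : ∀ a : A, 0 ≤ (f₁ (star a * a)).re ∧ (f₁ (star a * a)).im = 0 := fun a => by
    simpa [f₁, f, Prod.star_def] using φ.2.2 (a, 0)
  have h₂ : ∀ a : B, 0 ≤ (f₂ (star a * a)).re ∧ (f₂ (star a * a)).im = 0 := fun a => by
    simpa [f₂, f, Prod.star_def] using φ.2.2 (0, a)
  obtain ⟨φ₁, hφ₁⟩ := exists_state_of_positive f₁ h₁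
  obtain ⟨φ₂, hφ₂⟩ := exists_state_of_positive f₂ h₂
  have hsum : ∀ a : A × B, φ.1 a = f₁ a.1 + f₂ a.2 := fun a => by
    have : a = (a.1, 0) + (0, a.2) := by simp
    conv_lhs => rw [this, map_add]
    rfl
  have hone : (f₁ 1).re + (f₂ 1).re = 1 := by
    have := hsum 1
    rw [φ.2.1] at this
    simpa using (congrArg Complex.re this).symm
  have p₁ : 0 ≤ (f₁ 1).re := by simpa using (h₁ 1).1
  have p₂ : 0 ≤ (f₂ 1).re := by simpa using (h₂ 1).1
  refine ⟨(f₁ 1).re, φ₁, φ₂, p₁, by linarith, fun a => ?_⟩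
  rw [hsum, hφ₁, hφ₂ a.2, ← hone]
  congr 3
  ring

/-- Convex combinations of states. -/
def StateSpace.convexComb (t : ℝ) (h0 : 0 ≤ t) (h1 : t ≤ 1) (φ ψ : StateSpace A) :
    StateSpace A :=
  ⟨StrongDual.toWeakDual ((t : ℂ) • WeakDual.toStrongDual φ.1 +
      ((1 - t : ℝ) : ℂ) • WeakDual.toStrongDual ψ.1), by
    constructor
    · change (t : ℂ) * φ.1 1 + ((1 - t : ℝ) : ℂ) * ψ.1 1 = 1
      rw [φ.2.1, ψ.2.1]
      push_cast
      ring
    · intro a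
      change 0 ≤ ((t : ℂ) * φ.1 (star a * a) + ((1 - t : ℝ) : ℂ) * ψ.1 (star a * a)).re ∧
        ((t : ℂ) * φ.1 (star a * a) + ((1 - t : ℝ) : ℂ) * ψ.1 (star a * a)).im = 0
      rw [Complex.add_re, Complex.add_im, Complex.re_ofReal_mul, Complex.re_ofReal_mul,
        Complex.im_ofReal_mul, Complex.im_ofReal_mul, (φ.2.2 a).2, (ψ.2.2 a).2]
      exact ⟨add_nonneg (mul_nonneg h0 (φ.2.2 a).1)
        (mul_nonneg (sub_nonneg.2 h1) (ψ.2.2 a).1), by simp⟩⟩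

lemma StateSpace.convexComb_apply (t : ℝ) (h0 : 0 ≤ t) (h1 : t ≤ 1) (φ ψ : StateSpace A) (a : A) :
    (StateSpace.convexComb t h0 h1 φ ψ).1 a = t * φ.1 a + (1 - t : ℝ) * ψ.1 a := rfl

lemma StateSpace.comp_apply (φ : StateSpace B) (π : A →⋆ₐ[ℂ] B) (a : A) :
    (φ.comp π).1 a = φ.1 (π a) := rfl

end Prod

end

section

/-! ### Sublevel sets of extended seminorms -/

section Sublevel

variable {E : Type*} [AddCommGroup E] [Module ℝ E] {N : E → ℝ≥0∞}

lemma inv_smul_le_one_iff (hs : ∀ (t : ℝ) (a : E), N (t • a) = ‖t‖ₑ * N a) {l : ℝ≥0} (hl : 0 < l)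
    (a : E) : N ((l : ℝ)⁻¹ • a) ≤ 1 ↔ N a ≤ l := by
  have h0 : (l : ℝ≥0∞) ≠ 0 := by exact_mod_cast hl.ne'
  have h : ‖((l : ℝ)⁻¹ : ℝ)‖ₑ = (l : ℝ≥0∞)⁻¹ := by
    rw [← ENNReal.coe_inv hl.ne', ← NNReal.coe_inv, enorm_eq_nnnorm, NNReal.nnnorm_eq]
  rw [hs, h, ENNReal.inv_mul_le_iff h0 ENNReal.coe_ne_top, mul_one]

variable [TopologicalSpace E] [ContinuousConstSMul ℝ E]

lemma isClosed_sublevel (hs : ∀ (t : ℝ) (a : E), N (t • a) = ‖t‖ₑ * N a)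
    (hc : IsClosed {a | N a ≤ 1}) {l : ℝ≥0} (hl : 0 < l) : IsClosed {a | N a ≤ l} := by
  have : {a | N a ≤ l} = (fun a => (l : ℝ)⁻¹ • a) ⁻¹' {a | N a ≤ 1} := by
    ext a
    exact (inv_smul_le_one_iff hs hl a).symm
  rw [this]
  exact hc.preimage (continuous_const_smul _)

/-- Closedness of the unit ball and homogeneity give lower semicontinuity. The bound is asked for
every `r > l` because the lifts used later are only nearly optimal; it also keeps the radii positive
when `l = 0`. -/
lemma le_of_tendsto_of_isClosed (hs : ∀ (t : ℝ) (a : E), N (t • a) = ‖t‖ₑ * N a)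
    (hc : IsClosed {a | N a ≤ 1}) {ι : Type*} {𝓕 : Filter ι} [𝓕.NeBot] {f : ι → E} {a : E}
    (hf : Filter.Tendsto f 𝓕 (𝓝 a)) {l : ℝ≥0∞} (h : ∀ r, l < r → ∀ᶠ i in 𝓕, N (f i) ≤ r) :
    N a ≤ l := by
  refine le_of_forall_gt fun r hr => ?_
  obtain ⟨r', h1, h2⟩ := ENNReal.lt_iff_exists_nnreal_btwn.1 hr
  have hpos : 0 < r' := by exact_mod_cast lt_of_le_of_lt (zero_le (a := l)) h1
  exact lt_of_le_of_lt ((isClosed_sublevel hs hc hpos).mem_of_tendsto hf (h _ h1)) h2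

end Sublevel

/-! ### Monge-Kantorovich distances -/

section MK

variable {A : Type u} [CStarAlgebra A]

instance : CompleteSpace (selfAdjoint A) :=
  IsClosed.completeSpace_coe (hs := isClosed_eq continuous_star continuous_id)

variable {L : selfAdjoint A → ℝ≥0∞} {φ ψ χ : StateSpace A}

lemma enorm_sub_le_mkState {a : selfAdjoint A} (ha : L a ≤ 1) :
    ‖φ.1 (a : A) - ψ.1 (a : A)‖ₑ ≤ mkState L φ ψ :=
  le_iSup₂ (f := fun (a : selfAdjoint A) (_ : L a ≤ 1) => ‖φ.1 (a : A) - ψ.1 (a : A)‖ₑ) a ha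

lemma mkState_le_iff {r : ℝ≥0∞} : mkState L φ ψ ≤ r ↔
    ∀ a : selfAdjoint A, L a ≤ 1 → ‖φ.1 (a : A) - ψ.1 (a : A)‖ₑ ≤ r :=
  iSup₂_le_iff

lemma mkState_self : mkState L φ φ = 0 := by
  simp [mkState]

lemma mkState_triangle : mkState L φ χ ≤ mkState L φ ψ + mkState L ψ χ := by
  refine mkState_le_iff.2 fun a ha => ?_
  rw [← sub_add_sub_cancel (φ.1 (a : A)) (ψ.1 (a : A))]
  exact (enorm_add_le _ _).trans
    (add_le_add (enorm_sub_le_mkState ha) (enorm_sub_le_mkState ha))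

lemma enorm_sub_le_mul_mkState (hs : ∀ (t : ℝ) (a : selfAdjoint A), L (t • a) = ‖t‖ₑ * L a)
    {l : ℝ≥0} (hl : 0 < l) {a : selfAdjoint A} (ha : L a ≤ l) :
    ‖φ.1 (a : A) - ψ.1 (a : A)‖ₑ ≤ l * mkState L φ ψ := by
  have h := enorm_sub_le_mkState (φ := φ) (ψ := ψ) ((inv_smul_le_one_iff hs hl a).2 ha)
  have h0 : ((l : ℝ) : ℂ) ≠ 0 := by exact_mod_cast hl.ne'
  have key : φ.1 (a : A) - ψ.1 (a : A) = ((l : ℝ) : ℂ) •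
      (φ.1 (((l : ℝ)⁻¹ • a : selfAdjoint A) : A) - ψ.1 (((l : ℝ)⁻¹ • a : selfAdjoint A) : A)) := by
    rw [selfAdjoint.val_smul, ← Complex.coe_smul, map_smul, map_smul, ← smul_sub, smul_smul,
      Complex.ofReal_inv, mul_inv_cancel₀ h0, one_smul]
  rw [key, enorm_smul]
  refine mul_le_mul (le_of_eq ?_) h bot_le bot_le
  rw [enorm_eq_nnnorm, Complex.nnnorm_real, NNReal.nnnorm_eq]

/-- The algebraic axioms of the Lipschitz seminorms. -/
structure IsLipSeminorm (L : selfAdjoint A → ℝ≥0∞) : Prop where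
  smul : ∀ (t : ℝ) (a : selfAdjoint A), L (t • a) = ‖t‖ₑ * L a
  add_le : ∀ a b, L (a + b) ≤ L a + L b
  one : L 1 = 0

namespace IsLipSeminorm

variable (hL : IsLipSeminorm L)
include hL

lemma neg (a : selfAdjoint A) : L (-a) = L a := by
  simpa using hL.smul (-1) a

lemma zero : L 0 = 0 := by simpa using hL.smul 0 0

lemma add_smul_one_le (a : selfAdjoint A) (c : ℝ) : L (a + c • (1 : selfAdjoint A)) ≤ L a := by
  refine (hL.add_le _ _).trans ?_
  rw [hL.smul, hL.one, mul_zero, add_zero]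

end IsLipSeminorm

/-- Subtract from a self-adjoint element its value at a state. -/
def center (μ : StateSpace A) (a : selfAdjoint A) : selfAdjoint A :=
  a + (-(μ.1 (a : A)).re) • (1 : selfAdjoint A)

lemma coe_center (μ : StateSpace A) (a : selfAdjoint A) :
    (center μ a : A) = a - μ.1 (a : A) • (1 : A) := by
  rw [← StateSpace.ofReal_re_apply μ a]
  simp [center, sub_eq_add_neg]

lemma state_center (μ : StateSpace A) (a : selfAdjoint A) :
    φ.1 (center μ a : A) = φ.1 (a : A) - μ.1 (a : A) := by
  rw [coe_center, map_sub, map_smul, φ.2.1, smul_eq_mul, mul_one]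

lemma IsLipSeminorm.center_le (hL : IsLipSeminorm L) (μ : StateSpace A) (a : selfAdjoint A) :
    L (center μ a) ≤ L a :=
  hL.add_smul_one_le _ _

/-- The part of the unit ball of `L` where a given state vanishes. -/
def centeredBall (L : selfAdjoint A → ℝ≥0∞) (μ : StateSpace A) : Set (selfAdjoint A) :=
  {a | L a ≤ 1 ∧ μ.1 (a : A) = 0}

lemma IsLipSeminorm.center_mem (hL : IsLipSeminorm L) (μ : StateSpace A) {a : selfAdjoint A}
    (ha : L a ≤ 1) : center μ a ∈ centeredBall L μ :=
  ⟨(hL.center_le μ a).trans ha, by rw [state_center, sub_self]⟩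

/-- Subtracting a scalar changes neither the difference of two states nor, by more than it
decreases, the seminorm. Testing on the centered ball suffices, and that set can be totally bounded
while the unit ball is not. -/
lemma mkState_le_of_centeredBall (hL : IsLipSeminorm L) (μ : StateSpace A) {r : ℝ≥0∞}
    (h : ∀ a ∈ centeredBall L μ, ‖φ.1 (a : A) - ψ.1 (a : A)‖ₑ ≤ r) : mkState L φ ψ ≤ r := by
  refine mkState_le_iff.2 fun a ha => ?_
  have := h _ (hL.center_mem μ ha)
  rwa [state_center, state_center, sub_sub_sub_cancel_right] at this

lemma exists_mkState_le (hL : IsLipSeminorm L) {μ : StateSpace A}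
    (hB : TotallyBounded (centeredBall L μ)) : ∃ R : ℝ≥0, ∀ φ ψ, mkState L φ ψ ≤ R := by
  obtain ⟨R, hR⟩ := hB.isBounded.exists_norm_le
  refine ⟨(2 * R).toNNReal, fun φ ψ => mkState_le_of_centeredBall hL μ fun a ha => ?_⟩
  rw [enorm_eq_nnnorm, ENNReal.coe_le_coe, ← norm_toNNReal]
  refine Real.toNNReal_mono ((norm_sub_le _ _).trans ?_)
  have h1 : ‖(a : A)‖ ≤ R := hR a ha
  linarith [φ.norm_apply_le (a : A), ψ.norm_apply_le (a : A)]

/-- A weak* neighbourhood controls the finitely many points of a `δ / 3`-net; states are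
contractive, so the rest of the centered ball follows. -/
lemma eventually_mkState_lt (hL : IsLipSeminorm L) {μ : StateSpace A}
    (hB : TotallyBounded (centeredBall L μ)) (φ : StateSpace A) {ε : ℝ≥0∞} (hε : 0 < ε) :
    ∀ᶠ ψ in 𝓝 φ, mkState L ψ φ < ε := by
  obtain ⟨δ, hδ0, hδ⟩ := ENNReal.lt_iff_exists_nnreal_btwn.1 hε
  have hδ0 : (0 : ℝ) < δ := by exact_mod_cast hδ0
  obtain ⟨t, htf, ht⟩ := Metric.totallyBounded_iff.1 hB (δ / 3) (by positivity)
  have hev : ∀ᶠ ψ in 𝓝 φ, ∀ y ∈ t, ‖ψ.1 (y : A) - φ.1 (y : A)‖ < δ / 3 := by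
    refine (Filter.eventually_all_finite htf).2 fun y _ => ?_
    have := (StateSpace.continuous_eval (y : A)).tendsto φ
    simpa [dist_eq_norm] using (Metric.tendsto_nhds.1 this) (δ / 3) (by positivity)
  filter_upwards [hev] with ψ hψ
  refine lt_of_le_of_lt (mkState_le_of_centeredBall hL μ fun a ha => ?_) hδ
  obtain ⟨y, hy, hay⟩ := Set.mem_iUnion₂.1 (ht ha)
  rw [enorm_eq_nnnorm, ENNReal.coe_le_coe, ← NNReal.coe_le_coe, coe_nnnorm]
  have h1 : ‖(a : A) - y‖ < δ / 3 := by simpa [dist_eq_norm] using! hay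
  have h2 := ψ.norm_apply_le ((a : A) - y)
  have h3 := φ.norm_apply_le ((a : A) - y)
  have h4 : ψ.1 (a : A) - φ.1 (a : A) = ψ.1 ((a : A) - y) - φ.1 ((a : A) - y) +
      (ψ.1 (y : A) - φ.1 (y : A)) := by
    rw [map_sub, map_sub]; ring
  rw [h4]
  linarith [norm_add_le (ψ.1 ((a : A) - y) - φ.1 ((a : A) - y)) (ψ.1 (y : A) - φ.1 (y : A)),
    norm_sub_le (ψ.1 ((a : A) - y)) (φ.1 ((a : A) - y)), hψ y hy]

/-- Rieffel's criterion. Total boundedness makes the metric balls weak* neighbourhoods; density of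
the domain makes convergence for the metric imply weak* convergence. -/
lemma nhds_hasBasis_mkState (hL : IsLipSeminorm L) (hd : Dense {a | L a < ∞}) {μ : StateSpace A}
    (hB : TotallyBounded (centeredBall L μ)) (φ : StateSpace A) :
    (𝓝 φ).HasBasis (fun ε : ℝ≥0∞ => 0 < ε) (fun ε => {ψ | mkState L ψ φ < ε}) := by
  have hbasis : (⨅ ε ∈ {ε : ℝ≥0∞ | 0 < ε}, Filter.principal {ψ | mkState L ψ φ < ε}).HasBasis
      (fun ε : ℝ≥0∞ => 0 < ε) (fun ε => {ψ | mkState L ψ φ < ε}) := by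
    refine Filter.hasBasis_biInf_principal ?_ ⟨1, one_pos (α := ℝ≥0∞)⟩
    intro ε hε δ hδ
    exact ⟨min ε δ, (lt_min hε hδ : 0 < min ε δ), fun ψ (hψ : mkState L ψ φ < min ε δ) =>
        (lt_of_lt_of_le hψ (min_le_left ε δ) : mkState L ψ φ < ε),
      fun ψ (hψ : mkState L ψ φ < min ε δ) =>
        (lt_of_lt_of_le hψ (min_le_right ε δ) : mkState L ψ φ < δ)⟩
  convert hbasis
  refine le_antisymm (le_iInf₂ fun ε hε => ?_) ?_
  · exact Filter.le_principal_iff.2 (eventually_mkState_lt hL hB φ hε)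
  · set l := ⨅ ε ∈ {ε : ℝ≥0∞ | 0 < ε}, Filter.principal {ψ | mkState L ψ φ < ε}
    have hsa : ∀ a : selfAdjoint A,
        Filter.Tendsto (fun ψ : StateSpace A => ψ.1 (a : A)) l (𝓝 (φ.1 (a : A))) := by
      intro a
      refine Metric.tendsto_nhds.2 fun ε hε => ?_
      obtain ⟨b, hb, hab⟩ := Metric.dense_iff.1 hd a (ε / 4) (by positivity)
      have hab' : ‖(a : A) - b‖ < ε / 4 := by
        rw [← dist_eq_norm, dist_comm]; exact hb
      obtain ⟨m, hm⟩ := ENNReal.lt_iff_exists_coe.1 (show L b < ∞ from hab)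
      have hm1 : L b ≤ ((m + 1 : ℝ≥0) : ℝ≥0∞) := by
        rw [hm.1]; exact_mod_cast (le_add_of_nonneg_right zero_le_one)
      -- The radius is `ε / 4` divided by a bound of `L b`, where `m + 1` replaces `m` to be
      -- positive. The two errors from `a - b` and the one from `b` then sum to less than `ε`.
      have hpos : (0 : ℝ≥0∞) < ENNReal.ofReal (ε / (4 * (m + 1))) := by
        rw [ENNReal.ofReal_pos]; positivity
      filter_upwards [hbasis.mem_of_mem hpos] with ψ hψ
      have h1 := (enorm_sub_le_mul_mkState (φ := ψ) (ψ := φ) hL.smul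
        (l := m + 1) (by positivity) hm1).trans (mul_le_mul_right (le_of_lt hψ) _)
      rw [← ENNReal.ofReal_coe_nnreal, ← ENNReal.ofReal_mul (by positivity),
        ← ofReal_norm, ENNReal.ofReal_le_ofReal_iff (by positivity)] at h1
      have h1' : ((m + 1 : ℝ≥0) : ℝ) * (ε / (4 * (m + 1))) = ε / 4 := by
        push_cast; field_simp
      rw [h1'] at h1
      have h4 : ψ.1 (a : A) - φ.1 (a : A) = ψ.1 ((a : A) - b) - φ.1 ((a : A) - b) +
          (ψ.1 (b : A) - φ.1 (b : A)) := by
        rw [map_sub, map_sub]; ring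
      rw [dist_eq_norm, h4]
      linarith [norm_add_le (ψ.1 ((a : A) - b) - φ.1 ((a : A) - b)) (ψ.1 (b : A) - φ.1 (b : A)),
        norm_sub_le (ψ.1 ((a : A) - b)) (φ.1 ((a : A) - b)), ψ.norm_apply_le ((a : A) - b),
        φ.norm_apply_le ((a : A) - b)]
    refine Filter.tendsto_id'.1 (tendsto_subtype_rng.2 ?_)
    refine tendsto_iff_forall_eval_tendsto_topDualPairing.2 fun a => ?_
    have h := (hsa (ℜ a)).add ((hsa (ℑ a)).const_mul Complex.I)
    have hdec : ∀ ψ : StateSpace A, ψ.1 a = ψ.1 (ℜ a : A) + Complex.I * ψ.1 (ℑ a : A) := by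
      intro ψ
      conv_lhs => rw [← realPart_add_I_smul_imaginaryPart a]
      rw [map_add, map_smul, smul_eq_mul]
    simp only [← hdec] at h
    exact h

end MK

/-! ### Compactness in quantum compact metric spaces -/

namespace QuantumCMS

variable {F K : ℝ≥0} (Q : QuantumCMS.{u} F K)

lemma isLipSeminorm : IsLipSeminorm Q.lip := ⟨Q.lip_smul, Q.lip_add_le, Q.lip_one⟩

/-- The metric is only assumed finite pointwise. Compactness of the state space covers it with
finitely many metric balls of radius `1`, which gives a uniform bound. -/
lemma exists_mkState_le_state (μ : StateSpace Q.carrier) :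
    ∃ R : ℝ≥0, ∀ φ, mkState Q.lip φ μ ≤ R := by
  obtain ⟨t, ht⟩ := isCompact_univ.elim_nhds_subcover
    (fun φ : StateSpace Q.carrier => {ψ | mkState Q.lip ψ φ < 1})
    (fun φ _ => (Q.mk_basis φ).mem_of_mem one_pos)
  have hfin : (1 + ∑ φ ∈ t, mkState Q.lip φ μ) < ∞ :=
    ENNReal.add_lt_top.2 ⟨ENNReal.one_lt_top, ENNReal.sum_lt_top.2 fun φ _ => Q.mk_lt_top _ _⟩
  refine ⟨(1 + ∑ φ ∈ t, mkState Q.lip φ μ).toNNReal, fun ψ => ?_⟩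
  rw [ENNReal.coe_toNNReal hfin.ne]
  obtain ⟨φ, hφ, hψ⟩ := Set.mem_iUnion₂.1 (ht.2 (Set.mem_univ ψ))
  exact mkState_triangle.trans (add_le_add (le_of_lt hψ)
    (Finset.single_le_sum (f := fun φ => mkState Q.lip φ μ) (fun _ _ => bot_le) hφ))

/-- Evaluation embeds the self-adjoint part isometrically in the continuous functions on the compact
state space. The image of the centered ball is bounded by the radius, and equicontinuous because the
metric induces the weak* topology; Arzelà-Ascoli applies. -/
lemma totallyBounded_centeredBall (μ : StateSpace Q.carrier) :
    TotallyBounded (centeredBall Q.lip μ) := by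
  obtain ⟨R, hR⟩ := Q.exists_mkState_le_state μ
  let Ψ : selfAdjoint Q.carrier → BoundedContinuousFunction (StateSpace Q.carrier) ℂ := fun a =>
    BoundedContinuousFunction.mkOfCompact
      ⟨fun φ => φ.1 (a : Q.carrier), StateSpace.continuous_eval _⟩
  have hΨ : Isometry Ψ := by
    refine Isometry.of_dist_eq fun a b => le_antisymm ?_ ?_
    · refine (BoundedContinuousFunction.dist_le dist_nonneg).2 fun φ => ?_
      rw [dist_eq_norm, dist_eq_norm]
      change ‖φ.1 (a : Q.carrier) - φ.1 (b : Q.carrier)‖ ≤ ‖(a : Q.carrier) - b‖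
      rw [← map_sub]
      exact φ.norm_apply_le _
    · have : ‖((a - b : selfAdjoint Q.carrier) : Q.carrier)‖ ≤ dist (Ψ a) (Ψ b) := by
        refine norm_le_of_forall_state fun φ => ?_
        rw [AddSubgroupClass.coe_sub, map_sub, ← dist_eq_norm]
        exact BoundedContinuousFunction.dist_coe_le_dist (f := Ψ a) (g := Ψ b) φ
      rw [dist_eq_norm]
      exact this
  rw [← totallyBounded_image_iff hΨ.isUniformInducing]
  refine TotallyBounded.subset subset_closure
    (BoundedContinuousFunction.arzela_ascoli (Metric.closedBall (0 : ℂ) R)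
      (isCompact_closedBall _ _) _ ?_ ?_).totallyBounded
  · rintro _ φ ⟨a, ha, rfl⟩
    have h := (enorm_sub_le_mkState (φ := φ) (ψ := μ) ha.1).trans (hR φ)
    rw [ha.2, sub_zero, enorm_eq_nnnorm, ENNReal.coe_le_coe] at h
    rw [mem_closedBall_zero_iff]
    exact h
  · intro φ
    refine Metric.equicontinuousAt_iff_right.2 fun ε hε => ?_
    filter_upwards [(Q.mk_basis φ).mem_of_mem (ENNReal.ofReal_pos.2 hε)] with ψ hψ
    rintro ⟨_, a, ha, rfl⟩
    have h := (enorm_sub_le_mkState (φ := ψ) (ψ := φ) ha.1).trans_lt hψ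
    rw [← ofReal_norm, ENNReal.ofReal_lt_ofReal_iff hε] at h
    rw [dist_comm, dist_eq_norm]
    exact h

lemma exists_mkState_le : ∃ R : ℝ≥0, ∀ φ ψ, mkState Q.lip φ ψ ≤ R :=
  OpPropinquity.exists_mkState_le Q.isLipSeminorm
    (Q.totallyBounded_centeredBall (Classical.arbitrary _))

lemma totallyBounded_sublevel (l : ℝ≥0) (r : ℝ) :
    TotallyBounded {a : selfAdjoint Q.carrier | Q.lip a ≤ l ∧ ‖(a : Q.carrier)‖ ≤ r} := by
  let μ : StateSpace Q.carrier := Classical.arbitrary _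
  -- An element of the sublevel set is a multiple of an element of the centered ball plus a scalar
  -- in `[-r, r]`. The multiple is `l + 1` rather than `l` so that it can be inverted.
  let f : selfAdjoint Q.carrier × ℝ →L[ℝ] selfAdjoint Q.carrier :=
    ((l + 1 : ℝ≥0) : ℝ) • ContinuousLinearMap.fst ℝ _ _ +
      (ContinuousLinearMap.toSpanSingleton ℝ 1).comp (ContinuousLinearMap.snd ℝ _ _)
  have hf : UniformContinuous f := f.uniformContinuous
  have hfa : ∀ p, f p = ((l + 1 : ℝ≥0) : ℝ) • p.1 + p.2 • (1 : selfAdjoint Q.carrier) :=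
    fun _ => rfl
  have hc : IsCompact (closure (centeredBall Q.lip μ)) :=
    (Q.totallyBounded_centeredBall μ).closure.isCompact_of_isClosed isClosed_closure
  refine TotallyBounded.subset ?_ ((hc.prod
    (isCompact_closedBall (0 : ℝ) r)).totallyBounded.image hf)
  rintro a ⟨ha, har⟩
  have hpos : 0 < l + 1 := by positivity
  have hle : Q.lip (center μ a) ≤ ((l + 1 : ℝ≥0) : ℝ≥0∞) :=
    (Q.isLipSeminorm.center_le μ a).trans
      (ha.trans (by exact_mod_cast (le_add_of_nonneg_right zero_le_one)))
  refine ⟨(((l + 1 : ℝ≥0) : ℝ)⁻¹ • center μ a, (μ.1 (a : Q.carrier)).re), ⟨subset_closure ⟨?_, ?_⟩, ?_⟩, ?_⟩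
  · exact (inv_smul_le_one_iff Q.lip_smul hpos _).2 hle
  · rw [selfAdjoint.val_smul, ← Complex.coe_smul, map_smul, state_center, sub_self, smul_zero]
  · rw [mem_closedBall_zero_iff]
    exact (Complex.abs_re_le_norm _).trans ((μ.norm_apply_le _).trans har)
  · have h0 : ((l + 1 : ℝ≥0) : ℝ) ≠ 0 := by exact_mod_cast hpos.ne'
    simp only [hfa, smul_smul, mul_inv_cancel₀ h0, one_smul, center]
    rw [neg_smul, neg_add_cancel_right]

lemma isCompact_sublevel (l : ℝ≥0) (hl : 0 < l) (r : ℝ) :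
    IsCompact {a : selfAdjoint Q.carrier | Q.lip a ≤ l ∧ ‖(a : Q.carrier)‖ ≤ r} := by
  refine (Q.totallyBounded_sublevel l r).isCompact_of_isClosed ?_
  exact (isClosed_sublevel Q.lip_smul Q.isClosed_ball hl).inter
    (isClosed_le continuous_subtype_val.norm continuous_const)

end QuantumCMS

end

section

/-! ### Hilbert modules -/

section HilbertModule

variable {B M : Type u} [CStarAlgebra B] [NormedAddCommGroup M] [NormedSpace ℂ M]
    [Module Bᵐᵒᵖ M] [CompleteSpace M] [HilbertModule B M]

local notation "⟪" x ", " y "⟫" => HilbertModule.inner (B := B) x y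

/-- A right Hilbert module, seen as a module over the opposite algebra in Mathlib's sense. -/
@[reducible]
def HilbertModule.toCStarModule : @CStarModule Bᵐᵒᵖ M _ _ _ _ _
    (CStarAlgebra.spectralOrder Bᵐᵒᵖ) _ _ _ :=
  let _ := CStarAlgebra.spectralOrder Bᵐᵒᵖ
  have := CStarAlgebra.spectralOrderedRing Bᵐᵒᵖ
  { inner := fun x y => MulOpposite.op ⟪x, y⟫
    inner_add_right := by
      intro x y z
      rw [HilbertModule.inner_add_right, MulOpposite.op_add]
    inner_self_nonneg := by
      intro x
      obtain ⟨b, hb⟩ := HilbertModule.inner_self_nonneg (B := B) x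
      rw [hb, MulOpposite.op_mul, MulOpposite.op_star]
      exact mul_star_self_nonneg _
    inner_self := by
      intro x
      rw [MulOpposite.op_eq_zero_iff, HilbertModule.inner_self_eq_zero]
    inner_op_smul_right := by
      intro a x y
      have := HilbertModule.inner_op_smul_right (MulOpposite.unop a) x y
      rw [MulOpposite.op_unop] at this
      rw [this, MulOpposite.op_mul, MulOpposite.op_unop]
    inner_smul_right_complex := by
      intro z x y
      rw [HilbertModule.inner_smul_right, MulOpposite.op_smul]
    star_inner := by
      intro x y
      rw [← MulOpposite.op_star, HilbertModule.star_inner]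
    norm_eq_sqrt_norm_inner_self := by
      intro x
      rw [HilbertModule.norm_eq (B := B) x, MulOpposite.norm_op] }

namespace HilbertModule

lemma inner_add_left (x y z : M) : ⟪x + y, z⟫ = ⟪x, z⟫ + ⟪y, z⟫ := by
  rw [← star_inner, inner_add_right, star_add, star_inner, star_inner]

lemma inner_sub_right (x y z : M) : ⟪x, y - z⟫ = ⟪x, y⟫ - ⟪x, z⟫ := by
  rw [eq_sub_iff_add_eq, ← inner_add_right, sub_add_cancel]

lemma inner_sub_left (x y z : M) : ⟪x - y, z⟫ = ⟪x, z⟫ - ⟪y, z⟫ := by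
  rw [eq_sub_iff_add_eq, ← inner_add_left, sub_add_cancel]

lemma norm_sq_eq (x : M) : ‖x‖ ^ 2 = ‖⟪x, x⟫‖ := by
  rw [norm_eq (B := B) x, Real.sq_sqrt (norm_nonneg _)]

lemma norm_inner_le (x y : M) : ‖⟪x, y⟫‖ ≤ ‖x‖ * ‖y‖ := by
  let _ := CStarAlgebra.spectralOrder Bᵐᵒᵖ
  have := CStarAlgebra.spectralOrderedRing Bᵐᵒᵖ
  let _ : CStarModule Bᵐᵒᵖ M := toCStarModule
  exact CStarModule.norm_inner_le (A := Bᵐᵒᵖ) M (x := x) (y := y)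

lemma continuous_inner : Continuous fun x : M × M => ⟪x.1, x.2⟫ := by
  refine continuous_iff_continuousAt.2 fun x => ?_
  refine tendsto_iff_norm_sub_tendsto_zero.2 ?_
  have hbound : Filter.Tendsto (fun y : M × M => ‖y.1 - x.1‖ * ‖y.2‖ + ‖x.1‖ * ‖y.2 - x.2‖) (𝓝 x)
      (𝓝 (‖x.1 - x.1‖ * ‖x.2‖ + ‖x.1‖ * ‖x.2 - x.2‖)) :=
    Continuous.tendsto (by fun_prop) x
  simp only [sub_self, norm_zero, zero_mul, mul_zero, add_zero] at hbound
  refine squeeze_zero (fun _ => norm_nonneg _) (fun y => ?_) hbound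
  have : ⟪y.1, y.2⟫ - ⟪x.1, x.2⟫ = ⟪y.1 - x.1, y.2⟫ + ⟪x.1, y.2 - x.2⟫ := by
    rw [inner_sub_left, inner_sub_right]; abel
  rw [this]
  exact (norm_add_le _ _).trans (add_le_add (norm_inner_le _ _) (norm_inner_le _ _))

variable (B) in
lemma eq_zero_of_forall_inner {x : M} (h : ∀ y : M, ⟪y, x⟫ = 0) : x = 0 :=
  (inner_self_eq_zero (B := B) x).1 (h x)

end HilbertModule

/-- A *-representation by adjointable operators is contractive. -/
lemma norm_rep_apply_le {A : Type u} [CStarAlgebra A] (π : A →ₐ[ℂ] (M →L[ℂ] M))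
    (hπ : ∀ a, IsAdjointPair B M (π a) (π (star a))) (a : A) (ω : M) :
    ‖π a ω‖ ≤ ‖a‖ * ‖ω‖ := by
  let _ := CStarAlgebra.spectralOrder B
  have := CStarAlgebra.spectralOrderedRing B
  -- With `star c * c = ‖star a * a‖ - star a * a`, positivity of the inner square of `π c ω` reads
  -- `⟪π a ω, π a ω⟫ ≤ ‖a‖ ^ 2 ⟪ω, ω⟫`.
  obtain ⟨c, hc⟩ := exists_star_mul_self_eq_norm_sub (IsSelfAdjoint.star_mul_self a)
  have hin : ∀ x : A, ⟪π x ω, π x ω⟫ = ⟪ω, π (star x * x) ω⟫ := fun x => by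
    rw [hπ x, map_mul]; rfl
  have hnn : ∀ η : M, 0 ≤ ⟪η, η⟫ := fun η => by
    obtain ⟨b, hb⟩ := HilbertModule.inner_self_nonneg (B := B) η
    exact hb ▸ star_mul_self_nonneg b
  have h1 : ⟪π a ω, π a ω⟫ ≤ (‖star a * a‖ : ℂ) • ⟪ω, ω⟫ := by
    have h2 := hnn (π c ω)
    rw [hin c, hc, map_sub, map_smul, map_one, sub_apply,
      HilbertModule.inner_sub_right, smul_apply,
      HilbertModule.inner_smul_right, one_apply_eq_self, sub_nonneg] at h2
    rwa [hin a]
  have h3 := CStarAlgebra.norm_le_norm_of_nonneg_of_le (hnn _) h1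
  rw [norm_smul, ← HilbertModule.norm_sq_eq, ← HilbertModule.norm_sq_eq, Complex.norm_real,
    norm_norm, CStarRing.norm_star_mul_self, ← sq, ← mul_pow] at h3
  exact le_of_sq_le_sq h3 (by positivity)

end HilbertModule

/-! ### Metrical C*-correspondences -/

namespace MetricalCorr

variable {F K G H : ℝ≥0} (X : MetricalCorr.{u} F K G H)

lemma norm_lact_le (a : X.A) (ω : X.M) : ‖X.lact a ω‖ ≤ ‖a‖ * ‖ω‖ :=
  norm_rep_apply_le X.lact X.lact_star a ω

lemma continuous_lact : Continuous fun p : X.A.carrier × X.M => X.lact p.1 p.2 := by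
  refine continuous_iff_continuousAt.2 fun x => ?_
  refine tendsto_iff_norm_sub_tendsto_zero.2 ?_
  have hbound : Filter.Tendsto
      (fun y : X.A.carrier × X.M => ‖y.1 - x.1‖ * ‖y.2‖ + ‖x.1‖ * ‖y.2 - x.2‖) (𝓝 x)
      (𝓝 (‖x.1 - x.1‖ * ‖x.2‖ + ‖x.1‖ * ‖x.2 - x.2‖)) :=
    Continuous.tendsto (by fun_prop) x
  simp only [sub_self, norm_zero, zero_mul, mul_zero, add_zero] at hbound
  refine squeeze_zero (fun _ => norm_nonneg _) (fun y => ?_) hbound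
  have : X.lact y.1 y.2 - X.lact x.1 x.2 = X.lact (y.1 - x.1) y.2 + X.lact x.1 (y.2 - x.2) := by
    rw [map_sub, map_sub, sub_apply]; abel
  rw [this]
  exact (norm_add_le _ _).trans (add_le_add (X.norm_lact_le _ _) (X.norm_lact_le _ _))

lemma dnorm_smul_real (t : ℝ) (ω : X.M) : X.dnorm (t • ω) = ‖t‖ₑ * X.dnorm ω := by
  rw [← Complex.coe_smul, X.dnorm_smul, enorm_eq_nnnorm, Complex.nnnorm_real, enorm_eq_nnnorm]

lemma dnorm_zero : X.dnorm 0 = 0 := by simpa using X.dnorm_smul 0 0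

lemma norm_le_of_dnorm_le {ω : X.M} {l : ℝ≥0} (h : X.dnorm ω ≤ l) : ‖ω‖ ≤ l := by
  have := (X.norm_le_dnorm ω).trans h
  rw [enorm_eq_nnnorm, ENNReal.coe_le_coe] at this
  exact_mod_cast this

lemma norm_le_one {ω : X.M} (h : X.dnorm ω ≤ 1) : ‖ω‖ ≤ 1 :=
  X.norm_le_of_dnorm_le (l := 1) h

lemma isCompact_sublevel {l : ℝ≥0} (hl : 0 < l) : IsCompact {ω : X.M | X.dnorm ω ≤ l} := by
  have : {ω : X.M | X.dnorm ω ≤ l} = (fun ω => (l : ℝ) • ω) '' {ω | X.dnorm ω ≤ 1} := by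
    ext ω
    have h0 : (l : ℝ) ≠ 0 := by exact_mod_cast hl.ne'
    rw [Set.mem_ofPred_eq, ← inv_smul_le_one_iff X.dnorm_smul_real hl]
    constructor
    · exact fun h => ⟨_, h, smul_inv_smul₀ h0 ω⟩
    · rintro ⟨η, hη, rfl⟩
      simpa [inv_smul_smul₀ h0] using hη
  rw [this]
  exact X.isCompact_ball.image (continuous_const_smul _)

lemma norm_pseudoState_le (μ : StateSpace X.B) {ω : X.M} (hω : X.dnorm ω ≤ 1) (ξ : X.M) :
    ‖μ.1 (X.ip ω ξ)‖ ≤ ‖ξ‖ := by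
  refine (μ.norm_apply_le _).trans ((HilbertModule.norm_inner_le _ _).trans ?_)
  simpa using mul_le_mul_of_nonneg_right (X.norm_le_one hω) (norm_nonneg ξ)

/-- The pseudo-state associated with a state and a vector. -/
def pseudoState (μ : StateSpace X.B) (ω : X.M) : X.M →L[ℂ] ℂ :=
  LinearMap.mkContinuous
    { toFun := fun ξ => μ.1 (X.ip ω ξ)
      map_add' := fun x y => by simp only [ip, HilbertModule.inner_add_right, map_add]
      map_smul' := fun z x => by
        simp only [ip, HilbertModule.inner_smul_right, map_smul, RingHom.id_apply] } ‖ω‖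
    fun ξ => (μ.norm_apply_le _).trans (HilbertModule.norm_inner_le _ _)

lemma pseudoState_mem (μ : StateSpace X.B) {ω : X.M} (hω : X.dnorm ω ≤ 1) :
    X.pseudoState μ ω ∈ X.pseudoStates := ⟨μ, ω, hω, fun _ => rfl⟩

lemma pseudoStates_nonempty : X.pseudoStates.Nonempty :=
  ⟨_, X.pseudoState_mem (Classical.arbitrary _) (ω := 0) (by simp [X.dnorm_zero])⟩

end MetricalCorr

namespace LipschitzMorphism

variable {F K G H : ℝ≥0} {X Y : MetricalCorr.{u} F K G H} (Φ : LipschitzMorphism X Y)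

lemma norm_modMap_le (ω : X.M) : ‖Φ.modMap ω‖ ≤ ‖ω‖ := by
  refine le_of_sq_le_sq ?_ (norm_nonneg _)
  rw [HilbertModule.norm_sq_eq (B := Y.B.carrier), HilbertModule.norm_sq_eq (B := X.B.carrier)]
  change ‖Y.ip _ _‖ ≤ _
  rw [← Φ.map_ip]
  exact NonUnitalStarAlgHom.norm_apply_le _ _

end LipschitzMorphism

end

section

/-! ### Quotient seminorms -/

/-- `L'` is the quotient of `L` along `f`. -/
structure IsSeminormQuotient {S T : Type*} (f : S → T) (L : S → ℝ≥0∞) (L' : T → ℝ≥0∞) : Prop where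
  le : ∀ s, L' (f s) ≤ L s
  lift : ∀ t r, L' t < r → ∃ s, f s = t ∧ L s < r

namespace IsSeminormQuotient

variable {S T U : Type*} {f : S → T} {g : T → U} {L : S → ℝ≥0∞} {L' : T → ℝ≥0∞} {L'' : U → ℝ≥0∞}

/-- Infima over the domain are traded for strict lifts, since the infimum need not be attained. In
this form quotients compose directly, and elements of infinite seminorm need no separate treatment.
-/
lemma of_iInf (h1 : ∀ s, L s < ∞ → L' (f s) < ∞)
    (h2 : ∀ t, L' t < ∞ → L' t = ⨅ (s) (_ : L s < ∞) (_ : f s = t), L s) :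
    IsSeminormQuotient f L L' where
  le s := by
    obtain h | h := lt_or_ge (L s) ∞
    · rw [h2 _ (h1 s h)]
      exact iInf₂_le_of_le s h (iInf_le_of_le rfl le_rfl)
    · exact le_top.trans h
  lift t r hr := by
    rw [h2 t (hr.trans_le le_top)] at hr
    simp only [iInf_lt_iff] at hr
    obtain ⟨s, -, hs, hsr⟩ := hr
    exact ⟨s, hs, hsr⟩

variable (h : IsSeminormQuotient f L L')
include h

lemma lt_top (s : S) (hs : L s < ∞) : L' (f s) < ∞ := (h.le s).trans_lt hs

lemma eq_iInf (t : T) (_ : L' t < ∞) : L' t = ⨅ (s) (_ : L s < ∞) (_ : f s = t), L s := by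
  refine le_antisymm (le_iInf fun s => le_iInf₂ fun _ hst => hst ▸ h.le s) ?_
  refine le_of_forall_gt fun r hr => ?_
  obtain ⟨s, hs, hsr⟩ := h.lift t r hr
  exact (iInf₂_le_of_le s (hsr.trans_le le_top) (iInf_le_of_le hs le_rfl)).trans_lt hsr

lemma comp (h' : IsSeminormQuotient g L' L'') : IsSeminormQuotient (g ∘ f) L L'' where
  le s := (h'.le _).trans (h.le s)
  lift t r hr := by
    obtain ⟨s, hs, hsr⟩ := h'.lift t r hr
    obtain ⟨s', hs', hsr'⟩ := h.lift s r hsr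
    exact ⟨s', by rw [Function.comp, hs', hs], hsr'⟩

end IsSeminormQuotient

lemma isSeminormQuotient_of_surjective {S T : Type*} {f : S → T} {L : S → ℝ≥0∞} {L' : T → ℝ≥0∞}
    (hf : Function.Surjective f) (h : ∀ s, L' (f s) = L s) : IsSeminormQuotient f L L' where
  le s := (h s).le
  lift t r hr := by
    obtain ⟨s, rfl⟩ := hf t
    exact ⟨s, rfl, h s ▸ hr⟩

/-! ### Modular quantum isometries -/

variable {F K G H : ℝ≥0}

namespace ModularQuantumIsometry

variable {X Y Z : MetricalCorr.{u} F K G H}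

lemma left_quotient (Φ : ModularQuantumIsometry X Y) :
    IsSeminormQuotient (saMap Φ.leftMap) X.A.lip Y.A.lip :=
  .of_iInf Φ.left_dom Φ.left_quot

lemma right_quotient (Φ : ModularQuantumIsometry X Y) :
    IsSeminormQuotient (saMap Φ.rightMap) X.B.lip Y.B.lip :=
  .of_iInf Φ.right_dom Φ.right_quot

lemma mod_quotient (Φ : ModularQuantumIsometry X Y) :
    IsSeminormQuotient Φ.modMap X.dnorm Y.dnorm :=
  .of_iInf Φ.mod_dom Φ.mod_quot

/-- A modular quantum isometry, built from quotient properties. -/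
def ofQuotient (modMap : X.M →L[ℂ] Y.M) (leftMap : X.A →⋆ₐ[ℂ] Y.A) (rightMap : X.B →⋆ₐ[ℂ] Y.B)
    (map_lact : ∀ (a : X.A) (ω : X.M), modMap (X.lact a ω) = Y.lact (leftMap a) (modMap ω))
    (map_right : ∀ (b : X.B) (ω : X.M),
      modMap (MulOpposite.op b • ω) = MulOpposite.op (rightMap b) • modMap ω)
    (map_ip : ∀ ω η : X.M, rightMap (X.ip ω η) = Y.ip (modMap ω) (modMap η))
    (hl : IsSeminormQuotient (saMap leftMap) X.A.lip Y.A.lip)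
    (hr : IsSeminormQuotient (saMap rightMap) X.B.lip Y.B.lip)
    (hm : IsSeminormQuotient modMap X.dnorm Y.dnorm) : ModularQuantumIsometry X Y where
  modMap := modMap
  leftMap := leftMap
  rightMap := rightMap
  map_lact := map_lact
  map_right := map_right
  map_ip := map_ip
  left_dom := hl.lt_top
  right_dom := hr.lt_top
  mod_dom := hm.lt_top
  left_quot := hl.eq_iInf
  right_quot := hr.eq_iInf
  mod_quot := hm.eq_iInf

/-- The identity modular quantum isometry. -/
def refl (X : MetricalCorr.{u} F K G H) : ModularQuantumIsometry X X :=
  ofQuotient (ContinuousLinearMap.id ℂ X.M) (StarAlgHom.id ℂ X.A) (StarAlgHom.id ℂ X.B)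
    (fun _ _ => rfl) (fun _ _ => rfl) (fun _ _ => rfl)
    (isSeminormQuotient_of_surjective (fun a => ⟨a, rfl⟩) fun _ => rfl)
    (isSeminormQuotient_of_surjective (fun a => ⟨a, rfl⟩) fun _ => rfl)
    (isSeminormQuotient_of_surjective (fun a => ⟨a, rfl⟩) fun _ => rfl)

/-- The composition of modular quantum isometries. -/
def comp (Ψ : ModularQuantumIsometry Y Z) (Φ : ModularQuantumIsometry X Y) :
    ModularQuantumIsometry X Z :=
  ofQuotient (Ψ.modMap.comp Φ.modMap) (Ψ.leftMap.comp Φ.leftMap) (Ψ.rightMap.comp Φ.rightMap)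
    (fun a ω => by simp [Φ.map_lact, Ψ.map_lact]) (fun b ω => by simp [Φ.map_right, Ψ.map_right])
    (fun ω η => by simp [Φ.map_ip, Ψ.map_ip])
    (Φ.left_quotient.comp Ψ.left_quotient) (Φ.right_quotient.comp Ψ.right_quotient)
    (Φ.mod_quotient.comp Ψ.mod_quotient)

end ModularQuantumIsometry

/-! ### Hausdorff distances -/

section Hausdorff

variable {E : Type*} {d : E → E → ℝ≥0∞} {S T : Set E} {r : ℝ≥0∞}

lemma hausdorff_comm : hausdorff d S T = hausdorff d T S := max_comm _ _

lemma hausdorff_le (h₁ : ∀ x ∈ S, ∀ ε : ℝ≥0, 0 < ε → ∃ y ∈ T, d x y ≤ r + ε)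
    (h₂ : ∀ y ∈ T, ∀ ε : ℝ≥0, 0 < ε → ∃ x ∈ S, d y x ≤ r + ε) : hausdorff d S T ≤ r := by
  refine max_le (iSup₂_le fun x hx => ?_) (iSup₂_le fun y hy => ?_)
  · refine ENNReal.le_of_forall_pos_le_add fun ε hε _ => ?_
    obtain ⟨y, hy, hxy⟩ := h₁ x hx ε hε
    exact (iInf₂_le y hy).trans hxy
  · refine ENNReal.le_of_forall_pos_le_add fun ε hε _ => ?_
    obtain ⟨x, hx, hxy⟩ := h₂ y hy ε hε
    exact (iInf₂_le x hx).trans hxy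

lemma exists_le_of_hausdorff_le (h : hausdorff d S T ≤ r) (hr : r ≠ ∞) {x : E} (hx : x ∈ S)
    {ε : ℝ≥0} (hε : 0 < ε) : ∃ y ∈ T, d x y ≤ r + ε := by
  have h1 : ⨅ y ∈ T, d x y < r + ε :=
    ((le_iSup₂ (f := fun x (_ : x ∈ S) => ⨅ y ∈ T, d x y) x hx).trans
      ((le_max_left _ _).trans h)).trans_lt
      (ENNReal.lt_add_right hr (by exact_mod_cast hε.ne'))
  simp only [iInf_lt_iff] at h1
  obtain ⟨y, hy, hxy⟩ := h1
  exact ⟨y, hy, hxy.le⟩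

end Hausdorff

/-! ### The extent of a leg -/

/-- Every state is within `r`, up to an arbitrarily small error, of a state which factors
through `π`. -/
def StatesWithin {A D : Type u} [CStarAlgebra A] [CStarAlgebra D] (L : selfAdjoint D → ℝ≥0∞)
    (π : D →⋆ₐ[ℂ] A) (r : ℝ≥0∞) : Prop :=
  ∀ (ψ : StateSpace D) (ε : ℝ≥0), 0 < ε → ∃ φ : StateSpace A, mkState L ψ (φ.comp π) ≤ r + ε

section StatesWithin

variable {A D E : Type u} [CStarAlgebra A] [CStarAlgebra D] [CStarAlgebra E]
  {L : selfAdjoint D → ℝ≥0∞} {L' : selfAdjoint E → ℝ≥0∞} {π : D →⋆ₐ[ℂ] A} {r s : ℝ≥0∞}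

/-- One of the two suprema vanishes, as the states which factor through `π` are themselves states;
only the approximation of arbitrary states remains. -/
lemma hausdorff_mkState_le_iff (hr : r ≠ ∞) : hausdorff (mkState L)
    (Set.range fun φ : StateSpace A => φ.comp π) Set.univ ≤ r ↔ StatesWithin L π r := by
  constructor
  · intro h ψ ε hε
    rw [hausdorff_comm] at h
    obtain ⟨_, ⟨φ, rfl⟩, h⟩ := exists_le_of_hausdorff_le h hr (Set.mem_univ ψ) hε
    exact ⟨φ, h⟩
  · intro h
    refine hausdorff_le (fun x _ ε _ => ⟨x, Set.mem_univ x, by simp [mkState_self]⟩)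
      fun ψ _ ε hε => ?_
    obtain ⟨φ, h⟩ := h ψ ε hε
    exact ⟨_, ⟨φ, rfl⟩, h⟩

lemma mkState_comp_le {f : D →⋆ₐ[ℂ] E} (hf : ∀ a, L' (saMap f a) ≤ L a) (φ ψ : StateSpace E) :
    mkState L (φ.comp f) (ψ.comp f) ≤ mkState L' φ ψ :=
  mkState_le_iff.2 fun a ha => enorm_sub_le_mkState (a := saMap f a) ((hf a).trans ha)

lemma StatesWithin.comp {f : D →⋆ₐ[ℂ] E} {g : E →⋆ₐ[ℂ] A} (h : StatesWithin L f r)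
    (h' : StatesWithin L' g s) (hf : ∀ a, L' (saMap f a) ≤ L a) :
    StatesWithin L (g.comp f) (r + s) := by
  intro ψ ε hε
  obtain ⟨φ, hφ⟩ := h ψ (ε / 2) (by positivity)
  obtain ⟨χ, hχ⟩ := h' φ (ε / 2) (by positivity)
  refine ⟨χ, (mkState_triangle (ψ := φ.comp f)).trans ?_⟩
  have h2 : mkState L (φ.comp f) (χ.comp (g.comp f)) ≤ mkState L' φ (χ.comp g) :=
    mkState_comp_le hf φ (χ.comp g)
  calc _ ≤ (r + (ε / 2 : ℝ≥0)) + (s + (ε / 2 : ℝ≥0)) := add_le_add hφ (h2.trans hχ)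
    _ = r + s + ε := by
      rw [add_add_add_comm, ← ENNReal.coe_add, add_halves]

lemma statesWithin_of_mkState_le [Nontrivial A] (h : ∀ φ ψ, mkState L φ ψ ≤ r) :
    StatesWithin L π r :=
  fun _ _ _ => ⟨Classical.arbitrary _, (h _ _).trans le_self_add⟩

/-- The norm of a self-adjoint element is controlled by the norm of its image and the distance
of the states to those which factor. -/
lemma StatesWithin.norm_le [Nontrivial D] (hs : ∀ (t : ℝ) (a : selfAdjoint D), L (t • a) = ‖t‖ₑ * L a)
    {r : ℝ≥0} (h : StatesWithin L π r) {l : ℝ≥0} (hl : 0 < l) {d : selfAdjoint D} (hd : L d ≤ l) :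
    ‖(d : D)‖ ≤ ‖π d‖ + l * r := by
  refine le_of_forall_pos_le_add fun ε hε => norm_le_of_forall_state fun ψ => ?_
  lift ε to ℝ≥0 using hε.le
  have hε : 0 < ε := by exact_mod_cast hε
  obtain ⟨φ, hφ⟩ := h ψ (ε / l) (by positivity)
  have h1 := (enorm_sub_le_mul_mkState (φ := ψ) (ψ := φ.comp π) hs hl hd).trans
    (mul_le_mul_right hφ _)
  rw [enorm_eq_nnnorm] at h1
  have h2 : ‖ψ.1 (d : D) - (φ.comp π).1 (d : D)‖ ≤ l * (r + ε / l) := by exact_mod_cast h1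
  have h0 : (l : ℝ) ≠ 0 := by exact_mod_cast hl.ne'
  rw [mul_add, mul_div_cancel₀ _ h0] at h2
  have h3 := φ.norm_apply_le (π (d : D))
  rw [StateSpace.comp_apply] at h2
  linarith [norm_le_norm_add_norm_sub' (ψ.1 (d : D)) (φ.1 (π (d : D)))]

end StatesWithin

section Leg

variable {P X Y : MetricalCorr.{u} F K G H} {r : ℝ≥0∞}

lemma legExtent_le_iff (hr : r ≠ ∞) (Φ : ModularQuantumIsometry P X) : legExtent Φ ≤ r ↔
    StatesWithin P.A.lip Φ.leftMap r ∧ StatesWithin P.B.lip Φ.rightMap r := by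
  rw [legExtent, max_le_iff, hausdorff_mkState_le_iff hr, hausdorff_mkState_le_iff hr]

/-- The extent is at most the larger diameter of the two state spaces of `P`, which is finite. -/
lemma legExtent_lt_top (Φ : ModularQuantumIsometry P X) : legExtent Φ < ∞ := by
  obtain ⟨R, hR⟩ := P.A.exists_mkState_le
  obtain ⟨R', hR'⟩ := P.B.exists_mkState_le
  refine lt_of_le_of_lt ((legExtent_le_iff (r := (max R R' : ℝ≥0)) ENNReal.coe_ne_top Φ).2
    ⟨statesWithin_of_mkState_le fun φ ψ => (hR φ ψ).trans ?_,
      statesWithin_of_mkState_le fun φ ψ => (hR' φ ψ).trans ?_⟩) ENNReal.coe_lt_top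
  · exact_mod_cast le_max_left _ _
  · exact_mod_cast le_max_right _ _

end Leg

end

section

/-! ### Coupled sums of quantum compact metric spaces -/

section SaMap

variable {A B : Type u} [CStarAlgebra A] [CStarAlgebra B]

lemma coe_saMap (π : A →⋆ₐ[ℂ] B) (a : selfAdjoint A) : (saMap π a : B) = π a := rfl

lemma saMap_add (π : A →⋆ₐ[ℂ] B) (a b : selfAdjoint A) : saMap π (a + b) = saMap π a + saMap π b :=
  Subtype.ext (map_add π (a : A) b)

lemma saMap_smul (π : A →⋆ₐ[ℂ] B) (t : ℝ) (a : selfAdjoint A) :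
    saMap π (t • a) = t • saMap π a :=
  Subtype.ext (by
    rw [coe_saMap, selfAdjoint.val_smul, selfAdjoint.val_smul, ← Complex.coe_smul, map_smul,
      Complex.coe_smul, coe_saMap])

lemma saMap_one (π : A →⋆ₐ[ℂ] B) : saMap π 1 = 1 := Subtype.ext (map_one π)

lemma saMap_realPart (π : A →⋆ₐ[ℂ] B) (a : A) : saMap π (ℜ a) = ℜ (π a) :=
  Subtype.ext (map_realPart π a)

lemma saMap_imaginaryPart (π : A →⋆ₐ[ℂ] B) (a : A) : saMap π (ℑ a) = ℑ (π a) :=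
  Subtype.ext (map_imaginaryPart π a)

/-- `saMap` as a continuous linear map. -/
def saMapL (π : A →⋆ₐ[ℂ] B) : selfAdjoint A →L[ℝ] selfAdjoint B :=
  LinearMap.mkContinuous
    { toFun := saMap π, map_add' := saMap_add π, map_smul' := saMap_smul π } 1
    fun a => by
      rw [one_mul]
      exact NonUnitalStarAlgHom.norm_apply_le π (a : A)

lemma continuous_saMap (π : A →⋆ₐ[ℂ] B) : Continuous (saMap π) := (saMapL π).continuous

lemma norm_saMap_le (π : A →⋆ₐ[ℂ] B) (a : selfAdjoint A) : ‖saMap π a‖ ≤ ‖a‖ :=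
  NonUnitalStarAlgHom.norm_apply_le π (a : A)

/-- The self-adjoint element of a product with the given components. -/
def saPair (a : selfAdjoint A) (b : selfAdjoint B) : selfAdjoint (A × B) :=
  ⟨((a : A), (b : B)), Prod.ext a.2 b.2⟩

/-- Unital *-morphisms of C*-algebras. -/
abbrev StarHom (A B : Type u) [CStarAlgebra A] [CStarAlgebra B] : Type u := A →⋆ₐ[ℂ] B

/-- The first projection of a product. -/
def pr₁ : StarHom (A × B) A := StarAlgHom.fst ℂ A B

/-- The second projection of a product. -/
def pr₂ : StarHom (A × B) B := StarAlgHom.snd ℂ A B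

lemma saMap_pr₁_saPair (a : selfAdjoint A) (b : selfAdjoint B) : saMap pr₁ (saPair a b) = a := rfl

lemma saMap_pr₂_saPair (a : selfAdjoint A) (b : selfAdjoint B) : saMap pr₂ (saPair a b) = b := rfl

lemma saPair_eta (a : selfAdjoint (A × B)) : saPair (saMap pr₁ a) (saMap pr₂ a) = a := rfl

lemma saPair_sub (a b : selfAdjoint A) (c d : selfAdjoint B) :
    saPair a c - saPair b d = saPair (a - b) (c - d) := rfl

lemma norm_saPair (a : selfAdjoint A) (b : selfAdjoint B) : ‖saPair a b‖ = max ‖a‖ ‖b‖ := rfl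

lemma continuous_saPair : Continuous fun p : selfAdjoint A × selfAdjoint B => saPair p.1 p.2 := by
  refine Continuous.subtype_mk ?_ _
  fun_prop

end SaMap

variable {F K : ℝ≥0}

/-- A linear coupling of two quantum compact metric spaces. -/
structure Coupling (A₁ A₂ : QuantumCMS.{u} F K) (V : Type u) [NormedAddCommGroup V]
    [NormedSpace ℝ V] where
  T : selfAdjoint (A₁.carrier × A₂.carrier) →L[ℝ] V
  map_one : T 1 = 0
  leibniz_re : ∀ a b : selfAdjoint (A₁.carrier × A₂.carrier),
    ‖T (ℜ ((a : A₁.carrier × A₂.carrier) * b))‖ ≤ ‖T a‖ * ‖b‖ + ‖a‖ * ‖T b‖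
  leibniz_im : ∀ a b : selfAdjoint (A₁.carrier × A₂.carrier),
    ‖T (ℑ ((a : A₁.carrier × A₂.carrier) * b))‖ ≤ ‖T a‖ * ‖b‖ + ‖a‖ * ‖T b‖
  nondeg : T (saPair 0 1) ≠ 0

lemma enorm_le_of_norm_le {V W : Type*} [SeminormedAddCommGroup V] [SeminormedAddCommGroup W]
    {v : V} {w : W} (h : ‖v‖ ≤ ‖w‖) : ‖v‖ₑ ≤ ‖w‖ₑ := by
  rw [← ofReal_norm, ← ofReal_norm]
  exact ENNReal.ofReal_le_ofReal h

lemma enorm_le_of_norm_le_mul_add {V W₁ W₂ W₃ W₄ : Type*} [SeminormedAddCommGroup V]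
    [SeminormedAddCommGroup W₁] [SeminormedAddCommGroup W₂] [SeminormedAddCommGroup W₃]
    [SeminormedAddCommGroup W₄] {v : V} {a : W₁} {b : W₂} {c : W₃} {d : W₄}
    (h : ‖v‖ ≤ ‖a‖ * ‖b‖ + ‖c‖ * ‖d‖) : ‖v‖ₑ ≤ ‖a‖ₑ * ‖b‖ₑ + ‖c‖ₑ * ‖d‖ₑ := by
  rw [← ofReal_norm, ← ofReal_norm, ← ofReal_norm, ← ofReal_norm, ← ofReal_norm,
    ← ENNReal.ofReal_mul (norm_nonneg _), ← ENNReal.ofReal_mul (norm_nonneg _),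
    ← ENNReal.ofReal_add (by positivity) (by positivity)]
  exact ENNReal.ofReal_le_ofReal h

lemma enorm_le_one_iff {V : Type*} [SeminormedAddCommGroup V] {v : V} : ‖v‖ₑ ≤ 1 ↔ ‖v‖ ≤ 1 := by
  rw [← ofReal_norm, ← ENNReal.ofReal_one, ENNReal.ofReal_le_ofReal_iff zero_le_one]

lemma leibniz_mono {x F K l₁ l₂ n₁ n₂ l₁' l₂' n₁' n₂' : ℝ≥0∞}
    (h : x ≤ F * (l₁ * n₂ + n₁ * l₂) + K * l₁ * l₂) (hl₁ : l₁ ≤ l₁') (hl₂ : l₂ ≤ l₂')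
    (hn₁ : n₁ ≤ n₁') (hn₂ : n₂ ≤ n₂') : x ≤ F * (l₁' * n₂' + n₁' * l₂') + K * l₁' * l₂' :=
  h.trans (by gcongr)

namespace Coupling

variable {A₁ A₂ : QuantumCMS.{u} F K} {V : Type u} [NormedAddCommGroup V] [NormedSpace ℝ V]
  (C : Coupling A₁ A₂ V)

/-- The Lipschitz seminorm of a coupled sum. -/
def lip (a : selfAdjoint (A₁.carrier × A₂.carrier)) : ℝ≥0∞ :=
  max (max (A₁.lip (saMap pr₁ a)) (A₂.lip (saMap pr₂ a))) ‖C.T a‖ₑ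

lemma lip_le_iff {a : selfAdjoint (A₁.carrier × A₂.carrier)} {r : ℝ≥0∞} : C.lip a ≤ r ↔
    (A₁.lip (saMap pr₁ a) ≤ r ∧ A₂.lip (saMap pr₂ a) ≤ r) ∧ ‖C.T a‖ₑ ≤ r := by
  rw [lip, max_le_iff, max_le_iff]

lemma lip_lt_iff {a : selfAdjoint (A₁.carrier × A₂.carrier)} {r : ℝ≥0∞} : C.lip a < r ↔
    (A₁.lip (saMap pr₁ a) < r ∧ A₂.lip (saMap pr₂ a) < r) ∧ ‖C.T a‖ₑ < r := by
  rw [lip, max_lt_iff, max_lt_iff]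

lemma lip_fst_le (a) : A₁.lip (saMap pr₁ a) ≤ C.lip a := (C.lip_le_iff.1 le_rfl).1.1

lemma lip_snd_le (a) : A₂.lip (saMap pr₂ a) ≤ C.lip a := (C.lip_le_iff.1 le_rfl).1.2

lemma enorm_le_lip (a) : ‖C.T a‖ₑ ≤ C.lip a := (C.lip_le_iff.1 le_rfl).2

lemma isLipSeminorm : IsLipSeminorm C.lip where
  smul t a := by
    have hm : Monotone fun x : ℝ≥0∞ => ‖t‖ₑ * x := fun x y h => mul_le_mul_right h _
    rw [lip, lip, hm.map_max, hm.map_max, saMap_smul, saMap_smul, A₁.lip_smul, A₂.lip_smul,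
      map_smul, enorm_smul]
  add_le a b := by
    refine C.lip_le_iff.2 ⟨⟨?_, ?_⟩, ?_⟩
    · rw [saMap_add]
      exact (A₁.lip_add_le _ _).trans (add_le_add (C.lip_fst_le a) (C.lip_fst_le b))
    · rw [saMap_add]
      exact (A₂.lip_add_le _ _).trans (add_le_add (C.lip_snd_le a) (C.lip_snd_le b))
    · rw [map_add]
      exact (enorm_add_le _ _).trans (add_le_add (C.enorm_le_lip a) (C.enorm_le_lip b))
  one := by
    rw [lip, saMap_one, saMap_one, A₁.lip_one, A₂.lip_one, C.map_one]
    simp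

lemma dense_dom : Dense {a | C.lip a < ∞} := by
  refine Metric.dense_iff.2 fun a ε hε => ?_
  obtain ⟨b₁, hb₁, h₁⟩ := Metric.dense_iff.1 A₁.dense_dom (saMap pr₁ a) ε hε
  obtain ⟨b₂, hb₂, h₂⟩ := Metric.dense_iff.1 A₂.dense_dom (saMap pr₂ a) ε hε
  refine ⟨saPair b₁ b₂, ?_, C.lip_lt_iff.2 ⟨⟨h₁, h₂⟩, enorm_lt_top⟩⟩
  rw [Metric.mem_ball, dist_eq_norm] at *
  rw [← saPair_eta a, saPair_sub, norm_saPair]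
  exact max_lt hb₁ hb₂

lemma isClosed_ball : IsClosed {a | C.lip a ≤ 1} := by
  have h₁ : IsClosed {a : selfAdjoint (A₁.carrier × A₂.carrier) | A₁.lip (saMap pr₁ a) ≤ 1} :=
    A₁.isClosed_ball.preimage (continuous_saMap pr₁)
  have h₂ : IsClosed {a : selfAdjoint (A₁.carrier × A₂.carrier) | A₂.lip (saMap pr₂ a) ≤ 1} :=
    A₂.isClosed_ball.preimage (continuous_saMap pr₂)
  have h₃ : IsClosed {a | ‖C.T a‖ ≤ 1} := isClosed_le C.T.continuous.norm continuous_const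
  convert (h₁.inter h₂).inter h₃ using 1
  ext a
  exact C.lip_le_iff.trans (and_congr_right fun _ => enorm_le_one_iff)

/-- Centering in the first factor leaves free a scalar `c` in the second one. The vector `c • (0,
1)` is the difference of `a` and a pair of centered elements, on both of which `T` is bounded; as `T
(0, 1) ≠ 0`, this bounds `c`. Without this condition the two factors would be at infinite distance.
-/
lemma exists_norm_snd_le (μ : StateSpace A₁.carrier) : ∃ R : ℝ, ∀ a, C.lip a ≤ 1 →
    μ.1 (saMap pr₁ a : A₁.carrier) = 0 → ‖saMap pr₂ a‖ ≤ R := by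
  let μ₂ : StateSpace A₂.carrier := Classical.arbitrary _
  obtain ⟨R₁, hR₁⟩ := (A₁.totallyBounded_centeredBall μ).isBounded.exists_norm_le
  obtain ⟨R₂, hR₂⟩ := (A₂.totallyBounded_centeredBall μ₂).isBounded.exists_norm_le
  have hpos : 0 < ‖C.T (saPair 0 1)‖ := norm_pos_iff.2 C.nondeg
  refine ⟨R₂ + (1 + ‖C.T‖ * max R₁ R₂) / ‖C.T (saPair 0 1)‖, fun a ha hμ => ?_⟩
  obtain ⟨⟨h₁, h₂⟩, hT⟩ := C.lip_le_iff.1 ha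
  have n₁ := hR₁ _ ⟨h₁, hμ⟩
  have n₂ := hR₂ _ (A₂.isLipSeminorm.center_mem μ₂ h₂)
  set c := (μ₂.1 (saMap pr₂ a : A₂.carrier)).re with hc
  have hcenter : center μ₂ (saMap pr₂ a) = saMap pr₂ a + (-c) • 1 := rfl
  have hdec : c • saPair (0 : selfAdjoint A₁.carrier) (1 : selfAdjoint A₂.carrier) =
      a - saPair (saMap pr₁ a) (center μ₂ (saMap pr₂ a)) := by
    rw [← saPair_eta a, saPair_sub, saMap_pr₁_saPair, saMap_pr₂_saPair, sub_self, hcenter,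
      neg_smul, sub_add_cancel_left, neg_neg]
    refine Subtype.ext (Prod.ext ?_ rfl)
    exact smul_zero c
  have hTa : ‖C.T a‖ ≤ 1 := enorm_le_one_iff.1 hT
  have hcb : |c| * ‖C.T (saPair 0 1)‖ ≤ 1 + ‖C.T‖ * max R₁ R₂ := by
    rw [← Real.norm_eq_abs, ← norm_smul, ← map_smul, hdec, map_sub]
    refine (norm_sub_le _ _).trans (add_le_add hTa ((C.T.le_opNorm _).trans ?_))
    rw [norm_saPair]
    exact mul_le_mul_of_nonneg_left (max_le_max n₁ n₂) C.T.opNorm_nonneg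
  rw [← le_div_iff₀ hpos] at hcb
  have hsplit : saMap pr₂ a = center μ₂ (saMap pr₂ a) + c • 1 := by
    rw [hcenter, neg_smul, neg_add_cancel_right]
  rw [hsplit]
  refine (norm_add_le _ _).trans (add_le_add n₂ ?_)
  rw [norm_smul, Real.norm_eq_abs]
  have h1 : ‖(1 : selfAdjoint A₂.carrier)‖ = 1 := norm_one (α := A₂.carrier)
  rwa [h1, mul_one]

lemma totallyBounded_centeredBall (μ : StateSpace A₁.carrier) :
    TotallyBounded (centeredBall C.lip (μ.comp pr₁)) := by
  obtain ⟨R, hR⟩ := C.exists_norm_snd_le μ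
  have hc₁ : IsCompact (closure (centeredBall A₁.lip μ)) :=
    (A₁.totallyBounded_centeredBall μ).closure.isCompact_of_isClosed isClosed_closure
  refine TotallyBounded.subset ?_
    ((hc₁.prod (A₂.isCompact_sublevel 1 one_pos R)).image continuous_saPair).totallyBounded
  rintro a ⟨ha, hμ⟩
  obtain ⟨⟨h₁, h₂⟩, -⟩ := C.lip_le_iff.1 ha
  have m₁ : saMap pr₁ a ∈ centeredBall A₁.lip μ := ⟨h₁, hμ⟩
  have m₂ : saMap pr₂ a ∈ {a : selfAdjoint A₂.carrier | A₂.lip a ≤ (1 : ℝ≥0) ∧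
    ‖(a : A₂.carrier)‖ ≤ R} := ⟨h₂, hR a ha hμ⟩
  exact ⟨(saMap pr₁ a, saMap pr₂ a), ⟨subset_closure m₁, m₂⟩, rfl⟩

/-- The two factors have the required inequality already. The coupling term has the sharp one, with
constant `1`, which is why `F ≥ 1` is needed. -/
lemma leibniz (hF : 1 ≤ F) (a b : selfAdjoint (A₁.carrier × A₂.carrier)) (ha : C.lip a < ∞)
    (hb : C.lip b < ∞) :
    max (C.lip (ℜ ((a : A₁.carrier × A₂.carrier) * b)))
      (C.lip (ℑ ((a : A₁.carrier × A₂.carrier) * b))) ≤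
      F * (C.lip a * ‖(b : A₁.carrier × A₂.carrier)‖ₑ +
        ‖(a : A₁.carrier × A₂.carrier)‖ₑ * C.lip b) + K * C.lip a * C.lip b := by
  obtain ⟨⟨ha₁, ha₂⟩, -⟩ := C.lip_lt_iff.1 ha
  obtain ⟨⟨hb₁, hb₂⟩, -⟩ := C.lip_lt_iff.1 hb
  have h₁ := leibniz_mono (A₁.leibniz _ _ ha₁ hb₁) (C.lip_fst_le a) (C.lip_fst_le b)
    (enorm_le_of_norm_le (norm_saMap_le pr₁ a)) (enorm_le_of_norm_le (norm_saMap_le pr₁ b))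
  have h₂ := leibniz_mono (A₂.leibniz _ _ ha₂ hb₂) (C.lip_snd_le a) (C.lip_snd_le b)
    (enorm_le_of_norm_le (norm_saMap_le pr₂ a)) (enorm_le_of_norm_le (norm_saMap_le pr₂ b))
  rw [coe_saMap, coe_saMap, ← map_mul, ← saMap_realPart, ← saMap_imaginaryPart] at h₁ h₂
  have h₃ : ‖C.T a‖ₑ * ‖b‖ₑ + ‖a‖ₑ * ‖C.T b‖ₑ ≤
      F * (C.lip a * ‖(b : A₁.carrier × A₂.carrier)‖ₑ +
        ‖(a : A₁.carrier × A₂.carrier)‖ₑ * C.lip b) + K * C.lip a * C.lip b := by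
    refine le_trans ?_ le_self_add
    refine le_trans ?_ (le_mul_of_one_le_left bot_le (by exact_mod_cast hF))
    exact add_le_add (mul_le_mul_left (C.enorm_le_lip a) _) (mul_le_mul_right (C.enorm_le_lip b) _)
  exact max_le
    (C.lip_le_iff.2 ⟨⟨(le_max_left _ _).trans h₁, (le_max_left _ _).trans h₂⟩,
      (enorm_le_of_norm_le_mul_add (C.leibniz_re a b)).trans h₃⟩)
    (C.lip_le_iff.2 ⟨⟨(le_max_right _ _).trans h₁, (le_max_right _ _).trans h₂⟩,
      (enorm_le_of_norm_le_mul_add (C.leibniz_im a b)).trans h₃⟩)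

/-- The coupled sum of two quantum compact metric spaces. -/
@[reducible]
def sum (hF : 1 ≤ F) : QuantumCMS.{u} F K where
  carrier := A₁.carrier × A₂.carrier
  lip := C.lip
  lip_smul := C.isLipSeminorm.smul
  lip_add_le := C.isLipSeminorm.add_le
  dense_dom := C.dense_dom
  lip_one := C.isLipSeminorm.one
  mk_lt_top φ ψ := by
    obtain ⟨R, hR⟩ := exists_mkState_le C.isLipSeminorm
      (C.totallyBounded_centeredBall (Classical.arbitrary _))
    exact (hR φ ψ).trans_lt ENNReal.coe_lt_top
  mk_basis := nhds_hasBasis_mkState C.isLipSeminorm C.dense_dom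
    (C.totallyBounded_centeredBall (Classical.arbitrary _))
  leibniz := C.leibniz hF
  isClosed_ball := C.isClosed_ball

lemma fst_quotient (h : ∀ (a₁ : selfAdjoint A₁.carrier) (r : ℝ≥0∞), A₁.lip a₁ < r →
    ∃ a₂, A₂.lip a₂ < r ∧ ‖C.T (saPair a₁ a₂)‖ₑ < r) :
    IsSeminormQuotient (saMap pr₁) C.lip A₁.lip where
  le := C.lip_fst_le
  lift a r hr := by
    obtain ⟨a₂, h₂, hT⟩ := h a r hr
    exact ⟨saPair a a₂, rfl, C.lip_lt_iff.2 ⟨⟨hr, h₂⟩, hT⟩⟩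

lemma snd_quotient (h : ∀ (a₂ : selfAdjoint A₂.carrier) (r : ℝ≥0∞), A₂.lip a₂ < r →
    ∃ a₁, A₁.lip a₁ < r ∧ ‖C.T (saPair a₁ a₂)‖ₑ < r) :
    IsSeminormQuotient (saMap pr₂) C.lip A₂.lip where
  le := C.lip_snd_le
  lift a r hr := by
    obtain ⟨a₁, h₁, hT⟩ := h a r hr
    exact ⟨saPair a₁ a, rfl, C.lip_lt_iff.2 ⟨⟨h₁, hr⟩, hT⟩⟩

end Coupling

end

section

/-! ### Products of Hilbert modules -/

section ProdModule

/-- The componentwise right action of a product. -/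
@[reducible]
def prodRightModule (B₁ B₂ M₁ M₂ : Type u) [CStarAlgebra B₁] [CStarAlgebra B₂]
    [NormedAddCommGroup M₁] [Module B₁ᵐᵒᵖ M₁] [NormedAddCommGroup M₂] [Module B₂ᵐᵒᵖ M₂] :
    Module (B₁ × B₂)ᵐᵒᵖ (M₁ × M₂) where
  smul b ω := (MulOpposite.op b.unop.1 • ω.1, MulOpposite.op b.unop.2 • ω.2)
  one_smul ω := Prod.ext (one_smul _ ω.1) (one_smul _ ω.2)
  mul_smul b c ω := Prod.ext (mul_smul (MulOpposite.op b.unop.1) (MulOpposite.op c.unop.1) ω.1)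
    (mul_smul (MulOpposite.op b.unop.2) (MulOpposite.op c.unop.2) ω.2)
  smul_zero _ := Prod.ext (smul_zero _) (smul_zero _)
  smul_add _ ω η := Prod.ext (smul_add _ ω.1 η.1) (smul_add _ ω.2 η.2)
  add_smul b c ω := Prod.ext (add_smul (MulOpposite.op b.unop.1) (MulOpposite.op c.unop.1) ω.1)
    (add_smul (MulOpposite.op b.unop.2) (MulOpposite.op c.unop.2) ω.2)
  zero_smul ω := Prod.ext (zero_smul _ ω.1) (zero_smul _ ω.2)

attribute [local instance] prodRightModule

/-- The product of two Hilbert modules, over the product of the C*-algebras. -/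
@[reducible]
def prodHilbertModule (B₁ B₂ M₁ M₂ : Type u) [CStarAlgebra B₁] [CStarAlgebra B₂]
    [NormedAddCommGroup M₁] [NormedSpace ℂ M₁] [Module B₁ᵐᵒᵖ M₁] [CompleteSpace M₁]
    [HilbertModule B₁ M₁] [NormedAddCommGroup M₂] [NormedSpace ℂ M₂] [Module B₂ᵐᵒᵖ M₂]
    [CompleteSpace M₂] [HilbertModule B₂ M₂] : HilbertModule (B₁ × B₂) (M₁ × M₂) where
  inner ω η := (HilbertModule.inner ω.1 η.1, HilbertModule.inner ω.2 η.2)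
  inner_add_right ω η ζ := Prod.ext (HilbertModule.inner_add_right ω.1 η.1 ζ.1)
    (HilbertModule.inner_add_right ω.2 η.2 ζ.2)
  inner_smul_right z ω η := Prod.ext (HilbertModule.inner_smul_right z ω.1 η.1)
    (HilbertModule.inner_smul_right z ω.2 η.2)
  inner_op_smul_right b ω η := Prod.ext (HilbertModule.inner_op_smul_right b.1 ω.1 η.1)
    (HilbertModule.inner_op_smul_right b.2 ω.2 η.2)
  star_inner ω η := Prod.ext (HilbertModule.star_inner ω.1 η.1) (HilbertModule.star_inner ω.2 η.2)
  inner_self_nonneg ω := by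
    obtain ⟨b₁, h₁⟩ := HilbertModule.inner_self_nonneg (B := B₁) ω.1
    obtain ⟨b₂, h₂⟩ := HilbertModule.inner_self_nonneg (B := B₂) ω.2
    exact ⟨(b₁, b₂), Prod.ext h₁ h₂⟩
  inner_self_eq_zero ω := by
    rw [Prod.ext_iff, Prod.ext_iff]
    exact and_congr (HilbertModule.inner_self_eq_zero ω.1) (HilbertModule.inner_self_eq_zero ω.2)
  norm_eq ω := by
    rw [Prod.norm_def, Prod.norm_def, Real.sqrt_monotone.map_max]
    exact congrArg₂ max (HilbertModule.norm_eq (B := B₁) ω.1) (HilbertModule.norm_eq (B := B₂) ω.2)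

variable {A₁ A₂ M₁ M₂ : Type u} [CStarAlgebra A₁] [CStarAlgebra A₂]
  [NormedAddCommGroup M₁] [NormedSpace ℂ M₁] [NormedAddCommGroup M₂] [NormedSpace ℂ M₂]

/-- The product of two representations. -/
def prodRep (π₁ : A₁ →ₐ[ℂ] (M₁ →L[ℂ] M₁))
    (π₂ : A₂ →ₐ[ℂ] (M₂ →L[ℂ] M₂)) : A₁ × A₂ →ₐ[ℂ] (M₁ × M₂ →L[ℂ] M₁ × M₂) :=
  AlgHom.ofLinearMap
    { toFun := fun a => (π₁ a.1).prodMap (π₂ a.2)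
      map_add' := fun a b => by ext <;> simp
      map_smul' := fun z a => by ext <;> simp }
    (by ext <;> simp) (fun a b => by ext <;> simp)

end ProdModule

/-! ### Coupled sums of metrical C*-correspondences -/

variable {F K G H : ℝ≥0}

/-- A linear coupling of two metrical C*-correspondences. -/
structure ModuleCoupling (X₁ X₂ : MetricalCorr.{u} F K G H) (V V' W : Type u)
    [NormedAddCommGroup V] [NormedSpace ℝ V] [NormedAddCommGroup V'] [NormedSpace ℝ V']
    [NormedAddCommGroup W] [NormedSpace ℂ W] where
  left : Coupling X₁.A X₂.A V
  right : Coupling X₁.B X₂.B V'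
  T : X₁.M × X₂.M →L[ℂ] W
  modular : ∀ (a : selfAdjoint (X₁.A.carrier × X₂.A.carrier)) (ω : X₁.M × X₂.M),
    ‖T (X₁.lact (saMap pr₁ a : X₁.A.carrier) ω.1, X₂.lact (saMap pr₂ a : X₂.A.carrier) ω.2)‖ ≤
      ‖a‖ * ‖T ω‖ + ‖left.T a‖ * ‖ω‖
  inner_re : ∀ ω η : X₁.M × X₂.M,
    ‖right.T (saPair (ℜ (X₁.ip ω.1 η.1)) (ℜ (X₂.ip ω.2 η.2)))‖ ≤ ‖T ω‖ * ‖η‖ + ‖ω‖ * ‖T η‖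
  inner_im : ∀ ω η : X₁.M × X₂.M,
    ‖right.T (saPair (ℑ (X₁.ip ω.1 η.1)) (ℑ (X₂.ip ω.2 η.2)))‖ ≤ ‖T ω‖ * ‖η‖ + ‖ω‖ * ‖T η‖

namespace ModuleCoupling

variable {X₁ X₂ : MetricalCorr.{u} F K G H} {V V' W : Type u} [NormedAddCommGroup V]
  [NormedSpace ℝ V] [NormedAddCommGroup V'] [NormedSpace ℝ V'] [NormedAddCommGroup W]
  [NormedSpace ℂ W] (C : ModuleCoupling X₁ X₂ V V' W)

/-- The D-norm of a coupled sum. -/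
def dnorm (ω : X₁.M × X₂.M) : ℝ≥0∞ :=
  max (max (X₁.dnorm ω.1) (X₂.dnorm ω.2)) ‖C.T ω‖ₑ

lemma dnorm_le_iff {ω : X₁.M × X₂.M} {r : ℝ≥0∞} : C.dnorm ω ≤ r ↔
    (X₁.dnorm ω.1 ≤ r ∧ X₂.dnorm ω.2 ≤ r) ∧ ‖C.T ω‖ₑ ≤ r := by
  rw [dnorm, max_le_iff, max_le_iff]

lemma dnorm_lt_iff {ω : X₁.M × X₂.M} {r : ℝ≥0∞} : C.dnorm ω < r ↔
    (X₁.dnorm ω.1 < r ∧ X₂.dnorm ω.2 < r) ∧ ‖C.T ω‖ₑ < r := by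
  rw [dnorm, max_lt_iff, max_lt_iff]

lemma dnorm_fst_le (ω) : X₁.dnorm ω.1 ≤ C.dnorm ω := (C.dnorm_le_iff.1 le_rfl).1.1

lemma dnorm_snd_le (ω) : X₂.dnorm ω.2 ≤ C.dnorm ω := (C.dnorm_le_iff.1 le_rfl).1.2

lemma enorm_le_dnorm (ω) : ‖C.T ω‖ₑ ≤ C.dnorm ω := (C.dnorm_le_iff.1 le_rfl).2

lemma dnorm_smul (z : ℂ) (ω : X₁.M × X₂.M) : C.dnorm (z • ω) = ‖z‖ₑ * C.dnorm ω := by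
  have hm : Monotone fun x : ℝ≥0∞ => ‖z‖ₑ * x := fun x y h => mul_le_mul_right h _
  rw [dnorm, dnorm, hm.map_max, hm.map_max, Prod.smul_fst, Prod.smul_snd, X₁.dnorm_smul,
    X₂.dnorm_smul, map_smul, enorm_smul]

lemma dnorm_add_le (ω η : X₁.M × X₂.M) : C.dnorm (ω + η) ≤ C.dnorm ω + C.dnorm η := by
  refine C.dnorm_le_iff.2 ⟨⟨?_, ?_⟩, ?_⟩
  · exact (X₁.dnorm_add_le _ _).trans (add_le_add (C.dnorm_fst_le ω) (C.dnorm_fst_le η))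
  · exact (X₂.dnorm_add_le _ _).trans (add_le_add (C.dnorm_snd_le ω) (C.dnorm_snd_le η))
  · rw [map_add]
    exact (enorm_add_le _ _).trans (add_le_add (C.enorm_le_dnorm ω) (C.enorm_le_dnorm η))

lemma dense_dom : Dense {ω | C.dnorm ω < ∞} := by
  have h : {ω | C.dnorm ω < ∞} = {ω | X₁.dnorm ω < ∞} ×ˢ {ω | X₂.dnorm ω < ∞} := by
    ext ω
    exact C.dnorm_lt_iff.trans (and_iff_left enorm_lt_top)
  rw [h]
  exact X₁.dense_dom.prod X₂.dense_dom

lemma norm_le_dnorm (ω : X₁.M × X₂.M) : ‖ω‖ₑ ≤ C.dnorm ω := by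
  have h : ‖ω‖ₑ = max ‖ω.1‖ₑ ‖ω.2‖ₑ := rfl
  rw [h]
  exact max_le ((X₁.norm_le_dnorm _).trans (C.dnorm_fst_le ω))
    ((X₂.norm_le_dnorm _).trans (C.dnorm_snd_le ω))

lemma isCompact_ball : IsCompact {ω | C.dnorm ω ≤ 1} := by
  have h : IsClosed {ω | ‖C.T ω‖ ≤ 1} := isClosed_le C.T.continuous.norm continuous_const
  convert (X₁.isCompact_ball.prod X₂.isCompact_ball).inter_right h using 1
  ext ω
  exact C.dnorm_le_iff.trans (and_congr_right fun _ => enorm_le_one_iff)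

lemma modular_leibniz (hG : 1 ≤ G) (a : selfAdjoint (X₁.A.carrier × X₂.A.carrier))
    (ω : X₁.M × X₂.M) (ha : C.left.lip a < ∞) (hω : C.dnorm ω < ∞) :
    C.dnorm (prodRep X₁.lact X₂.lact (a : X₁.A.carrier × X₂.A.carrier) ω) ≤
      G * (‖(a : X₁.A.carrier × X₂.A.carrier)‖ₑ + C.left.lip a) * C.dnorm ω := by
  obtain ⟨⟨ha₁, ha₂⟩, -⟩ := C.left.lip_lt_iff.1 ha
  obtain ⟨⟨hω₁, hω₂⟩, -⟩ := C.dnorm_lt_iff.1 hω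
  have n₁ := enorm_le_of_norm_le (norm_saMap_le pr₁ a)
  have n₂ := enorm_le_of_norm_le (norm_saMap_le pr₂ a)
  refine C.dnorm_le_iff.2 ⟨⟨?_, ?_⟩, ?_⟩
  · refine (X₁.modular_leibniz _ _ ha₁ hω₁).trans ?_
    exact mul_le_mul' (mul_le_mul_right (add_le_add n₁ (C.left.lip_fst_le a)) _)
      (C.dnorm_fst_le ω)
  · refine (X₂.modular_leibniz _ _ ha₂ hω₂).trans ?_
    exact mul_le_mul' (mul_le_mul_right (add_le_add n₂ (C.left.lip_snd_le a)) _)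
      (C.dnorm_snd_le ω)
  · refine (enorm_le_of_norm_le_mul_add (C.modular a ω)).trans ?_
    rw [mul_assoc, add_mul]
    refine le_trans ?_ (le_mul_of_one_le_left bot_le (by exact_mod_cast hG))
    exact add_le_add (mul_le_mul_right (C.enorm_le_dnorm ω) _)
      (mul_le_mul' (C.left.enorm_le_lip a) (C.norm_le_dnorm ω))

/-- Each of the two terms is at most the product of the D-norms, since the D-norm dominates both the
norm and `T`. Their sum accounts for `H ≥ 2`. -/
lemma inner_leibniz_aux (hH : 2 ≤ H) {v : V'} {ω η : X₁.M × X₂.M}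
    (h : ‖v‖ ≤ ‖C.T ω‖ * ‖η‖ + ‖ω‖ * ‖C.T η‖) : ‖v‖ₑ ≤ H * C.dnorm ω * C.dnorm η := by
  refine (enorm_le_of_norm_le_mul_add h).trans ?_
  calc _ ≤ C.dnorm ω * C.dnorm η + C.dnorm ω * C.dnorm η :=
        add_le_add (mul_le_mul' (C.enorm_le_dnorm ω) (C.norm_le_dnorm η))
          (mul_le_mul' (C.norm_le_dnorm ω) (C.enorm_le_dnorm η))
    _ = 2 * (C.dnorm ω * C.dnorm η) := (two_mul _).symm
    _ ≤ H * (C.dnorm ω * C.dnorm η) := mul_le_mul_left (by exact_mod_cast hH) _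
    _ = H * C.dnorm ω * C.dnorm η := (mul_assoc _ _ _).symm

lemma inner_leibniz (hH : 2 ≤ H) (ω η : X₁.M × X₂.M) (hω : C.dnorm ω < ∞) (hη : C.dnorm η < ∞) :
    max (C.right.lip (saPair (ℜ (X₁.ip ω.1 η.1)) (ℜ (X₂.ip ω.2 η.2))))
      (C.right.lip (saPair (ℑ (X₁.ip ω.1 η.1)) (ℑ (X₂.ip ω.2 η.2)))) ≤
      H * C.dnorm ω * C.dnorm η := by
  obtain ⟨⟨hω₁, hω₂⟩, -⟩ := C.dnorm_lt_iff.1 hω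
  obtain ⟨⟨hη₁, hη₂⟩, -⟩ := C.dnorm_lt_iff.1 hη
  have h₁ := (X₁.inner_leibniz _ _ hω₁ hη₁).trans (mul_le_mul' (mul_le_mul_right
    (C.dnorm_fst_le ω) (H : ℝ≥0∞)) (C.dnorm_fst_le η))
  have h₂ := (X₂.inner_leibniz _ _ hω₂ hη₂).trans (mul_le_mul' (mul_le_mul_right
    (C.dnorm_snd_le ω) (H : ℝ≥0∞)) (C.dnorm_snd_le η))
  exact max_le
    (C.right.lip_le_iff.2 ⟨⟨(le_max_left _ _).trans h₁, (le_max_left _ _).trans h₂⟩,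
      C.inner_leibniz_aux hH (C.inner_re ω η)⟩)
    (C.right.lip_le_iff.2 ⟨⟨(le_max_right _ _).trans h₁, (le_max_right _ _).trans h₂⟩,
      C.inner_leibniz_aux hH (C.inner_im ω η)⟩)

/-- The coupled sum of two metrical C*-correspondences. -/
@[reducible]
def sum (hF : 1 ≤ F) (hG : 1 ≤ G) (hH : 2 ≤ H) : MetricalCorr.{u} F K G H where
  A := C.left.sum hF
  B := C.right.sum hF
  M := X₁.M × X₂.M
  rightModule := prodRightModule X₁.B.carrier X₂.B.carrier X₁.M X₂.M
  hilbert := prodHilbertModule X₁.B.carrier X₂.B.carrier X₁.M X₂.M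
  lact := prodRep X₁.lact X₂.lact
  lact_right_linear a b ω := Prod.ext (X₁.lact_right_linear a.1 b.1 ω.1)
    (X₂.lact_right_linear a.2 b.2 ω.2)
  lact_star a ω η := Prod.ext (X₁.lact_star a.1 ω.1 η.1) (X₂.lact_star a.2 ω.2 η.2)
  dnorm := C.dnorm
  dnorm_smul := C.dnorm_smul
  dnorm_add_le := C.dnorm_add_le
  dense_dom := C.dense_dom
  norm_le_dnorm := C.norm_le_dnorm
  isCompact_ball := C.isCompact_ball
  modular_leibniz := C.modular_leibniz hG
  inner_leibniz ω η hω hη := C.inner_leibniz hH ω η hω hη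

variable (hF : 1 ≤ F) (hG : 1 ≤ G) (hH : 2 ≤ H)

/-- The first projection of a coupled sum. -/
def fst (hA : IsSeminormQuotient (saMap pr₁) C.left.lip X₁.A.lip)
    (hB : IsSeminormQuotient (saMap pr₁) C.right.lip X₁.B.lip)
    (hM : IsSeminormQuotient Prod.fst C.dnorm X₁.dnorm) :
    ModularQuantumIsometry (C.sum hF hG hH) X₁ :=
  .ofQuotient (X := C.sum hF hG hH) (ContinuousLinearMap.fst ℂ X₁.M X₂.M) pr₁ pr₁
    (fun _ _ => rfl) (fun _ _ => rfl) (fun _ _ => rfl) hA hB hM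

/-- The second projection of a coupled sum. -/
def snd (hA : IsSeminormQuotient (saMap pr₂) C.left.lip X₂.A.lip)
    (hB : IsSeminormQuotient (saMap pr₂) C.right.lip X₂.B.lip)
    (hM : IsSeminormQuotient Prod.snd C.dnorm X₂.dnorm) :
    ModularQuantumIsometry (C.sum hF hG hH) X₂ :=
  .ofQuotient (X := C.sum hF hG hH) (ContinuousLinearMap.snd ℂ X₁.M X₂.M) pr₂ pr₂
    (fun _ _ => rfl) (fun _ _ => rfl) (fun _ _ => rfl) hA hB hM

lemma fst_quotient (h : ∀ (ω : X₁.M) (r : ℝ≥0∞), X₁.dnorm ω < r →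
    ∃ η, X₂.dnorm η < r ∧ ‖C.T (ω, η)‖ₑ < r) : IsSeminormQuotient Prod.fst C.dnorm X₁.dnorm where
  le := C.dnorm_fst_le
  lift ω r hr := by
    obtain ⟨η, h₂, hT⟩ := h ω r hr
    exact ⟨(ω, η), rfl, C.dnorm_lt_iff.2 ⟨⟨hr, h₂⟩, hT⟩⟩

lemma snd_quotient (h : ∀ (η : X₂.M) (r : ℝ≥0∞), X₂.dnorm η < r →
    ∃ ω, X₁.dnorm ω < r ∧ ‖C.T (ω, η)‖ₑ < r) : IsSeminormQuotient Prod.snd C.dnorm X₂.dnorm where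
  le := C.dnorm_snd_le
  lift η r hr := by
    obtain ⟨ω, h₁, hT⟩ := h η r hr
    exact ⟨(ω, η), rfl, C.dnorm_lt_iff.2 ⟨⟨h₁, hr⟩, hT⟩⟩

end ModuleCoupling

end

section

/-! ### Coupling along a common quotient -/

variable {F K G H : ℝ≥0}

/-- A state of a coupled algebra is close to a state of the first factor, when the states of the
second factor are close to those of a common quotient. -/
lemma StatesWithin.of_coupling {D A₁ A₂ E : Type u} [CStarAlgebra D] [CStarAlgebra A₁]
    [CStarAlgebra A₂] [CStarAlgebra E] {L : selfAdjoint D → ℝ≥0∞} {L₂ : selfAdjoint A₂ → ℝ≥0∞}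
    {p₁ : StarHom D A₁} {p₂ : StarHom D A₂} {π : StarHom A₁ E} {ρ : StarHom A₂ E} {r : ℝ≥0∞}
    {ε : ℝ≥0} (hL₂ : ∀ a, L₂ (saMap p₂ a) ≤ L a)
    (hT : ∀ a : selfAdjoint D, L a ≤ 1 → ‖π (p₁ a) - ρ (p₂ a)‖ₑ ≤ ε)
    (hdec : ∀ ψ : StateSpace D, ∃ (t : ℝ) (φ₁ : StateSpace A₁) (φ₂ : StateSpace A₂), 0 ≤ t ∧
      t ≤ 1 ∧ ∀ a : D, ψ.1 a = t * φ₁.1 (p₁ a) + (1 - t : ℝ) * φ₂.1 (p₂ a))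
    (h : StatesWithin L₂ ρ r) : StatesWithin L p₁ (r + ε) := by
  intro ψ δ hδ
  obtain ⟨t, φ₁, φ₂, h0, h1, hψ⟩ := hdec ψ
  obtain ⟨μ, hμ⟩ := h φ₂ δ hδ
  -- The part of `ψ` on the first factor is kept. The part `φ₂` on the second is moved to a state of
  -- the common quotient, at cost `r`, and then read through `π` instead of `ρ`, at cost `ε`.
  refine ⟨StateSpace.convexComb t h0 h1 φ₁ (μ.comp π), mkState_le_iff.2 fun a ha => ?_⟩
  have hn : ‖((1 - t : ℝ) : ℂ)‖ₑ ≤ 1 := by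
    rw [enorm_le_one_iff, Complex.norm_real, Real.norm_eq_abs, abs_le]
    constructor <;> linarith
  have hμa : ‖μ.1 (ρ (p₂ a) - π (p₁ a))‖ₑ ≤ ε := by
    refine (enorm_le_of_norm_le (μ.norm_apply_le _)).trans ?_
    rw [← edist_eq_enorm_sub, edist_comm, edist_eq_enorm_sub]
    exact hT a ha
  have h2 : ‖φ₂.1 (p₂ (a : D)) - (μ.comp ρ).1 (p₂ (a : D))‖ₑ ≤ r + δ :=
    (enorm_sub_le_mkState (a := saMap p₂ a) ((hL₂ a).trans ha)).trans hμ
  rw [StateSpace.comp_apply] at h2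
  have key : ψ.1 (a : D) - ((StateSpace.convexComb t h0 h1 φ₁ (μ.comp π)).comp p₁).1 (a : D) =
      ((1 - t : ℝ) : ℂ) * ((φ₂.1 (p₂ (a : D)) - μ.1 (ρ (p₂ (a : D)))) +
        μ.1 (ρ (p₂ a) - π (p₁ a))) := by
    rw [StateSpace.comp_apply, StateSpace.convexComb_apply, hψ, StateSpace.comp_apply, map_sub]
    ring
  rw [key, enorm_mul]
  calc _ ≤ 1 * ((r + δ) + ε) := mul_le_mul' hn ((enorm_add_le _ _).trans (add_le_add h2 hμa))
    _ = r + ε + δ := by rw [one_mul, add_right_comm]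

lemma enorm_lt_of_eq_zero {V : Type*} [SeminormedAddCommGroup V] {v : V} (hv : v = 0)
    {x r : ℝ≥0∞} (hr : x < r) : ‖v‖ₑ < r := by
  rw [hv, ← ofReal_norm, norm_zero, ENNReal.ofReal_zero]
  exact lt_of_le_of_lt bot_le hr

section QuotientCoupling

variable {A₁ A₂ : QuantumCMS.{u} F K} {E : Type u} [CStarAlgebra E]
  (π : StarHom A₁.carrier E) (ρ : StarHom A₂.carrier E) {ε : ℝ≥0} (hε : 0 < ε)

lemma norm_mul_sub_mul_le {R : Type*} [NormedRing R] (a b c d : R) :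
    ‖a * b - c * d‖ ≤ ‖a - c‖ * ‖b‖ + ‖c‖ * ‖b - d‖ := by
  have : a * b - c * d = (a - c) * b + c * (b - d) := by noncomm_ring
  rw [this]
  exact (norm_add_le _ _).trans (add_le_add (norm_mul_le _ _) (norm_mul_le _ _))

/-- The difference of two morphisms, up to a factor. -/
def diffMap (ε : ℝ≥0) : selfAdjoint (A₁.carrier × A₂.carrier) →L[ℝ] selfAdjoint E :=
  (ε : ℝ)⁻¹ • ((saMapL π).comp (saMapL pr₁) - (saMapL ρ).comp (saMapL pr₂))

lemma diffMap_apply (a : selfAdjoint (A₁.carrier × A₂.carrier)) :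
    diffMap π ρ ε a = (ε : ℝ)⁻¹ • (saMap π (saMap pr₁ a) - saMap ρ (saMap pr₂ a)) := rfl

lemma norm_diffMap (a : selfAdjoint (A₁.carrier × A₂.carrier)) :
    ‖diffMap π ρ ε a‖ = (ε : ℝ)⁻¹ * ‖π (pr₁ (a : A₁.carrier × A₂.carrier)) -
      ρ (pr₂ (a : A₁.carrier × A₂.carrier))‖ := by
  rw [diffMap_apply, norm_smul, norm_inv, Real.norm_of_nonneg ε.coe_nonneg]
  rfl

lemma norm_diffMap_leibniz (a b : selfAdjoint (A₁.carrier × A₂.carrier)) :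
    (ε : ℝ)⁻¹ * ‖π (pr₁ (a.1 * b.1)) - ρ (pr₂ (a.1 * b.1))‖ ≤
      ‖diffMap π ρ ε a‖ * ‖b‖ + ‖a‖ * ‖diffMap π ρ ε b‖ := by
  rw [norm_diffMap, norm_diffMap, mul_assoc, mul_left_comm ‖a‖, ← mul_add, map_mul, map_mul,
    map_mul, map_mul]
  refine mul_le_mul_of_nonneg_left ((norm_mul_sub_mul_le _ _ _ _).trans ?_)
    (inv_nonneg.2 ε.2)
  refine add_le_add (mul_le_mul_of_nonneg_left ?_ (norm_nonneg _))
    (mul_le_mul_of_nonneg_right ?_ (norm_nonneg _))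
  · exact (norm_saMap_le π (saMap pr₁ b)).trans (norm_saMap_le pr₁ b)
  · exact (norm_saMap_le ρ (saMap pr₂ a)).trans (norm_saMap_le pr₂ a)

variable [Nontrivial E]

/-- The coupling of two quantum compact metric spaces along morphisms to a common C*-algebra. -/
def quotientCoupling : Coupling A₁ A₂ (selfAdjoint E) where
  T := diffMap π ρ ε
  map_one := by rw [diffMap_apply]; simp only [saMap_one, sub_self, smul_zero]
  leibniz_re a b := by
    refine le_trans ?_ (norm_diffMap_leibniz π ρ a b)
    rw [diffMap_apply, norm_smul, norm_inv, Real.norm_of_nonneg ε.coe_nonneg]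
    refine mul_le_mul_of_nonneg_left ?_ (inv_nonneg.2 ε.2)
    rw [saMap_realPart, saMap_realPart, saMap_realPart, saMap_realPart, ← map_sub]
    exact realPart.norm_le _
  leibniz_im a b := by
    refine le_trans ?_ (norm_diffMap_leibniz π ρ a b)
    rw [diffMap_apply, norm_smul, norm_inv, Real.norm_of_nonneg ε.coe_nonneg]
    refine mul_le_mul_of_nonneg_left ?_ (inv_nonneg.2 ε.2)
    rw [saMap_imaginaryPart, saMap_imaginaryPart, saMap_imaginaryPart, saMap_imaginaryPart,
      ← map_sub]
    exact imaginaryPart.norm_le _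
  nondeg := by
    rw [← norm_ne_zero_iff, norm_diffMap]
    have h : ‖π (pr₁ (saPair (0 : selfAdjoint A₁.carrier) (1 : selfAdjoint A₂.carrier)).1) -
        ρ (pr₂ (saPair (0 : selfAdjoint A₁.carrier) (1 : selfAdjoint A₂.carrier)).1)‖ = 1 := by
      change ‖π 0 - ρ 1‖ = 1
      rw [map_zero, map_one, zero_sub, norm_neg, norm_one]
    rw [h, mul_one]
    exact inv_ne_zero (by exact_mod_cast hε.ne')

variable {L : selfAdjoint E → ℝ≥0∞}

/-- The partner of `a` is a nearly optimal lift along `ρ` of the image of `a`. Both have the same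
image in `E`, so the coupling term is exactly zero, however small `ε` is. -/
lemma quotientCoupling_fst (hπ : ∀ a, L (saMap π a) ≤ A₁.lip a)
    (hρ : IsSeminormQuotient (saMap ρ) A₂.lip L) :
    IsSeminormQuotient (saMap pr₁) (quotientCoupling π ρ hε).lip A₁.lip := by
  refine Coupling.fst_quotient _ fun a r hr => ?_
  obtain ⟨b, hb, hbr⟩ := hρ.lift (saMap π a) r ((hπ a).trans_lt hr)
  refine ⟨b, hbr, ?_⟩
  change ‖diffMap π ρ ε (saPair a b)‖ₑ < r
  exact enorm_lt_of_eq_zero (by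
    rw [diffMap_apply, saMap_pr₁_saPair, saMap_pr₂_saPair, hb, sub_self, smul_zero]) hr

lemma quotientCoupling_snd (hπ : IsSeminormQuotient (saMap π) A₁.lip L)
    (hρ : ∀ a, L (saMap ρ a) ≤ A₂.lip a) :
    IsSeminormQuotient (saMap pr₂) (quotientCoupling π ρ hε).lip A₂.lip := by
  refine Coupling.snd_quotient _ fun b r hr => ?_
  obtain ⟨a, ha, har⟩ := hπ.lift (saMap ρ b) r ((hρ b).trans_lt hr)
  refine ⟨a, har, ?_⟩
  change ‖diffMap π ρ ε (saPair a b)‖ₑ < r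
  exact enorm_lt_of_eq_zero (by
    rw [diffMap_apply, saMap_pr₁_saPair, saMap_pr₂_saPair, ha, sub_self, smul_zero]) hr

lemma enorm_le_of_inv_mul_norm {V W : Type*} [SeminormedAddCommGroup V] [SeminormedAddCommGroup W]
    (hε : 0 < ε) {v : V} {w : W} (hv : ‖v‖ = (ε : ℝ)⁻¹ * ‖w‖) (h : ‖v‖ₑ ≤ 1) : ‖w‖ₑ ≤ ε := by
  have hε' : (0 : ℝ) < ε := by exact_mod_cast hε
  rw [enorm_le_one_iff, hv, inv_mul_le_iff₀ hε', mul_one] at h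
  rw [enorm_eq_nnnorm, ENNReal.coe_le_coe]
  exact h

lemma quotientCoupling_statesWithin_fst {r : ℝ≥0∞} (h : StatesWithin A₂.lip ρ r) :
    StatesWithin (quotientCoupling π ρ hε).lip pr₁ (r + ε) :=
  .of_coupling (Coupling.lip_snd_le _)
    (fun a ha => enorm_le_of_inv_mul_norm hε (norm_diffMap π ρ a)
      ((Coupling.enorm_le_lip (quotientCoupling π ρ hε) a).trans ha))
    exists_state_prod_decomp h

lemma quotientCoupling_statesWithin_snd {r : ℝ≥0∞} (h : StatesWithin A₁.lip π r) :
    StatesWithin (quotientCoupling π ρ hε).lip pr₂ (r + ε) := by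
  refine .of_coupling (π := ρ) (Coupling.lip_fst_le _) (fun a ha => ?_) (fun ψ => ?_) h
  · rw [← edist_eq_enorm_sub, edist_comm, edist_eq_enorm_sub]
    exact enorm_le_of_inv_mul_norm hε (norm_diffMap π ρ a)
      ((Coupling.enorm_le_lip (quotientCoupling π ρ hε) a).trans ha)
  · obtain ⟨t, φ₁, φ₂, h0, h1, hψ⟩ := exists_state_prod_decomp ψ
    -- The factors exchange roles, hence so do the weights.
    refine ⟨1 - t, φ₂, φ₁, by linarith, by linarith, fun a => ?_⟩
    rw [hψ a, sub_sub_cancel, add_comm]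
    rfl

end QuotientCoupling

/-! ### Coupling of modules along a common quotient -/

section ModuleQuotientCoupling

variable {P₁ P₂ Y : MetricalCorr.{u} F K G H} (Φ : ModularQuantumIsometry P₁ Y)
  (Ψ : ModularQuantumIsometry P₂ Y) {ε : ℝ≥0} (hε : 0 < ε)

/-- The difference of two module maps, up to a factor. -/
def modDiffMap (ε : ℝ≥0) : P₁.M × P₂.M →L[ℂ] Y.M :=
  ((ε : ℝ)⁻¹ : ℂ) • (Φ.modMap.comp (ContinuousLinearMap.fst ℂ _ _) -
    Ψ.modMap.comp (ContinuousLinearMap.snd ℂ _ _))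

lemma modDiffMap_apply (ω : P₁.M × P₂.M) :
    modDiffMap Φ Ψ ε ω = ((ε : ℝ)⁻¹ : ℂ) • (Φ.modMap ω.1 - Ψ.modMap ω.2) := rfl

lemma norm_modDiffMap (ω : P₁.M × P₂.M) :
    ‖modDiffMap Φ Ψ ε ω‖ = (ε : ℝ)⁻¹ * ‖Φ.modMap ω.1 - Ψ.modMap ω.2‖ := by
  rw [modDiffMap_apply, norm_smul]
  congr 1
  simp

/-- Telescope the difference of the inner products in `Y`, changing one vector at a time, and apply
Cauchy-Schwarz and contractivity of the module maps. -/
lemma norm_modDiffMap_inner (ω η : P₁.M × P₂.M) :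
    (ε : ℝ)⁻¹ * ‖Φ.rightMap (P₁.ip ω.1 η.1) - Ψ.rightMap (P₂.ip ω.2 η.2)‖ ≤
      ‖modDiffMap Φ Ψ ε ω‖ * ‖η‖ + ‖ω‖ * ‖modDiffMap Φ Ψ ε η‖ := by
  rw [norm_modDiffMap, norm_modDiffMap, mul_assoc, mul_left_comm ‖ω‖, ← mul_add, Φ.map_ip,
    Ψ.map_ip]
  refine mul_le_mul_of_nonneg_left ?_ (inv_nonneg.2 ε.2)
  have h : Y.ip (Φ.modMap ω.1) (Φ.modMap η.1) - Y.ip (Ψ.modMap ω.2) (Ψ.modMap η.2) =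
      Y.ip (Φ.modMap ω.1 - Ψ.modMap ω.2) (Φ.modMap η.1) +
        Y.ip (Ψ.modMap ω.2) (Φ.modMap η.1 - Ψ.modMap η.2) := by
    simp only [MetricalCorr.ip, HilbertModule.inner_sub_left, HilbertModule.inner_sub_right]
    abel
  rw [h]
  refine (norm_add_le _ _).trans (add_le_add ?_ ?_)
  · exact (HilbertModule.norm_inner_le _ _).trans (mul_le_mul_of_nonneg_left
      ((Φ.norm_modMap_le _).trans (norm_fst_le η)) (norm_nonneg _))
  · exact (HilbertModule.norm_inner_le _ _).trans (mul_le_mul_of_nonneg_right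
      ((Ψ.norm_modMap_le _).trans (norm_snd_le ω)) (norm_nonneg _))

/-- The coupling of two metrical C*-correspondences along modular quantum isometries to a common
one. -/
def moduleQuotientCoupling :
    ModuleCoupling P₁ P₂ (selfAdjoint Y.A.carrier) (selfAdjoint Y.B.carrier) Y.M where
  left := quotientCoupling Φ.leftMap Ψ.leftMap hε
  right := quotientCoupling Φ.rightMap Ψ.rightMap hε
  T := modDiffMap Φ Ψ ε
  modular a ω := by
    change _ ≤ _ + ‖diffMap Φ.leftMap Ψ.leftMap ε a‖ * _
    rw [norm_modDiffMap, norm_modDiffMap, norm_diffMap, mul_left_comm ‖a‖, mul_assoc, ← mul_add,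
      Φ.map_lact, Ψ.map_lact]
    refine mul_le_mul_of_nonneg_left ?_ (inv_nonneg.2 ε.2)
    have h : Y.lact (Φ.leftMap (pr₁ a.1)) (Φ.modMap ω.1) -
        Y.lact (Ψ.leftMap (pr₂ a.1)) (Ψ.modMap ω.2) =
        Y.lact (Ψ.leftMap (pr₂ a.1)) (Φ.modMap ω.1 - Ψ.modMap ω.2) +
        Y.lact (Φ.leftMap (pr₁ a.1) - Ψ.leftMap (pr₂ a.1)) (Φ.modMap ω.1) := by
      rw [map_sub, map_sub, sub_apply]; abel
    refine (le_of_eq (congrArg norm h)).trans ((norm_add_le _ _).trans (add_le_add ?_ ?_))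
    · exact (Y.norm_lact_le _ _).trans (mul_le_mul_of_nonneg_right
        ((norm_saMap_le Ψ.leftMap (saMap pr₂ a)).trans (norm_saMap_le pr₂ a)) (norm_nonneg _))
    · exact (Y.norm_lact_le _ _).trans (mul_le_mul_of_nonneg_left
        ((Φ.norm_modMap_le _).trans (norm_fst_le ω)) (norm_nonneg _))
  inner_re ω η := by
    refine le_trans ?_ (norm_modDiffMap_inner Φ Ψ ω η)
    change ‖diffMap Φ.rightMap Ψ.rightMap ε _‖ ≤ _
    rw [diffMap_apply, norm_smul, norm_inv, Real.norm_of_nonneg ε.coe_nonneg, saMap_pr₁_saPair,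
      saMap_pr₂_saPair, saMap_realPart, saMap_realPart, ← map_sub]
    exact mul_le_mul_of_nonneg_left (realPart.norm_le _) (inv_nonneg.2 ε.2)
  inner_im ω η := by
    refine le_trans ?_ (norm_modDiffMap_inner Φ Ψ ω η)
    change ‖diffMap Φ.rightMap Ψ.rightMap ε _‖ ≤ _
    rw [diffMap_apply, norm_smul, norm_inv, Real.norm_of_nonneg ε.coe_nonneg, saMap_pr₁_saPair,
      saMap_pr₂_saPair, saMap_imaginaryPart, saMap_imaginaryPart, ← map_sub]
    exact mul_le_mul_of_nonneg_left (imaginaryPart.norm_le _) (inv_nonneg.2 ε.2)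

lemma moduleQuotientCoupling_fst :
    IsSeminormQuotient Prod.fst (moduleQuotientCoupling Φ Ψ hε).dnorm P₁.dnorm := by
  refine ModuleCoupling.fst_quotient _ fun ω r hr => ?_
  obtain ⟨η, hη, hr'⟩ := Ψ.mod_quotient.lift _ r ((Φ.mod_quotient.le ω).trans_lt hr)
  refine ⟨η, hr', ?_⟩
  change ‖modDiffMap Φ Ψ ε (ω, η)‖ₑ < r
  rw [modDiffMap_apply, hη, sub_self, smul_zero, enorm_zero]
  exact lt_of_le_of_lt bot_le hr

lemma moduleQuotientCoupling_snd :
    IsSeminormQuotient Prod.snd (moduleQuotientCoupling Φ Ψ hε).dnorm P₂.dnorm := by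
  refine ModuleCoupling.snd_quotient _ fun η r hr => ?_
  obtain ⟨ω, hω, hr'⟩ := Φ.mod_quotient.lift _ r ((Ψ.mod_quotient.le η).trans_lt hr)
  refine ⟨ω, hr', ?_⟩
  change ‖modDiffMap Φ Ψ ε (ω, η)‖ₑ < r
  rw [modDiffMap_apply, hω, sub_self, smul_zero, enorm_zero]
  exact lt_of_le_of_lt bot_le hr

end ModuleQuotientCoupling

/-! ### Composition of tunnels -/

namespace Tunnel

variable {X Y Z : MetricalCorr.{u} F K G H} (hF : 1 ≤ F) (hG : 1 ≤ G) (hH : 2 ≤ H)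
  (τ₁ : Tunnel X Y) (τ₂ : Tunnel Y Z) {ε : ℝ≥0} (hε : 0 < ε)

/-- The approximate composition of two tunnels. -/
def comp : Tunnel X Z where
  P := (moduleQuotientCoupling τ₁.toY τ₂.toX hε).sum hF hG hH
  toX := τ₁.toX.comp ((moduleQuotientCoupling τ₁.toY τ₂.toX hε).fst hF hG hH
    (quotientCoupling_fst _ _ hε τ₁.toY.left_quotient.le τ₂.toX.left_quotient)
    (quotientCoupling_fst _ _ hε τ₁.toY.right_quotient.le τ₂.toX.right_quotient)
    (moduleQuotientCoupling_fst _ _ hε))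
  toY := τ₂.toY.comp ((moduleQuotientCoupling τ₁.toY τ₂.toX hε).snd hF hG hH
    (quotientCoupling_snd _ _ hε τ₁.toY.left_quotient τ₂.toX.left_quotient.le)
    (quotientCoupling_snd _ _ hε τ₁.toY.right_quotient τ₂.toX.right_quotient.le)
    (moduleQuotientCoupling_snd _ _ hε))

/-- The leg onto `X` projects the sum onto the first tunnel, which costs `τ₂.extent + ε` as the
states of the second one must be moved to those of `Y`, and then follows `τ₁` down to `X`, which
costs `τ₁.extent`. The leg onto `Z` is symmetric. -/
lemma extent_comp_le : (τ₁.comp hF hG hH τ₂ hε).extent ≤ τ₁.extent + τ₂.extent + ε := by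
  have ht₁ : τ₁.extent ≠ ∞ := (max_lt (legExtent_lt_top _) (legExtent_lt_top _)).ne
  have ht₂ : τ₂.extent ≠ ∞ := (max_lt (legExtent_lt_top _) (legExtent_lt_top _)).ne
  have ht : τ₁.extent + τ₂.extent + ε ≠ ∞ :=
    ENNReal.add_ne_top.2 ⟨ENNReal.add_ne_top.2 ⟨ht₁, ht₂⟩, ENNReal.coe_ne_top⟩
  obtain ⟨a₁, b₁⟩ := (legExtent_le_iff ht₁ τ₁.toX).1 (le_max_left _ _)
  obtain ⟨c₁, d₁⟩ := (legExtent_le_iff ht₁ τ₁.toY).1 (le_max_right _ _)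
  obtain ⟨a₂, b₂⟩ := (legExtent_le_iff ht₂ τ₂.toX).1 (le_max_left _ _)
  obtain ⟨c₂, d₂⟩ := (legExtent_le_iff ht₂ τ₂.toY).1 (le_max_right _ _)
  have e₁ : τ₂.extent + ε + τ₁.extent = τ₁.extent + τ₂.extent + ε := by
    rw [add_comm, add_assoc]
  have e₂ : τ₁.extent + ε + τ₂.extent = τ₁.extent + τ₂.extent + ε := add_right_comm _ _ _
  refine max_le ((legExtent_le_iff ht _).2 ⟨?_, ?_⟩) ((legExtent_le_iff ht _).2 ⟨?_, ?_⟩)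
  · rw [← e₁]
    exact (quotientCoupling_statesWithin_fst _ _ hε a₂).comp a₁ (Coupling.lip_fst_le _)
  · rw [← e₁]
    exact (quotientCoupling_statesWithin_fst _ _ hε b₂).comp b₁ (Coupling.lip_fst_le _)
  · rw [← e₂]
    exact (quotientCoupling_statesWithin_snd _ _ hε c₁).comp c₂ (Coupling.lip_snd_le _)
  · rw [← e₂]
    exact (quotientCoupling_statesWithin_snd _ _ hε d₁).comp d₂ (Coupling.lip_snd_le _)

end Tunnel

end

section

variable {F K G H : ℝ≥0} {J : Type v}

/-! ### Separation -/

section Families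

variable (X : MetricalCorr.{u} F K G H) {φ ψ : J → (X.M →L[ℂ] ℂ)}

lemma MetricalCorr.mkFamily_le_iff {r : ℝ≥0∞} : X.mkFamily φ ψ ≤ r ↔
    ∀ j ξ, X.dnorm ξ ≤ 1 → ‖φ j ξ - ψ j ξ‖ₑ ≤ r := by
  simp only [mkFamily, mkDual, iSup_le_iff]

lemma MetricalCorr.mkFamily_comm : X.mkFamily φ ψ = X.mkFamily ψ φ := by
  simp only [mkFamily, mkDual, ← edist_eq_enorm_sub, edist_comm]

lemma MetricalCorr.mkFamily_self : X.mkFamily φ φ = 0 := by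
  simp [mkFamily, mkDual]

/-- The family of functionals on the domain of a leg which is defined by a functional. -/
def legFamily {P X : MetricalCorr.{u} F K G H} (Φ : ModularQuantumIsometry P X) (a : J → X.Op)
    (φ : X.M →L[ℂ] ℂ) (j : J) : P.M →L[ℂ] ℂ :=
  (φ.comp (a j).toCLM).comp Φ.modMap

lemma mem_legFamilies {P X : MetricalCorr.{u} F K G H} (Φ : ModularQuantumIsometry P X)
    (a : J → X.Op) {φ : X.M →L[ℂ] ℂ} (hφ : φ ∈ X.pseudoStates) :
    legFamily Φ a φ ∈ legFamilies Φ a := ⟨φ, hφ, rfl⟩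

lemma norm_apply_le_of_mem_pseudoStates {φ : X.M →L[ℂ] ℂ} (hφ : φ ∈ X.pseudoStates) (ξ : X.M) :
    ‖φ ξ‖ ≤ ‖ξ‖ := by
  obtain ⟨μ, ω, hω, h⟩ := hφ
  rw [h]
  exact X.norm_pseudoState_le μ hω ξ

end Families

namespace Tunnel

variable {X Y Z : MetricalCorr.{u} F K G H} (hF : 1 ≤ F) (hG : 1 ≤ G) (hH : 2 ≤ H)
  (τ₁ : Tunnel X Y) (τ₂ : Tunnel Y Z) {ε : ℝ≥0} (hε : 0 < ε)

/-- The functional `ψ ∘ b j` on `Y` serves as intermediate, read on the first component through `τ₁`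
and on the second through `τ₂`. The images in `Y` of the two components of `ξ` are at most `ε`
apart, so these readings differ by at most `C * ε`, uniformly in `j`. -/
lemma mkFamily_comp_le {a : J → X.Op} {b : J → Y.Op} {c : J → Z.Op} {C : ℝ≥0}
    (hC : ∀ j, ‖(b j).toCLM‖ ≤ C) {φ : X.M →L[ℂ] ℂ} {ψ : Y.M →L[ℂ] ℂ} {χ : Z.M →L[ℂ] ℂ}
    (hψ : ψ ∈ Y.pseudoStates) {r s : ℝ≥0∞}
    (h₁ : τ₁.P.mkFamily (legFamily τ₁.toX a φ) (legFamily τ₁.toY b ψ) ≤ r)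
    (h₂ : τ₂.P.mkFamily (legFamily τ₂.toX b ψ) (legFamily τ₂.toY c χ) ≤ s) :
    (τ₁.comp hF hG hH τ₂ hε).P.mkFamily (legFamily (τ₁.comp hF hG hH τ₂ hε).toX a φ)
      (legFamily (τ₁.comp hF hG hH τ₂ hε).toY c χ) ≤ r + s + C * ε := by
  refine (MetricalCorr.mkFamily_le_iff _).2 fun j ξ hξ => ?_
  obtain ⟨⟨hξ₁, hξ₂⟩, hξT⟩ := (moduleQuotientCoupling τ₁.toY τ₂.toX hε).dnorm_le_iff.1 hξ
  have e₁ := (MetricalCorr.mkFamily_le_iff _).1 h₁ j ξ.1 hξ₁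
  have e₂ := (MetricalCorr.mkFamily_le_iff _).1 h₂ j ξ.2 hξ₂
  have e₃ : ‖legFamily τ₁.toY b ψ j ξ.1 - legFamily τ₂.toX b ψ j ξ.2‖ₑ ≤ C * ε := by
    have h : legFamily τ₁.toY b ψ j ξ.1 - legFamily τ₂.toX b ψ j ξ.2 =
        ψ ((b j).toCLM (τ₁.toY.modMap ξ.1 - τ₂.toX.modMap ξ.2)) := by
      rw [map_sub, map_sub]; rfl
    have h' : ‖τ₁.toY.modMap ξ.1 - τ₂.toX.modMap ξ.2‖ₑ ≤ ε :=
      enorm_le_of_inv_mul_norm hε (norm_modDiffMap τ₁.toY τ₂.toX ξ) hξT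
    rw [enorm_eq_nnnorm, ENNReal.coe_le_coe] at h'
    rw [h, enorm_eq_nnnorm, ← ENNReal.coe_mul, ENNReal.coe_le_coe]
    refine (norm_apply_le_of_mem_pseudoStates Y hψ _).trans ?_
    refine ((b j).toCLM.le_opNorm _).trans ?_
    exact mul_le_mul (hC j) h' (norm_nonneg _) C.coe_nonneg
  have key : legFamily (τ₁.comp hF hG hH τ₂ hε).toX a φ j ξ -
      legFamily (τ₁.comp hF hG hH τ₂ hε).toY c χ j ξ =
      (legFamily τ₁.toX a φ j ξ.1 - legFamily τ₁.toY b ψ j ξ.1) +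
      (legFamily τ₂.toX b ψ j ξ.2 - legFamily τ₂.toY c χ j ξ.2) +
      (legFamily τ₁.toY b ψ j ξ.1 - legFamily τ₂.toX b ψ j ξ.2) := by
    have h₁ : legFamily (τ₁.comp hF hG hH τ₂ hε).toX a φ j ξ = legFamily τ₁.toX a φ j ξ.1 := rfl
    have h₂ : legFamily (τ₁.comp hF hG hH τ₂ hε).toY c χ j ξ = legFamily τ₂.toY c χ j ξ.2 := rfl
    rw [h₁, h₂]
    ring
  rw [key]
  exact (enorm_add_le _ _).trans (add_le_add ((enorm_add_le _ _).trans (add_le_add e₁ e₂)) e₃)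

lemma separation_comp_le {a : J → X.Op} {b : J → Y.Op} {c : J → Z.Op} {C : ℝ≥0}
    (hC : ∀ j, ‖(b j).toCLM‖ ≤ C) (h₁ : τ₁.separation a b ≠ ∞) (h₂ : τ₂.separation b c ≠ ∞) :
    (τ₁.comp hF hG hH τ₂ hε).separation a c ≤
      τ₁.separation a b + τ₂.separation b c + C * ε := by
  have hr : ∀ (δ : ℝ≥0), (τ₁.separation a b + (δ / 2 : ℝ≥0)) +
      (τ₂.separation b c + (δ / 2 : ℝ≥0)) + C * ε =
      τ₁.separation a b + τ₂.separation b c + C * ε + δ := fun δ => by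
    rw [add_add_add_comm, ← ENNReal.coe_add, add_halves, add_right_comm]
  refine hausdorff_le ?_ ?_
  · rintro _ ⟨φ, hφ, rfl⟩ δ hδ
    obtain ⟨_, ⟨ψ, hψ, rfl⟩, h₁⟩ := exists_le_of_hausdorff_le (le_refl (τ₁.separation a b)) h₁
      (mem_legFamilies τ₁.toX a hφ) (half_pos hδ)
    obtain ⟨_, ⟨χ, hχ, rfl⟩, h₂⟩ := exists_le_of_hausdorff_le (le_refl (τ₂.separation b c)) h₂
      (mem_legFamilies τ₂.toX b hψ) (half_pos hδ)
    exact ⟨_, mem_legFamilies _ c hχ,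
      (mkFamily_comp_le hF hG hH τ₁ τ₂ hε hC hψ h₁ h₂).trans_eq (hr δ)⟩
  · rintro _ ⟨χ, hχ, rfl⟩ δ hδ
    obtain ⟨_, ⟨ψ, hψ, rfl⟩, h₂⟩ := exists_le_of_hausdorff_le
      (hausdorff_comm.trans_le (le_refl (τ₂.separation b c))) h₂
      (mem_legFamilies τ₂.toY c hχ) (half_pos hδ)
    obtain ⟨_, ⟨φ, hφ, rfl⟩, h₁⟩ := exists_le_of_hausdorff_le
      (hausdorff_comm.trans_le (le_refl (τ₁.separation a b))) h₁
      (mem_legFamilies τ₁.toY b hψ) (half_pos hδ)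
    rw [MetricalCorr.mkFamily_comm] at h₁ h₂
    refine ⟨_, mem_legFamilies _ a hφ, ?_⟩
    rw [MetricalCorr.mkFamily_comm]
    exact (mkFamily_comp_le hF hG hH τ₁ τ₂ hε hC hψ h₁ h₂).trans_eq (hr δ)

/-- The same tunnel, with its legs exchanged. -/
def symm (τ : Tunnel X Y) : Tunnel Y X where
  P := τ.P
  toX := τ.toY
  toY := τ.toX

lemma dispersion_symm (τ : Tunnel X Y) (a : J → X.Op) (b : J → Y.Op) :
    τ.symm.dispersion b a = τ.dispersion a b :=
  congrArg₂ max (max_comm _ _) hausdorff_comm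

end Tunnel

/-! ### The propinquity is a pseudo-metric -/

section Propinquity

variable {X Y Z : MetricalCorr.{u} F K G H} {a : J → X.Op} {b : J → Y.Op} {c : J → Z.Op}

lemma opPropinquity_symm_le : opPropinquity b a ≤ opPropinquity a b :=
  le_iInf fun τ => iInf_le_of_le τ.symm (τ.dispersion_symm a b).le

lemma opPropinquity_symm : opPropinquity a b = opPropinquity b a :=
  le_antisymm opPropinquity_symm_le opPropinquity_symm_le

lemma opPropinquity_triangle (hF : 1 ≤ F) (hG : 1 ≤ G) (hH : 2 ≤ H) (hb : IsBoundedFamily b) :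
    opPropinquity a c ≤ opPropinquity a b + opPropinquity b c := by
  obtain ⟨C', hC'⟩ := hb
  have hC : ∀ j, ‖(b j).toCLM‖ ≤ (C'.toNNReal : ℝ) := fun j =>
    (hC' j).trans (Real.le_coe_toNNReal C')
  set C := C'.toNNReal
  refine ENNReal.le_of_forall_pos_le_add fun δ hδ hfin => ?_
  obtain ⟨hab, hbc⟩ := ENNReal.add_lt_top.1 hfin
  have hδ3 : ((δ / 3 : ℝ≥0) : ℝ≥0∞) ≠ 0 := by
    have : 0 < δ / 3 := by positivity
    exact_mod_cast this.ne'
  obtain ⟨τ₁, h₁⟩ := iInf_lt_iff.1 (ENNReal.lt_add_right hab.ne hδ3)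
  obtain ⟨τ₂, h₂⟩ := iInf_lt_iff.1 (ENNReal.lt_add_right hbc.ne hδ3)
  have t₁ := (max_lt_iff.1 h₁)
  have t₂ := (max_lt_iff.1 h₂)
  -- Chosen so that both `ε`, the error in the extent, and `C * ε`, the error in the separation, are
  -- at most `δ / 3`.
  have hε : 0 < δ / (3 * (C + 1)) := by positivity
  have hb1 : ((δ / (3 * (C + 1)) : ℝ≥0) : ℝ≥0∞) ≤ (δ / 3 : ℝ≥0) := by
    rw [ENNReal.coe_le_coe]
    exact div_le_div_of_nonneg_left hδ.le (by positivity)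
      (le_mul_of_one_le_right (by positivity) (le_add_of_nonneg_left (zero_le)))
  have hb2 : (C : ℝ≥0∞) * ((δ / (3 * (C + 1)) : ℝ≥0) : ℝ≥0∞) ≤ (δ / 3 : ℝ≥0) := by
    rw [← ENNReal.coe_mul, ENNReal.coe_le_coe, ← div_div, mul_div_assoc', div_le_iff₀ (by positivity),
      mul_comm]
    exact mul_le_mul_of_nonneg_left (le_add_of_nonneg_right zero_le_one) (zero_le)
  have hsum : opPropinquity a b + (δ / 3 : ℝ≥0) + (opPropinquity b c + (δ / 3 : ℝ≥0)) +
      (δ / 3 : ℝ≥0) = opPropinquity a b + opPropinquity b c + δ := by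
    rw [add_add_add_comm, add_assoc, ← ENNReal.coe_add, ← ENNReal.coe_add, add_thirds]
  refine (iInf_le _ (τ₁.comp hF hG hH τ₂ hε)).trans ?_
  rw [← hsum]
  refine max_le ?_ ?_
  · exact (Tunnel.extent_comp_le hF hG hH τ₁ τ₂ hε).trans
      (add_le_add (add_le_add t₁.1.le t₂.1.le) hb1)
  · exact (Tunnel.separation_comp_le hF hG hH τ₁ τ₂ hε hC (t₁.2.trans_le le_top).ne
      (t₂.2.trans_le le_top).ne).trans (add_le_add (add_le_add t₁.2.le t₂.2.le) hb2)

/-- A full modular quantum isometry which intertwines two families forces their propinquity to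
vanish. -/
lemma opPropinquity_eq_zero_of_isFull (Φ : ModularQuantumIsometry X Y) (hΦ : Φ.IsFull)
    (h : ∀ (j : J) (ω : X.M), Φ.modMap ((a j).toCLM ω) = (b j).toCLM (Φ.modMap ω)) :
    opPropinquity a b = 0 := by
  -- The tunnel is `X` itself, with the identity and `Φ` as legs.
  let τ : Tunnel X Y := ⟨X, ModularQuantumIsometry.refl X, Φ⟩
  have hcomp : ∀ {A B : Type u} [CStarAlgebra A] [CStarAlgebra B] (π : A →⋆ₐ[ℂ] B)
      (_ : Function.Bijective π) (ψ : StateSpace A), ∃ φ : StateSpace B, φ.comp π = ψ := by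
    intro A B _ _ π hπ ψ
    let e := StarAlgEquiv.ofBijective π hπ
    refine ⟨ψ.comp (e.symm : B →⋆ₐ[ℂ] A), Subtype.ext (DFunLike.ext _ _ fun a => ?_)⟩
    change ψ.1 (e.symm (e a)) = ψ.1 a
    rw [e.symm_apply_apply]
  have hwithin : ∀ {A B : Type u} [CStarAlgebra A] [CStarAlgebra B] (L : selfAdjoint A → ℝ≥0∞)
      (π : A →⋆ₐ[ℂ] B) (_ : Function.Bijective π), StatesWithin L π 0 := by
    intro A B _ _ L π hπ ψ ε _
    obtain ⟨φ, hφ⟩ := hcomp π hπ ψ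
    exact ⟨φ, by simp [hφ, mkState_self]⟩
  refine le_antisymm (iInf_le_of_le τ (max_le (max_le ?_ ?_) ?_)) bot_le
  · exact (legExtent_le_iff ENNReal.zero_ne_top _).2
      ⟨hwithin _ _ Function.bijective_id, hwithin _ _ Function.bijective_id⟩
  · exact (legExtent_le_iff ENNReal.zero_ne_top _).2
      ⟨hwithin _ _ hΦ.bij_left, hwithin _ _ hΦ.bij_right⟩
  -- Pushing the vector forward and pulling the state back matches the pseudo-states of `Y` and of
  -- `X`; by the intertwining relation, the families they define on `X` are equal.
  · have key : ∀ (φ : StateSpace Y.B) (ω : X.M),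
        legFamily Φ b (Y.pseudoState φ (Φ.modMap ω)) =
        legFamily (ModularQuantumIsometry.refl X) a (X.pseudoState (φ.comp Φ.rightMap) ω) := by
      intro φ ω
      funext j
      ext ξ
      change φ.1 (Y.ip (Φ.modMap ω) ((b j).toCLM (Φ.modMap ξ))) =
        φ.1 (Φ.rightMap (X.ip ω ((a j).toCLM ξ)))
      rw [← h, Φ.map_ip]
    refine hausdorff_le ?_ ?_
    · rintro _ ⟨φ, ⟨μ, ω, hω, hφ⟩, rfl⟩ ε _
      obtain ⟨ν, rfl⟩ := hcomp Φ.rightMap hΦ.bij_right μ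
      obtain rfl : φ = X.pseudoState (ν.comp Φ.rightMap) ω := by ext ξ; exact hφ ξ
      refine ⟨_, mem_legFamilies Φ b (Y.pseudoState_mem ν (ω := Φ.modMap ω) ?_), ?_⟩
      · rwa [hΦ.dnorm_mod]
      · rw [key]
        exact (MetricalCorr.mkFamily_self X).trans_le bot_le
    · rintro _ ⟨φ, ⟨μ, η, hη, hφ⟩, rfl⟩ ε _
      obtain ⟨ω, rfl⟩ := hΦ.bij_mod.2 η
      obtain rfl : φ = Y.pseudoState μ (Φ.modMap ω) := by ext ξ; exact hφ ξ
      refine ⟨_, mem_legFamilies (ModularQuantumIsometry.refl X) a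
        (X.pseudoState_mem (μ.comp Φ.rightMap) (ω := ω) ?_), ?_⟩
      · rwa [hΦ.dnorm_mod] at hη
      · rw [← key]
        exact (MetricalCorr.mkFamily_self X).trans_le bot_le

lemma ModularQuantumIsometry.refl_isFull (X : MetricalCorr.{u} F K G H) :
    (ModularQuantumIsometry.refl X).IsFull where
  bij_mod := Function.bijective_id
  bij_left := Function.bijective_id
  bij_right := Function.bijective_id
  lip_left _ := rfl
  lip_right _ := rfl
  dnorm_mod _ := rfl

lemma opPropinquity_self (a : J → X.Op) : opPropinquity a a = 0 :=
  opPropinquity_eq_zero_of_isFull (.refl X) (ModularQuantumIsometry.refl_isFull X)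
    fun _ _ => rfl

/-- The dispersion of bounded families is finite. -/
lemma Tunnel.dispersion_lt_top (τ : Tunnel X Y) (ha : IsBoundedFamily a)
    (hb : IsBoundedFamily b) : τ.dispersion a b < ∞ := by
  obtain ⟨C, hC⟩ := ha
  obtain ⟨C', hC'⟩ := hb
  have hleg : ∀ {Z : MetricalCorr.{u} F K G H} (Φ : ModularQuantumIsometry τ.P Z)
      {c : J → Z.Op} {R : ℝ} (_ : ∀ j, ‖(c j).toCLM‖ ≤ R) {φ : Z.M →L[ℂ] ℂ}
      (_ : φ ∈ Z.pseudoStates) (j : J) (ξ : τ.P.M), τ.P.dnorm ξ ≤ 1 →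
      ‖legFamily Φ c φ j ξ‖ ≤ R := by
    intro Z Φ c R hR φ hφ j ξ hξ
    refine (norm_apply_le_of_mem_pseudoStates Z hφ _).trans
      (((c j).toCLM.le_opNorm_of_le ((Φ.norm_modMap_le ξ).trans (τ.P.norm_le_one hξ))).trans ?_)
    rw [mul_one]
    exact hR j
  have hmk : ∀ φ ∈ X.pseudoStates, ∀ ψ ∈ Y.pseudoStates,
      τ.P.mkFamily (legFamily τ.toX a φ) (legFamily τ.toY b ψ) ≤ (C + C').toNNReal := by
    intro φ hφ ψ hψ
    refine (MetricalCorr.mkFamily_le_iff _).2 fun j ξ hξ => ?_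
    rw [enorm_eq_nnnorm, ENNReal.coe_le_coe, ← norm_toNNReal]
    exact Real.toNNReal_mono ((norm_sub_le _ _).trans
      (add_le_add (hleg τ.toX hC hφ j ξ hξ) (hleg τ.toY hC' hψ j ξ hξ)))
  refine max_lt (max_lt (legExtent_lt_top _) (legExtent_lt_top _))
    (lt_of_le_of_lt (hausdorff_le (r := (C + C').toNNReal) ?_ ?_) ENNReal.coe_lt_top)
  · rintro _ ⟨φ, hφ, rfl⟩ ε _
    obtain ⟨ψ, hψ⟩ := Y.pseudoStates_nonempty
    exact ⟨_, mem_legFamilies τ.toY b hψ, (hmk φ hφ ψ hψ).trans le_self_add⟩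
  · rintro _ ⟨ψ, hψ, rfl⟩ ε _
    obtain ⟨φ, hφ⟩ := X.pseudoStates_nonempty
    refine ⟨_, mem_legFamilies τ.toX a hφ, ?_⟩
    rw [MetricalCorr.mkFamily_comm]
    exact (hmk φ hφ ψ hψ).trans le_self_add

end Propinquity

end

section

/-! ### Existence of tunnels -/

/-! ### The self-adjoint part modulo the scalars -/

section ScalarQuotient

variable {D : Type u} [CStarAlgebra D]

/-- The real scalars. -/
abbrev realScalars (D : Type u) [CStarAlgebra D] : Submodule ℝ (selfAdjoint D) := ℝ ∙ 1

instance : IsClosed (realScalars D : Set (selfAdjoint D)) :=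
  Submodule.closed_of_finiteDimensional _

lemma coe_norm_sa (a : selfAdjoint D) : ‖(a : D)‖ = ‖a‖ := rfl

/-- Near optimal scalar approximations of a self-adjoint element may be chosen in the interval
determined by its norm. -/
lemma exists_norm_sub_smul_one_lt [Nontrivial D] (a : selfAdjoint D) {δ : ℝ} (hδ : 0 < δ) :
    ∃ t : ℝ, |t| ≤ ‖a‖ ∧ ‖a - t • 1‖ < ‖(realScalars D).mkQ a‖ + δ := by
  obtain ⟨m, hm, hlt⟩ := Submodule.Quotient.norm_mk_lt ((realScalars D).mkQ a) hδ
  rw [Submodule.mkQ_apply, eq_comm, Submodule.Quotient.eq] at hm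
  obtain ⟨s, hs⟩ := Submodule.mem_span_singleton.1 hm
  have hm' : m = a - s • 1 := by rw [hs, sub_sub_cancel]
  have h0 : -‖a‖ ≤ ‖a‖ := by linarith [norm_nonneg a]
  -- Clamp `s` to the interval `[-‖a‖, ‖a‖]`. All the values of states at `a` lie in this interval,
  -- so none gets farther from the scalar, and the norm of the difference is a supremum over states.
  refine ⟨max (-‖a‖) (min s ‖a‖), abs_le.2 ⟨le_max_left _ _, max_le h0 (min_le_right _ _)⟩,
    lt_of_le_of_lt ?_ hlt⟩
  rw [hm', ← coe_norm_sa]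
  refine norm_le_of_forall_state fun φ => ?_
  have hval : ∀ t : ℝ, φ.1 ((a - t • 1 : selfAdjoint D) : D) =
      (((φ.1 (a : D)).re - t : ℝ) : ℂ) := by
    intro t
    rw [AddSubgroupClass.coe_sub, map_sub, selfAdjoint.val_smul, ← Complex.coe_smul, map_smul,
      selfAdjoint.val_one, φ.2.1, ← StateSpace.ofReal_re_apply φ a]
    simp
  refine le_trans ?_ ((φ.norm_apply_le _).trans (coe_norm_sa _).le)
  rw [hval, hval, Complex.norm_real, Complex.norm_real, Real.norm_eq_abs, Real.norm_eq_abs]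
  have hb : |(φ.1 (a : D)).re| ≤ ‖a‖ := (Complex.abs_re_le_norm _).trans (φ.norm_apply_le _)
  obtain ⟨h1, h2⟩ := abs_le.1 hb
  rcases le_total s ‖a‖ with h3 | h3
  · rw [min_eq_left h3]
    rcases le_total (-‖a‖) s with h4 | h4
    · rw [max_eq_right h4]
    · rw [max_eq_left h4, abs_of_nonneg (by linarith), abs_of_nonneg (by linarith)]
      linarith
  · rw [min_eq_right h3, max_eq_right h0, abs_of_nonpos (by linarith),
      abs_of_nonpos (by linarith)]
    linarith

/-- Modulo scalars, `a b` may be replaced by `a b - s t = (a - s) b + s (b - t)` with `s`, `t`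
nearly optimal scalars. The bound `|s| ≤ ‖a‖` then gives the Leibniz inequality with constant `1`.
The map `f` stands for the real or the imaginary part. -/
lemma mkQ_leibniz [Nontrivial D] (f : D →ₗ[ℝ] selfAdjoint D) (hf : ∀ x, ‖f x‖ ≤ ‖x‖)
    (h1 : f 1 ∈ realScalars D) (a b : selfAdjoint D) :
    ‖(realScalars D).mkQ (f ((a : D) * b))‖ ≤
      ‖(realScalars D).mkQ a‖ * ‖b‖ + ‖a‖ * ‖(realScalars D).mkQ b‖ := by
  refine le_of_forall_pos_le_add fun ε hε => ?_
  have hpos : 0 < ‖a‖ + ‖b‖ + 1 := by positivity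
  set δ := ε / (‖a‖ + ‖b‖ + 1) with hδ
  have hδ0 : 0 < δ := by positivity
  obtain ⟨s, hs, has⟩ := exists_norm_sub_smul_one_lt a hδ0
  obtain ⟨t, ht, hbt⟩ := exists_norm_sub_smul_one_lt b hδ0
  have hprod : (s • (1 : D)) * (t • (1 : D)) = (s * t) • (1 : D) := by
    rw [smul_mul_smul_comm, one_mul]
  have heq : (realScalars D).mkQ (f ((a : D) * b)) =
      (realScalars D).mkQ (f ((a : D) * b - (s • (1 : D)) * (t • (1 : D)))) := by
    rw [hprod, map_sub, map_smul, Submodule.mkQ_apply, Submodule.mkQ_apply,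
      Submodule.Quotient.eq, sub_sub_cancel]
    exact Submodule.smul_mem _ _ h1
  have hn : ‖(s • (1 : D))‖ ≤ ‖a‖ := by
    rw [norm_smul, norm_one, mul_one]
    exact hs
  have has' : ‖(a : D) - s • (1 : D)‖ < ‖(realScalars D).mkQ a‖ + δ := has
  have hbt' : ‖(b : D) - t • (1 : D)‖ < ‖(realScalars D).mkQ b‖ + δ := hbt
  rw [heq]
  calc _ ≤ ‖f ((a : D) * b - (s • (1 : D)) * (t • (1 : D)))‖ := Submodule.Quotient.norm_mk_le _ _
    _ ≤ ‖(a : D) * b - (s • (1 : D)) * (t • (1 : D))‖ := hf _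
    _ ≤ ‖(a : D) - s • (1 : D)‖ * ‖(b : D)‖ + ‖s • (1 : D)‖ * ‖(b : D) - t • (1 : D)‖ :=
      norm_mul_sub_mul_le _ _ _ _
    _ ≤ (‖(realScalars D).mkQ a‖ + δ) * ‖b‖ + ‖a‖ * (‖(realScalars D).mkQ b‖ + δ) := by
      gcongr
      exact (coe_norm_sa b).le
    _ = ‖(realScalars D).mkQ a‖ * ‖b‖ + ‖a‖ * ‖(realScalars D).mkQ b‖ +
        δ * (‖a‖ + ‖b‖) := by ring
    _ ≤ _ := by
      gcongr
      calc δ * (‖a‖ + ‖b‖) ≤ δ * (‖a‖ + ‖b‖ + 1) :=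
          mul_le_mul_of_nonneg_left (le_add_of_nonneg_right zero_le_one) hδ0.le
        _ = ε := div_mul_cancel₀ _ hpos.ne'

/-- The quotient of the self-adjoint part by the scalars. -/
def ScalarQuotient (D : Type u) [CStarAlgebra D] : Type u := selfAdjoint D ⧸ realScalars D

instance : NormedAddCommGroup (ScalarQuotient D) :=
  inferInstanceAs (NormedAddCommGroup (selfAdjoint D ⧸ realScalars D))

instance : NormedSpace ℝ (ScalarQuotient D) :=
  inferInstanceAs (NormedSpace ℝ (selfAdjoint D ⧸ realScalars D))

/-- A multiple of the quotient map by the scalars. -/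
def scalarQuotientMap (D : Type u) [CStarAlgebra D] (R : ℝ≥0) :
    selfAdjoint D →L[ℝ] ScalarQuotient D :=
  (R : ℝ)⁻¹ • (realScalars D).mkQL

lemma norm_scalarQuotientMap (R : ℝ≥0) (a : selfAdjoint D) :
    ‖scalarQuotientMap D R a‖ = (R : ℝ)⁻¹ * ‖(realScalars D).mkQ a‖ := by
  have h := norm_smul (β := ScalarQuotient D) (R : ℝ)⁻¹ ((realScalars D).mkQ a)
  rw [norm_inv, Real.norm_of_nonneg R.coe_nonneg] at h
  exact h

lemma norm_scalarQuotientMap_le (R : ℝ≥0) (a : selfAdjoint D) (t : ℝ) :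
    ‖scalarQuotientMap D R a‖ ≤ (R : ℝ)⁻¹ * ‖a - t • 1‖ := by
  have h : (realScalars D).mkQ a = (realScalars D).mkQ (a - t • 1) := by
    rw [Submodule.mkQ_apply, Submodule.mkQ_apply, Submodule.Quotient.eq, sub_sub_cancel]
    exact Submodule.smul_mem _ _ (Submodule.mem_span_singleton_self _)
  rw [norm_scalarQuotientMap, h]
  exact mul_le_mul_of_nonneg_left (Submodule.Quotient.norm_mk_le _ _) (inv_nonneg.2 R.coe_nonneg)

lemma scalarQuotientMap_one (R : ℝ≥0) : scalarQuotientMap D R 1 = 0 := by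
  have h := norm_scalarQuotientMap_le (D := D) R 1 1
  rwa [one_smul, sub_self, norm_zero, mul_zero, norm_le_zero_iff] at h

lemma exists_eq_smul_one_of_scalarQuotientMap_eq_zero {R : ℝ≥0} (hR : 0 < R) {a : selfAdjoint D}
    (h : scalarQuotientMap D R a = 0) : ∃ t : ℝ, t • 1 = a := by
  have h0 : (R : ℝ)⁻¹ ≠ 0 := inv_ne_zero (by exact_mod_cast hR.ne')
  rw [← norm_eq_zero, norm_scalarQuotientMap, mul_eq_zero, or_iff_right h0] at h
  exact Submodule.mem_span_singleton.1 ((Submodule.Quotient.mk_eq_zero _).1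
    (norm_eq_zero.1 (show ‖((realScalars D).mkQ a : ScalarQuotient D)‖ = 0 from h)))

lemma scalarQuotientMap_leibniz [Nontrivial D] (R : ℝ≥0) (f : D →ₗ[ℝ] selfAdjoint D)
    (hf : ∀ x, ‖f x‖ ≤ ‖x‖) (h1 : f 1 ∈ realScalars D) (a b : selfAdjoint D) :
    ‖scalarQuotientMap D R (f ((a : D) * b))‖ ≤
      ‖scalarQuotientMap D R a‖ * ‖b‖ + ‖a‖ * ‖scalarQuotientMap D R b‖ := by
  rw [norm_scalarQuotientMap, norm_scalarQuotientMap, norm_scalarQuotientMap, mul_assoc,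
    mul_left_comm ‖a‖, ← mul_add]
  exact mul_le_mul_of_nonneg_left (mkQ_leibniz f hf h1 a b) (inv_nonneg.2 R.coe_nonneg)

lemma realPart_one_mem_realScalars : (ℜ (1 : D)) ∈ realScalars D := by
  rw [← selfAdjoint.val_one, selfAdjoint.realPart_coe]
  exact Submodule.mem_span_singleton_self _

lemma imaginaryPart_one_mem_realScalars : (ℑ (1 : D)) ∈ realScalars D := by
  rw [← selfAdjoint.val_one, selfAdjoint.imaginaryPart_coe]
  exact Submodule.zero_mem _

end ScalarQuotient

variable {F K G H : ℝ≥0}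

/-! ### Coupling through the distance to the scalars -/

section ScalarCoupling

variable {A₁ A₂ : QuantumCMS.{u} F K} {R : ℝ≥0}

/-- The coupling given by a multiple of the distance to the scalars. -/
def scalarCoupling (A₁ A₂ : QuantumCMS.{u} F K) (R : ℝ≥0) (hR : 0 < R) : Coupling A₁ A₂
    (ScalarQuotient (A₁.carrier × A₂.carrier)) where
  T := scalarQuotientMap (A₁.carrier × A₂.carrier) R
  map_one := scalarQuotientMap_one R
  leibniz_re := scalarQuotientMap_leibniz R realPart realPart.norm_le realPart_one_mem_realScalars
  leibniz_im := scalarQuotientMap_leibniz R imaginaryPart imaginaryPart.norm_le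
    imaginaryPart_one_mem_realScalars
  nondeg h := by
    obtain ⟨t, ht⟩ := exists_eq_smul_one_of_scalarQuotientMap_eq_zero hR h
    have h1 : t • (1 : A₁.carrier) = 0 := congrArg (fun x => x.1.1) ht
    have h2 : t • (1 : A₂.carrier) = 1 := congrArg (fun x => x.1.2) ht
    obtain h3 | h3 := smul_eq_zero.1 h1
    · rw [h3, zero_smul] at h2
      exact zero_ne_one h2
    · exact one_ne_zero h3

/-- The distance to its value at a state is controlled by the Lipschitz seminorm. -/
lemma enorm_center_le {A : QuantumCMS.{u} F K} (hR : 0 < R)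
    (h : ∀ φ ψ, mkState A.lip φ ψ ≤ R) (μ : StateSpace A.carrier) {a : selfAdjoint A.carrier}
    {r : ℝ≥0∞} (hr : A.lip a < r) : ENNReal.ofReal ((R : ℝ)⁻¹ * ‖center μ a‖) < r := by
  obtain ⟨l, hl, hlr⟩ := ENNReal.lt_iff_exists_nnreal_btwn.1 hr
  have hl0 : 0 < l := by
    rw [← ENNReal.coe_pos]
    exact bot_le.trans_lt hl
  refine lt_of_le_of_lt ?_ hlr
  have hn : ‖center μ a‖ ≤ l * R := by
    rw [← coe_norm_sa]
    refine norm_le_of_forall_state fun φ => ?_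
    rw [state_center]
    have := (enorm_sub_le_mul_mkState (φ := φ) (ψ := μ) A.isLipSeminorm.smul hl0 hl.le).trans
      (mul_le_mul_right (h φ μ) _)
    rw [enorm_eq_nnnorm] at this
    exact_mod_cast this
  have hR' : (0 : ℝ) < R := by exact_mod_cast hR
  rw [← ENNReal.ofReal_coe_nnreal]
  refine ENNReal.ofReal_le_ofReal ?_
  rw [inv_mul_le_iff₀ hR']
  linarith

lemma enorm_scalarCoupling_le (hR : 0 < R) (a : selfAdjoint (A₁.carrier × A₂.carrier)) (t : ℝ) :
    ‖(scalarCoupling A₁ A₂ R hR).T a‖ₑ ≤ ENNReal.ofReal ((R : ℝ)⁻¹ * ‖a - t • 1‖) := by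
  rw [← ofReal_norm]
  exact ENNReal.ofReal_le_ofReal (norm_scalarQuotientMap_le R a t)

/-- The partner of `a` is the scalar `μ a`, of seminorm zero. The pair is at distance at most
`‖center μ a‖` from the scalars of the product, and this is at most `R` times the seminorm of `a`
because `R` bounds the diameter. -/
lemma scalarCoupling_fst_quotient (hR : 0 < R) (h : ∀ φ ψ, mkState A₁.lip φ ψ ≤ R) :
    IsSeminormQuotient (saMap pr₁) (scalarCoupling A₁ A₂ R hR).lip A₁.lip := by
  refine Coupling.fst_quotient _ fun a r hr => ?_
  let μ : StateSpace A₁.carrier := Classical.arbitrary _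
  refine ⟨(μ.1 (a : A₁.carrier)).re • 1, ?_, ?_⟩
  · rw [A₂.lip_smul, A₂.lip_one, mul_zero]
    exact bot_le.trans_lt hr
  · refine (enorm_scalarCoupling_le hR _ (μ.1 (a : A₁.carrier)).re).trans_lt ?_
    convert enorm_center_le hR h μ hr using 3
    have : saPair a ((μ.1 (a : A₁.carrier)).re • (1 : selfAdjoint A₂.carrier)) -
        (μ.1 (a : A₁.carrier)).re • 1 = saPair (center μ a) 0 := by
      refine Subtype.ext (Prod.ext ?_ (sub_self _))
      change _ = ((a + (-(μ.1 (a : A₁.carrier)).re) • 1 : selfAdjoint A₁.carrier) : A₁.carrier)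
      rw [neg_smul, ← sub_eq_add_neg]
      rfl
    rw [this, norm_saPair, norm_zero, max_eq_left (norm_nonneg _)]

lemma scalarCoupling_snd_quotient (hR : 0 < R) (h : ∀ φ ψ, mkState A₂.lip φ ψ ≤ R) :
    IsSeminormQuotient (saMap pr₂) (scalarCoupling A₁ A₂ R hR).lip A₂.lip := by
  refine Coupling.snd_quotient _ fun a r hr => ?_
  let μ : StateSpace A₂.carrier := Classical.arbitrary _
  refine ⟨(μ.1 (a : A₂.carrier)).re • 1, ?_, ?_⟩
  · rw [A₁.lip_smul, A₁.lip_one, mul_zero]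
    exact bot_le.trans_lt hr
  · refine (enorm_scalarCoupling_le hR _ (μ.1 (a : A₂.carrier)).re).trans_lt ?_
    convert enorm_center_le hR h μ hr using 3
    have : saPair ((μ.1 (a : A₂.carrier)).re • (1 : selfAdjoint A₁.carrier)) a -
        (μ.1 (a : A₂.carrier)).re • 1 = saPair 0 (center μ a) := by
      refine Subtype.ext (Prod.ext (sub_self _) ?_)
      change _ = ((a + (-(μ.1 (a : A₂.carrier)).re) • 1 : selfAdjoint A₂.carrier) : A₂.carrier)
      rw [neg_smul, ← sub_eq_add_neg]
      rfl
    rw [this, norm_saPair, norm_zero, max_eq_right (norm_nonneg _)]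

end ScalarCoupling

variable {X Y : MetricalCorr.{u} F K G H}

lemma norm_scalarCoupling_inner_le (R : ℝ≥0) (hR : 0 < R) (ω η : X.M × Y.M) {a : selfAdjoint X.B.carrier}
    {b : selfAdjoint Y.B.carrier} (ha : ‖a‖ ≤ ‖X.ip ω.1 η.1‖) (hb : ‖b‖ ≤ ‖Y.ip ω.2 η.2‖) :
    ‖(scalarCoupling X.B Y.B R hR).T (saPair a b)‖ ≤
      ‖(((R : ℝ)⁻¹ : ℂ) • ContinuousLinearMap.id ℂ (X.M × Y.M)) ω‖ * ‖η‖ +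
      ‖ω‖ * ‖(((R : ℝ)⁻¹ : ℂ) • ContinuousLinearMap.id ℂ (X.M × Y.M)) η‖ := by
  refine le_add_of_le_of_nonneg ?_ (mul_nonneg (norm_nonneg _) (norm_nonneg _))
  have h := enorm_scalarCoupling_le hR (saPair a b) 0
  rw [← ofReal_norm, ENNReal.ofReal_le_ofReal_iff (by positivity), zero_smul, sub_zero,
    norm_saPair] at h
  refine h.trans ?_
  rw [smul_apply, norm_smul, norm_inv, Complex.norm_real, Real.norm_of_nonneg R.coe_nonneg,
    mul_assoc]
  refine mul_le_mul_of_nonneg_left ?_ (inv_nonneg.2 R.coe_nonneg)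
  refine max_le (ha.trans ((HilbertModule.norm_inner_le _ _).trans ?_))
    (hb.trans ((HilbertModule.norm_inner_le _ _).trans ?_))
  · exact mul_le_mul (norm_fst_le ω) (norm_fst_le η) (norm_nonneg _) (norm_nonneg _)
  · exact mul_le_mul (norm_snd_le ω) (norm_snd_le η) (norm_nonneg _) (norm_nonneg _)

/-- The coupling of two metrical C*-correspondences through the distances to the scalars. -/
def scalarModuleCoupling (X Y : MetricalCorr.{u} F K G H) (R : ℝ≥0) (hR : 0 < R) :
    ModuleCoupling X Y (ScalarQuotient (X.A.carrier × Y.A.carrier))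
      (ScalarQuotient (X.B.carrier × Y.B.carrier)) (X.M × Y.M) where
  left := scalarCoupling X.A Y.A R hR
  right := scalarCoupling X.B Y.B R hR
  T := ((R : ℝ)⁻¹ : ℂ) • ContinuousLinearMap.id ℂ (X.M × Y.M)
  modular a ω := by
    refine le_add_of_le_of_nonneg ?_ (mul_nonneg (norm_nonneg _) (norm_nonneg _))
    rw [smul_apply, smul_apply, norm_smul, norm_smul, mul_left_comm]
    refine mul_le_mul_of_nonneg_left ?_ (norm_nonneg _)
    refine max_le ((X.norm_lact_le _ _).trans ?_) ((Y.norm_lact_le _ _).trans ?_)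
    · exact mul_le_mul (norm_saMap_le pr₁ a) (norm_fst_le ω) (norm_nonneg _) (norm_nonneg _)
    · exact mul_le_mul (norm_saMap_le pr₂ a) (norm_snd_le ω) (norm_nonneg _) (norm_nonneg _)
  inner_re ω η := norm_scalarCoupling_inner_le R hR ω η (realPart.norm_le _) (realPart.norm_le _)
  inner_im ω η := norm_scalarCoupling_inner_le R hR ω η (imaginaryPart.norm_le _) (imaginaryPart.norm_le _)

lemma enorm_scalarModuleCoupling_le {R : ℝ≥0} (hR : 1 ≤ R) (ω : X.M × Y.M) :
    ‖(scalarModuleCoupling X Y R (one_pos.trans_le hR)).T ω‖ₑ ≤ ‖ω‖ₑ := by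
  refine enorm_le_of_norm_le ?_
  change ‖((R : ℝ)⁻¹ : ℂ) • ω‖ ≤ ‖ω‖
  rw [norm_smul, norm_inv, Complex.norm_real, Real.norm_of_nonneg R.coe_nonneg]
  exact mul_le_of_le_one_left (norm_nonneg _) (inv_le_one_of_one_le₀ (by exact_mod_cast hR))

/-- `R` dominates the diameters of the four state spaces, so that elements of the algebras lift, and
`1`, so that `(ω, 0)` and `(0, η)` are lifts of the same D-norm: `T` is then at most the norm, hence
at most the D-norm. -/
lemma nonempty_tunnel (hF : 1 ≤ F) (hG : 1 ≤ G) (hH : 2 ≤ H) (X Y : MetricalCorr.{u} F K G H) :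
    Nonempty (Tunnel X Y) := by
  obtain ⟨R₁, h₁⟩ := X.A.exists_mkState_le
  obtain ⟨R₂, h₂⟩ := Y.A.exists_mkState_le
  obtain ⟨R₃, h₃⟩ := X.B.exists_mkState_le
  obtain ⟨R₄, h₄⟩ := Y.B.exists_mkState_le
  obtain ⟨R, hR, hR₁, hR₂, hR₃, hR₄⟩ :
      ∃ R : ℝ≥0, 1 ≤ R ∧ R₁ ≤ R ∧ R₂ ≤ R ∧ R₃ ≤ R ∧ R₄ ≤ R :=
    ⟨1 + R₁ + R₂ + R₃ + R₄, by
      refine ⟨?_, ?_, ?_, ?_, ?_⟩ <;> rw [← NNReal.coe_le_coe] <;> push_cast <;>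
      linarith [R₁.coe_nonneg, R₂.coe_nonneg, R₃.coe_nonneg, R₄.coe_nonneg]⟩
  have hle : ∀ {S : ℝ≥0} {x : ℝ≥0∞}, x ≤ S → S ≤ R → x ≤ R := fun h h' =>
    h.trans (by exact_mod_cast h')
  let C := scalarModuleCoupling X Y R (one_pos.trans_le hR)
  refine ⟨⟨C.sum hF hG hH, C.fst hF hG hH
    (scalarCoupling_fst_quotient (one_pos.trans_le hR) fun φ ψ => hle (h₁ φ ψ) hR₁)
    (scalarCoupling_fst_quotient (one_pos.trans_le hR) fun φ ψ => hle (h₃ φ ψ) hR₃)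
    (C.fst_quotient fun ω r hr => ⟨0, ?_, ?_⟩),
    C.snd hF hG hH (scalarCoupling_snd_quotient (one_pos.trans_le hR) fun φ ψ => hle (h₂ φ ψ) hR₂)
    (scalarCoupling_snd_quotient (one_pos.trans_le hR) fun φ ψ => hle (h₄ φ ψ) hR₄)
    (C.snd_quotient fun ω r hr => ⟨0, ?_, ?_⟩)⟩⟩
  · rw [Y.dnorm_zero]
    exact bot_le.trans_lt hr
  · refine (enorm_scalarModuleCoupling_le hR _).trans_lt (lt_of_le_of_lt ?_ hr)
    refine (enorm_le_of_norm_le ?_).trans (X.norm_le_dnorm ω)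
    rw [Prod.norm_def, norm_zero, max_eq_left (norm_nonneg _)]
  · rw [X.dnorm_zero]
    exact bot_le.trans_lt hr
  · refine (enorm_scalarModuleCoupling_le hR _).trans_lt (lt_of_le_of_lt ?_ hr)
    refine (enorm_le_of_norm_le ?_).trans (Y.norm_le_dnorm ω)
    rw [Prod.norm_def, norm_zero, max_eq_right (norm_nonneg _)]

lemma opPropinquity_lt_top (hF : 1 ≤ F) (hG : 1 ≤ G) (hH : 2 ≤ H) {J : Type v}
    {a : J → X.Op} {b : J → Y.Op} (ha : IsBoundedFamily a) (hb : IsBoundedFamily b) :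
    opPropinquity a b < ∞ := by
  obtain ⟨τ⟩ := nonempty_tunnel hF hG hH X Y
  exact (iInf_le _ τ).trans_lt (τ.dispersion_lt_top ha hb)

end

section

/-! ### Isometries whose graph is a given subspace -/

/-- For the maximum norm of the product, both projections are isometric on `S`. As `S` is complete,
their ranges are closed, and dense by assumption; so both are onto, and the inverse of the first
followed by the second has graph `S`. -/
lemma exists_linearIsometry_of_graph {E E' : Type*} [NormedAddCommGroup E] [NormedSpace ℂ E]
    [CompleteSpace E] [NormedAddCommGroup E'] [NormedSpace ℂ E'] [CompleteSpace E']
    (S : Submodule ℂ (E × E')) (hS : IsClosed (S : Set (E × E')))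
    (hn : ∀ x ∈ S, ‖x.1‖ = ‖x.2‖) (h₁ : Dense (Prod.fst '' (S : Set (E × E'))))
    (h₂ : Dense (Prod.snd '' (S : Set (E × E')))) :
    ∃ e : E ≃ₗᵢ[ℂ] E', ∀ x, x ∈ S ↔ e x.1 = x.2 := by
  have : CompleteSpace S := hS.completeSpace_coe
  let f₁ : S →ₗᵢ[ℂ] E := ⟨LinearMap.fst ℂ E E' ∘ₗ S.subtype, fun x => by
    change ‖x.1.1‖ = max ‖x.1.1‖ ‖x.1.2‖
    rw [← hn x.1 x.2, max_self]⟩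
  let f₂ : S →ₗᵢ[ℂ] E' := ⟨LinearMap.snd ℂ E E' ∘ₗ S.subtype, fun x => by
    change ‖x.1.2‖ = max ‖x.1.1‖ ‖x.1.2‖
    rw [hn x.1 x.2, max_self]⟩
  have hs₁ : Function.Surjective f₁ := by
    rw [← Set.range_eq_univ, ← f₁.isometry.isClosedEmbedding.isClosed_range.closure_eq]
    convert h₁.closure_eq
    ext x
    exact ⟨fun ⟨y, hy⟩ => ⟨y.1, y.2, hy⟩, fun ⟨y, hy, h⟩ => ⟨⟨y, hy⟩, h⟩⟩
  have hs₂ : Function.Surjective f₂ := by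
    rw [← Set.range_eq_univ, ← f₂.isometry.isClosedEmbedding.isClosed_range.closure_eq]
    convert h₂.closure_eq
    ext x
    exact ⟨fun ⟨y, hy⟩ => ⟨y.1, y.2, hy⟩, fun ⟨y, hy, h⟩ => ⟨⟨y, hy⟩, h⟩⟩
  let e₁ := LinearIsometryEquiv.ofSurjective f₁ hs₁
  let e₂ := LinearIsometryEquiv.ofSurjective f₂ hs₂
  refine ⟨e₁.symm.trans e₂, fun x => ⟨fun hx => ?_, fun hx => ?_⟩⟩
  · have : e₁.symm x.1 = ⟨x, hx⟩ := e₁.symm_apply_eq.2 rfl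
    rw [LinearIsometryEquiv.trans_apply, this]
    rfl
  · have h1 : (e₁.symm x.1).1.1 = x.1 := e₁.apply_symm_apply x.1
    have h2 : (e₁.symm x.1).1.2 = x.2 := hx
    have h3 : (e₁.symm x.1).1 = x := Prod.ext h1 h2
    exact h3 ▸ (e₁.symm x.1).2

/-! ### Lipschitz elements of a quantum compact metric space -/

variable {F K G H : ℝ≥0}

namespace QuantumCMS

variable (Q : QuantumCMS.{u} F K)

/-- The Lipschitz seminorms of the real and imaginary parts, and the norm, are at most `l`. -/
structure IsBoundedBy (l : ℝ≥0) (d : Q.carrier) : Prop where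
  re : Q.lip (ℜ d) ≤ l
  im : Q.lip (ℑ d) ≤ l
  norm : ‖d‖ ≤ l

variable {Q} {l m : ℝ≥0} {d e : Q.carrier}

lemma isBoundedBy_of_selfAdjoint {d : selfAdjoint Q.carrier} (h : Q.lip d ≤ l) (hn : ‖d‖ ≤ l) :
    Q.IsBoundedBy l (d : Q.carrier) where
  re := by rwa [selfAdjoint.realPart_coe]
  im := by
    rw [selfAdjoint.imaginaryPart_coe, Q.isLipSeminorm.zero]
    exact bot_le
  norm := hn

lemma IsBoundedBy.add (h : Q.IsBoundedBy l d) (h' : Q.IsBoundedBy m e) :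
    Q.IsBoundedBy (l + m) (d + e) where
  re := by
    rw [map_add, ENNReal.coe_add]
    exact (Q.lip_add_le _ _).trans (add_le_add h.re h'.re)
  im := by
    rw [map_add, ENNReal.coe_add]
    exact (Q.lip_add_le _ _).trans (add_le_add h.im h'.im)
  norm := (norm_add_le _ _).trans (add_le_add h.norm h'.norm)

lemma IsBoundedBy.star (h : Q.IsBoundedBy l d) : Q.IsBoundedBy l (Star.star d) where
  re := by
    have h1 : ℜ (Star.star d) = ℜ d := Subtype.ext (by
      rw [realPart_apply_coe, realPart_apply_coe, star_star, add_comm])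
    rw [h1]
    exact h.re
  im := by
    have h1 : ℑ (Star.star d) = -ℑ d := Subtype.ext (by
      rw [NegMemClass.coe_neg, imaginaryPart_apply_coe, imaginaryPart_apply_coe, star_star,
        ← neg_sub d, smul_neg, smul_neg])
    rw [h1, Q.isLipSeminorm.neg]
    exact h.im
  norm := by
    rw [norm_star]
    exact h.norm

lemma IsBoundedBy.I_smul (h : Q.IsBoundedBy l d) : Q.IsBoundedBy l (Complex.I • d) where
  re := by
    rw [realPart_I_smul, Q.isLipSeminorm.neg]
    exact h.im
  im := by
    rw [imaginaryPart_I_smul]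
    exact h.re
  norm := by
    rw [norm_smul, Complex.norm_I, one_mul]
    exact h.norm

lemma IsBoundedBy.real_smul (h : Q.IsBoundedBy l d) (t : ℝ) : Q.IsBoundedBy (‖t‖₊ * l) (t • d) where
  re := by
    rw [map_smul, Q.lip_smul, ENNReal.coe_mul]
    exact mul_le_mul_right h.re _
  im := by
    rw [map_smul, Q.lip_smul, ENNReal.coe_mul]
    exact mul_le_mul_right h.im _
  norm := by
    rw [norm_smul]
    exact mul_le_mul_of_nonneg_left h.norm (norm_nonneg _)

lemma IsBoundedBy.complex_smul (h : Q.IsBoundedBy l d) (z : ℂ) :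
    Q.IsBoundedBy (‖z.re‖₊ * l + ‖z.im‖₊ * l) (z • d) := by
  have hz : z • d = z.re • d + z.im • (Complex.I • d) := by
    rw [← Complex.coe_smul, ← Complex.coe_smul, smul_smul, ← add_smul, Complex.re_add_im]
  rw [hz]
  exact (h.real_smul _).add (h.I_smul.real_smul _)

lemma isBoundedBy_one : Q.IsBoundedBy 1 (1 : Q.carrier) := by
  rw [← selfAdjoint.val_one]
  exact isBoundedBy_of_selfAdjoint (Q.lip_one ▸ bot_le) (norm_one (α := Q.carrier)).le

/-- The last summand `l * m` only serves the norm; the others come from the Leibniz inequality. -/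
lemma isBoundedBy_mul_coe {a b : selfAdjoint Q.carrier} (ha : Q.lip a ≤ l) (hb : Q.lip b ≤ m)
    (hna : ‖(a : Q.carrier)‖ ≤ l) (hnb : ‖(b : Q.carrier)‖ ≤ m) :
    Q.IsBoundedBy (F * (l * m + l * m) + K * l * m + l * m) ((a : Q.carrier) * b) := by
  have hna' : ‖(a : Q.carrier)‖ₑ ≤ l := by
    rw [enorm_eq_nnnorm]
    exact_mod_cast hna
  have hnb' : ‖(b : Q.carrier)‖ₑ ≤ m := by
    rw [enorm_eq_nnnorm]
    exact_mod_cast hnb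
  have h := leibniz_mono (Q.leibniz a b (ha.trans_lt ENNReal.coe_lt_top)
    (hb.trans_lt ENNReal.coe_lt_top)) ha hb hna' hnb'
  have h' : max (Q.lip (ℜ ((a : Q.carrier) * b))) (Q.lip (ℑ ((a : Q.carrier) * b))) ≤
      ((F * (l * m + l * m) + K * l * m + l * m : ℝ≥0) : ℝ≥0∞) := by
    push_cast
    exact h.trans le_self_add
  refine ⟨(le_max_left _ _).trans h', (le_max_right _ _).trans h', ?_⟩
  refine (norm_mul_le _ _).trans ((mul_le_mul hna hnb (norm_nonneg _) l.coe_nonneg).trans ?_)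
  exact_mod_cast le_add_self

/-- The bound depends only on `F`, `K`, `l` and `m`, not on the space; it is thus uniform along a
sequence of different spaces. -/
lemma IsBoundedBy.exists_mul (l m : ℝ≥0) : ∃ r : ℝ≥0, ∀ (Q : QuantumCMS.{u} F K)
    (d e : Q.carrier), Q.IsBoundedBy l d → Q.IsBoundedBy m e → Q.IsBoundedBy r (d * e) := by
  let r := F * (l * m + l * m) + K * l * m + l * m
  refine ⟨r + r + (r + r), fun Q d e h h' => ?_⟩
  have hd := (realPart.norm_le d).trans h.norm
  have hd' := (imaginaryPart.norm_le d).trans h.norm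
  have he := (realPart.norm_le e).trans h'.norm
  have he' := (imaginaryPart.norm_le e).trans h'.norm
  have key : d * e = ((ℜ d : Q.carrier) * ℜ e + Complex.I • ((ℜ d : Q.carrier) * ℑ e)) +
      (Complex.I • ((ℑ d : Q.carrier) * ℜ e) +
        Complex.I • (Complex.I • ((ℑ d : Q.carrier) * ℑ e))) := by
    conv_lhs => rw [← realPart_add_I_smul_imaginaryPart d, ← realPart_add_I_smul_imaginaryPart e]
    simp only [add_mul, mul_add, smul_mul_assoc, mul_smul_comm, smul_add]
    abel
  rw [key]
  exact ((isBoundedBy_mul_coe h.re h'.re hd he).add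
    (isBoundedBy_mul_coe h.re h'.im hd he').I_smul).add
    ((isBoundedBy_mul_coe h.im h'.re hd' he).I_smul.add
    (isBoundedBy_mul_coe h.im h'.im hd' he').I_smul.I_smul)

end QuantumCMS

/-! ### Sequences of bridges of vanishing extent -/

/-- The limits are taken along a fixed nonprincipal ultrafilter. -/
abbrev limFilter : Ultrafilter ℕ := Filter.hyperfilter ℕ

/-- The size of the `n`-th bridge. -/
def bridgeSize (n : ℕ) : ℝ≥0 := 1 / (n + 1)

lemma bridgeSize_le_one (n : ℕ) : bridgeSize n ≤ 1 := by
  rw [bridgeSize]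
  exact div_le_one_of_le₀ (le_add_of_nonneg_left bot_le) bot_le

lemma tendsto_bridgeSize :
    Filter.Tendsto (fun n => (bridgeSize n : ℝ)) limFilter (𝓝 0) := by
  refine Filter.Tendsto.mono_left ?_ Nat.hyperfilter_le_atTop
  simpa [bridgeSize] using tendsto_one_div_add_atTop_nhds_zero_nat (𝕜 := ℝ)

lemma eventually_add_bridgeSize_le {l r : ℝ≥0∞} (h : l < r) :
    ∀ᶠ n in (limFilter : Filter ℕ), l + bridgeSize n ≤ r := by
  have h0 : Filter.Tendsto (fun n => (bridgeSize n : ℝ≥0∞)) limFilter (𝓝 0) := by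
    rw [← ENNReal.coe_zero, ENNReal.tendsto_coe, ← NNReal.tendsto_coe]
    exact tendsto_bridgeSize
  have h1 := h0.const_add l
  rw [add_zero] at h1
  exact (h1.eventually (gt_mem_nhds h)).mono fun _ h => h.le

/-- A sequence of quantum compact metric spaces which project onto two given ones, with
extents vanishing at infinity. -/
structure BridgeSequence (A A' : QuantumCMS.{u} F K) where
  D : ℕ → QuantumCMS.{u} F K
  p : ∀ n, StarHom (D n).carrier A.carrier
  q : ∀ n, StarHom (D n).carrier A'.carrier
  p_quotient : ∀ n, IsSeminormQuotient (saMap (p n)) (D n).lip A.lip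
  q_quotient : ∀ n, IsSeminormQuotient (saMap (q n)) (D n).lip A'.lip
  p_states : ∀ n, StatesWithin (D n).lip (p n) (bridgeSize n)
  q_states : ∀ n, StatesWithin (D n).lip (q n) (bridgeSize n)

namespace BridgeSequence

variable {A A' : QuantumCMS.{u} F K} (𝔅 : BridgeSequence A A')

/-- The reversed sequence. -/
def symm : BridgeSequence A' A where
  D := 𝔅.D
  p := 𝔅.q
  q := 𝔅.p
  p_quotient := 𝔅.q_quotient
  q_quotient := 𝔅.p_quotient
  p_states := 𝔅.q_states
  q_states := 𝔅.p_states

/-- The pairs of limits of images of a bounded sequence. -/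
def IsLimit (x : A.carrier × A'.carrier) : Prop :=
  ∃ (d : ∀ n, (𝔅.D n).carrier) (l : ℝ≥0), (∀ n, (𝔅.D n).IsBoundedBy l (d n)) ∧
    Filter.Tendsto (fun n => 𝔅.p n (d n)) limFilter (𝓝 x.1) ∧
    Filter.Tendsto (fun n => 𝔅.q n (d n)) limFilter (𝓝 x.2)

lemma isLimit_symm {x : A.carrier × A'.carrier} (h : 𝔅.IsLimit x) : 𝔅.symm.IsLimit x.swap := by
  obtain ⟨d, l, hl, h₁, h₂⟩ := h
  exact ⟨d, l, hl, h₂, h₁⟩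

/-- The pairs of limits form a *-algebra. -/
def limits : StarSubalgebra ℂ (A.carrier × A'.carrier) where
  carrier := {x | 𝔅.IsLimit x}
  mul_mem' := by
    rintro x y ⟨d, l, hl, h₁, h₂⟩ ⟨e, m, hm, h₁', h₂'⟩
    obtain ⟨r, hr⟩ := QuantumCMS.IsBoundedBy.exists_mul (F := F) (K := K) l m
    refine ⟨fun n => d n * e n, r, fun n => hr _ _ _ (hl n) (hm n), ?_, ?_⟩
    · simp only [map_mul]
      exact h₁.mul h₁'
    · simp only [map_mul]
      exact h₂.mul h₂'
  add_mem' := by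
    rintro x y ⟨d, l, hl, h₁, h₂⟩ ⟨e, m, hm, h₁', h₂'⟩
    refine ⟨fun n => d n + e n, l + m, fun n => (hl n).add (hm n), ?_, ?_⟩
    · simp only [map_add]
      exact h₁.add h₁'
    · simp only [map_add]
      exact h₂.add h₂'
  algebraMap_mem' z := by
    refine ⟨fun n => algebraMap ℂ _ z, ‖z.re‖₊ * 1 + ‖z.im‖₊ * 1, fun n => ?_, ?_, ?_⟩
    · beta_reduce
      rw [Algebra.algebraMap_eq_smul_one]
      exact QuantumCMS.isBoundedBy_one.complex_smul z
    · simp only [AlgHomClass.commutes]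
      exact tendsto_const_nhds
    · simp only [AlgHomClass.commutes]
      exact tendsto_const_nhds
  star_mem' := by
    rintro x ⟨d, l, hl, h₁, h₂⟩
    refine ⟨fun n => star (d n), l, fun n => (hl n).star, ?_, ?_⟩
    · simp only [map_star]
      exact h₁.star
    · simp only [map_star]
      exact h₂.star

/-- Norms can be compared through states for self-adjoint elements only, so `star d * d` is used.
Its Lipschitz seminorm is uniformly bounded by the Leibniz inequality, hence `‖q d‖ ^ 2 ≤ ‖star d *
d‖ ≤ ‖p d‖ ^ 2 + (r + 1) / (n + 1)`. -/
lemma norm_snd_le_of_isLimit {x : A.carrier × A'.carrier} (h : 𝔅.IsLimit x) : ‖x.2‖ ≤ ‖x.1‖ := by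
  obtain ⟨d, l, hl, h₁, h₂⟩ := h
  obtain ⟨r, hr⟩ := QuantumCMS.IsBoundedBy.exists_mul (F := F) (K := K) l l
  have key : ∀ n, ‖𝔅.q n (d n)‖ * ‖𝔅.q n (d n)‖ ≤
      ‖𝔅.p n (d n)‖ * ‖𝔅.p n (d n)‖ + ((r + 1 : ℝ≥0) : ℝ) * bridgeSize n := by
    intro n
    have hb := hr _ _ _ (hl n).star (hl n)
    let s : selfAdjoint (𝔅.D n).carrier := ⟨star (d n) * d n, IsSelfAdjoint.star_mul_self _⟩
    have hs : (𝔅.D n).lip s ≤ (r + 1 : ℝ≥0) := by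
      have h0 := hb.re
      have h1 : ℜ (star (d n) * d n) = s := selfAdjoint.realPart_coe (x := s)
      rw [h1] at h0
      exact h0.trans (by exact_mod_cast le_self_add)
    have h1 := (𝔅.p_states n).norm_le (𝔅.D n).isLipSeminorm.smul (by positivity) hs
    have h2 : ‖𝔅.q n (star (d n) * d n)‖ ≤ ‖star (d n) * d n‖ :=
      NonUnitalStarAlgHom.norm_apply_le (𝔅.q n) _
    have h3 := h2.trans h1
    change _ ≤ ‖𝔅.p n (star (d n) * d n)‖ + _ at h3
    rwa [map_mul, map_star, CStarRing.norm_star_mul_self, map_mul, map_star,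
      CStarRing.norm_star_mul_self] at h3
  have hlim := le_of_tendsto_of_tendsto' (h₂.norm.mul h₂.norm)
    ((h₁.norm.mul h₁.norm).add (tendsto_bridgeSize.const_mul _)) key
  rw [mul_zero, add_zero] at hlim
  exact abs_le_of_sq_le_sq' (by simpa only [sq] using hlim) (norm_nonneg _) |>.2

lemma norm_eq_of_isLimit {x : A.carrier × A'.carrier} (h : 𝔅.IsLimit x) : ‖x.1‖ = ‖x.2‖ :=
  le_antisymm (𝔅.symm.norm_snd_le_of_isLimit (𝔅.isLimit_symm h)) (𝔅.norm_snd_le_of_isLimit h)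

/-- Lift `a` with excess below `1 / (n + 1)`. Small extent bounds the norms of the lifts, so their
images in `A'` stay in a compact sublevel set and converge along the ultrafilter; lower
semicontinuity removes the excess. -/
lemma exists_isLimit {a : selfAdjoint A.carrier} (ha : A.lip a < ∞) :
    ∃ b : selfAdjoint A'.carrier, 𝔅.IsLimit (a, b) ∧ A'.lip b ≤ A.lip a := by
  have hpos : ∀ n, A.lip a < A.lip a + bridgeSize n := fun n =>
    ENNReal.lt_add_right ha.ne (by
      rw [ENNReal.coe_ne_zero, bridgeSize]
      positivity)
  choose d hd hdl using fun n => (𝔅.p_quotient n).lift a _ (hpos n)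
  obtain ⟨l, hl⟩ : ∃ l : ℝ≥0, (l : ℝ≥0∞) = A.lip a := ⟨_, ENNReal.coe_toNNReal ha.ne⟩
  have hdl' : ∀ n, (𝔅.D n).lip (d n) ≤ (l + 1 : ℝ≥0) := fun n => by
    refine (hdl n).le.trans ?_
    rw [← hl]
    exact_mod_cast add_le_add_right (bridgeSize_le_one n) l
  have hpd : ∀ n, 𝔅.p n (d n) = a := fun n => congrArg Subtype.val (hd n)
  have hdn : ∀ n, ‖(d n : (𝔅.D n).carrier)‖ ≤ ‖(a : A.carrier)‖ + (l + 1 : ℝ≥0) := fun n => by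
    refine ((𝔅.p_states n).norm_le (𝔅.D n).isLipSeminorm.smul (by positivity) (hdl' n)).trans ?_
    rw [hpd]
    gcongr
    exact mul_le_of_le_one_right (NNReal.coe_nonneg _) (by exact_mod_cast bridgeSize_le_one n)
  have hc := A'.isCompact_sublevel (l + 1) (by positivity) (‖(a : A.carrier)‖ + (l + 1 : ℝ≥0))
  have hmem : ∀ n, A'.lip (saMap (𝔅.q n) (d n)) ≤ (l + 1 : ℝ≥0) ∧
      ‖(saMap (𝔅.q n) (d n) : A'.carrier)‖ ≤ ‖(a : A.carrier)‖ + (l + 1 : ℝ≥0) := fun n =>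
    ⟨((𝔅.q_quotient n).le _).trans (hdl' n), (norm_saMap_le (𝔅.q n) (d n)).trans (hdn n)⟩
  obtain ⟨b, -, hb⟩ := hc.ultrafilter_le_nhds' (limFilter.map fun n => saMap (𝔅.q n) (d n))
    (Ultrafilter.mem_map.2 (Filter.Eventually.of_forall hmem))
  have hb' : Filter.Tendsto (fun n => saMap (𝔅.q n) (d n)) limFilter (𝓝 b) := hb
  refine ⟨b, ⟨fun n => d n, ‖(a : A.carrier)‖₊ + (l + 1), fun n => ?_, ?_, ?_⟩, ?_⟩
  · exact QuantumCMS.isBoundedBy_of_selfAdjoint ((hdl' n).trans (by exact_mod_cast le_add_self))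
      (hdn n)
  · simp only [hpd]
    exact tendsto_const_nhds
  · exact (continuous_subtype_val.tendsto b).comp hb'
  · refine le_of_tendsto_of_isClosed A'.lip_smul A'.isClosed_ball hb' fun r hr => ?_
    filter_upwards [eventually_add_bridgeSize_le hr] with n hn
    exact ((𝔅.q_quotient n).le _).trans ((hdl n).le.trans hn)

lemma dense_fst_limits :
    Dense (Prod.fst '' (𝔅.limits : Set (A.carrier × A'.carrier))) := by
  let V : Submodule ℂ A.carrier :=
    (Subalgebra.toSubmodule 𝔅.limits.toSubalgebra).map (LinearMap.fst ℂ A.carrier A'.carrier)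
  have hV : (V : Set A.carrier) = Prod.fst '' (𝔅.limits : Set (A.carrier × A'.carrier)) := rfl
  have hsa : ∀ a : selfAdjoint A.carrier, (a : A.carrier) ∈ V.topologicalClosure := by
    intro a
    refine map_mem_closure (f := Subtype.val) continuous_subtype_val (A.dense_dom a) ?_
    intro a' ha'
    obtain ⟨b, hb, -⟩ := 𝔅.exists_isLimit ha'
    exact ⟨(a', b), hb, rfl⟩
  rw [← hV]
  intro a
  rw [← realPart_add_I_smul_imaginaryPart a]
  exact V.topologicalClosure.add_mem (hsa _) (V.topologicalClosure.smul_mem _ (hsa _))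

/-- The limit of a sequence of bridges of vanishing extent is an isomorphism. -/
theorem exists_starHom : ∃ π : StarHom A.carrier A'.carrier, Function.Bijective π ∧
    (∀ a, A'.lip (saMap π a) = A.lip a) ∧
    ∀ x, x ∈ closure {x | 𝔅.IsLimit x} ↔ π x.1 = x.2 := by
  have hdense₂ : Dense (Prod.snd '' (𝔅.limits : Set (A.carrier × A'.carrier))) := by
    convert 𝔅.symm.dense_fst_limits using 1
    ext b
    constructor
    · rintro ⟨x, hx, rfl⟩
      exact ⟨x.swap, 𝔅.isLimit_symm hx, rfl⟩
    · rintro ⟨x, hx, rfl⟩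
      exact ⟨x.swap, 𝔅.symm.isLimit_symm hx, rfl⟩
  -- The closure is a *-algebra and, by equality of norms, the graph of a linear isometry. Each
  -- algebraic property of the map is then membership of some element in `T`.
  let T := 𝔅.limits.topologicalClosure
  have hsub : (𝔅.limits : Set (A.carrier × A'.carrier)) ⊆ T := subset_closure
  obtain ⟨e, he⟩ := exists_linearIsometry_of_graph (Subalgebra.toSubmodule T.toSubalgebra)
    isClosed_closure
    (fun x hx => closure_minimal (fun x hx => 𝔅.norm_eq_of_isLimit hx)
      (isClosed_eq continuous_fst.norm continuous_snd.norm) hx)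
    (𝔅.dense_fst_limits.mono (Set.image_mono hsub)) (hdense₂.mono (Set.image_mono hsub))
  have he' : ∀ x, x ∈ T ↔ e x.1 = x.2 := he
  have hmem : ∀ a, (a, e a) ∈ T := fun a => (he' _).2 rfl
  let π : StarHom A.carrier A'.carrier :=
    { toFun := e
      map_one' := (he' 1).1 (one_mem T)
      map_mul' := fun a b => (he' _).1 (mul_mem (hmem a) (hmem b))
      map_zero' := map_zero e
      map_add' := map_add e
      commutes' := fun z => (he' (algebraMap ℂ (A.carrier × A'.carrier) z)).1 (algebraMap_mem T z)
      map_star' := fun a => (he' _).1 (star_mem (hmem a)) }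
  have hlim : ∀ {a b}, 𝔅.IsLimit (a, b) → π a = b := fun {a b} h => (he' (a, b)).1 (hsub h)
  refine ⟨π, e.bijective, fun a => le_antisymm ?_ ?_, he'⟩
  · obtain h | h := lt_or_ge (A.lip a) ∞
    · obtain ⟨b, hb, hle⟩ := 𝔅.exists_isLimit h
      rwa [show saMap π a = b from Subtype.ext (hlim hb)]
    · exact le_top.trans h
  -- The reversed sequence sends `π a` back to an element whose seminorm is no larger; injectivity
  -- identifies it with `a`.
  · obtain h | h := lt_or_ge (A'.lip (saMap π a)) ∞
    · obtain ⟨a', ha', hle⟩ := 𝔅.symm.exists_isLimit h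
      have h1 : π a' = π a := hlim (𝔅.symm.isLimit_symm ha')
      rwa [show a' = a from Subtype.ext (e.injective h1)] at hle
    · exact le_top.trans h

end BridgeSequence

end

section

/-! ### Sequences of tunnels of vanishing extent -/

variable {F K G H : ℝ≥0}

lemma saMap_surjective {A B : Type u} [CStarAlgebra A] [CStarAlgebra B] {π : StarHom A B}
    (hπ : Function.Bijective π) : Function.Surjective (saMap π) := fun b => by
  obtain ⟨a, ha⟩ := hπ.2 b
  have hsa : star a = a := hπ.1 (by rw [map_star, ha, selfAdjoint.star_val_eq])
  exact ⟨⟨a, hsa⟩, Subtype.ext ha⟩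

/-- A sequence of tunnels with extents vanishing at infinity. -/
structure TunnelSequence (X Y : MetricalCorr.{u} F K G H) where
  τ : ℕ → Tunnel X Y
  extent_le : ∀ n, (τ n).extent ≤ bridgeSize n

namespace TunnelSequence

variable {X Y : MetricalCorr.{u} F K G H} (𝔗 : TunnelSequence X Y)

lemma toX_states (n : ℕ) :
    StatesWithin (𝔗.τ n).P.A.lip (𝔗.τ n).toX.leftMap (bridgeSize n) ∧
    StatesWithin (𝔗.τ n).P.B.lip (𝔗.τ n).toX.rightMap (bridgeSize n) :=
  (legExtent_le_iff ENNReal.coe_ne_top _).1 ((le_max_left _ _).trans (𝔗.extent_le n))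

lemma toY_states (n : ℕ) :
    StatesWithin (𝔗.τ n).P.A.lip (𝔗.τ n).toY.leftMap (bridgeSize n) ∧
    StatesWithin (𝔗.τ n).P.B.lip (𝔗.τ n).toY.rightMap (bridgeSize n) :=
  (legExtent_le_iff ENNReal.coe_ne_top _).1 ((le_max_right _ _).trans (𝔗.extent_le n))

/-- The reversed sequence. -/
def symm : TunnelSequence Y X where
  τ n := (𝔗.τ n).symm
  extent_le n := (max_comm _ _).trans_le (𝔗.extent_le n)

/-- The sequence of bridges between the algebras which act on the left. -/
def left : BridgeSequence X.A Y.A where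
  D n := (𝔗.τ n).P.A
  p n := (𝔗.τ n).toX.leftMap
  q n := (𝔗.τ n).toY.leftMap
  p_quotient n := (𝔗.τ n).toX.left_quotient
  q_quotient n := (𝔗.τ n).toY.left_quotient
  p_states n := (𝔗.toX_states n).1
  q_states n := (𝔗.toY_states n).1

/-- The sequence of bridges between the algebras which act on the right. -/
def right : BridgeSequence X.B Y.B where
  D n := (𝔗.τ n).P.B
  p n := (𝔗.τ n).toX.rightMap
  q n := (𝔗.τ n).toY.rightMap
  p_quotient n := (𝔗.τ n).toX.right_quotient
  q_quotient n := (𝔗.τ n).toY.right_quotient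
  p_states n := (𝔗.toX_states n).2
  q_states n := (𝔗.toY_states n).2

/-- The pairs of limits of images of a sequence which is bounded for the D-norms. -/
def IsLimit (x : X.M × Y.M) : Prop :=
  ∃ (ζ : ∀ n, (𝔗.τ n).P.M) (l : ℝ≥0), (∀ n, (𝔗.τ n).P.dnorm (ζ n) ≤ l) ∧
    Filter.Tendsto (fun n => (𝔗.τ n).toX.modMap (ζ n)) limFilter (𝓝 x.1) ∧
    Filter.Tendsto (fun n => (𝔗.τ n).toY.modMap (ζ n)) limFilter (𝓝 x.2)

variable {𝔗}

lemma IsLimit.symm {x : X.M × Y.M} (h : 𝔗.IsLimit x) : 𝔗.symm.IsLimit x.swap := by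
  obtain ⟨ζ, l, hl, h₁, h₂⟩ := h
  exact ⟨ζ, l, hl, h₂, h₁⟩

/-- The Leibniz inequality for inner products keeps the sequence of inner products bounded in the
right algebras. This ties the limits in the modules to those in the algebras, and transfers the
equality of norms to vectors. -/
lemma IsLimit.inner {x y : X.M × Y.M} (hx : 𝔗.IsLimit x) (hy : 𝔗.IsLimit y) :
    𝔗.right.IsLimit (X.ip x.1 y.1, Y.ip x.2 y.2) := by
  obtain ⟨ζ, l, hl, h₁, h₂⟩ := hx
  obtain ⟨ξ, m, hm, h₁', h₂'⟩ := hy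
  refine ⟨fun n => (𝔗.τ n).P.ip (ζ n) (ξ n), H * l * m + l * m, fun n => ?_, ?_, ?_⟩
  · have h := ((𝔗.τ n).P.inner_leibniz (ζ n) (ξ n) ((hl n).trans_lt ENNReal.coe_lt_top)
      ((hm n).trans_lt ENNReal.coe_lt_top)).trans
      (mul_le_mul' (mul_le_mul_right (hl n) (H : ℝ≥0∞)) (hm n))
    have h' := h.trans (le_add_right le_rfl : _ ≤ (H : ℝ≥0∞) * l * m + l * m)
    refine ⟨?_, ?_, ?_⟩
    · push_cast
      exact (le_max_left _ _).trans h'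
    · push_cast
      exact (le_max_right _ _).trans h'
    · refine (HilbertModule.norm_inner_le (B := (𝔗.τ n).P.B.carrier) _ _).trans ((mul_le_mul
        ((𝔗.τ n).P.norm_le_of_dnorm_le (hl n)) ((𝔗.τ n).P.norm_le_of_dnorm_le (hm n))
        (norm_nonneg _) l.coe_nonneg).trans ?_)
      exact_mod_cast le_add_self
  · refine ((HilbertModule.continuous_inner.tendsto (x.1, y.1)).comp
      (h₁.prodMk_nhds h₁')).congr fun n => ?_
    exact ((𝔗.τ n).toX.map_ip _ _).symm
  · refine ((HilbertModule.continuous_inner.tendsto (x.2, y.2)).comp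
      (h₂.prodMk_nhds h₂')).congr fun n => ?_
    exact ((𝔗.τ n).toY.map_ip _ _).symm

lemma IsLimit.norm_eq {x : X.M × Y.M} (h : 𝔗.IsLimit x) : ‖x.1‖ = ‖x.2‖ := by
  have := 𝔗.right.norm_eq_of_isLimit (h.inner h)
  simp only [MetricalCorr.ip, ← HilbertModule.norm_sq_eq] at this
  exact (sq_eq_sq₀ (norm_nonneg _) (norm_nonneg _)).1 this

lemma dnorm_lact_le {Z : MetricalCorr.{u} F K G H} {l m : ℝ≥0} {d : Z.A.carrier} {ζ : Z.M}
    (hd : Z.A.IsBoundedBy l d) (hζ : Z.dnorm ζ ≤ m) :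
    Z.dnorm (Z.lact d ζ) ≤ (G * (l + l) * m + G * (l + l) * m : ℝ≥0) := by
  have key : ∀ a : selfAdjoint Z.A.carrier, ‖(a : Z.A.carrier)‖ ≤ l → Z.A.lip a ≤ l →
      Z.dnorm (Z.lact a ζ) ≤ G * (l + l) * m := by
    intro a hn hl
    have hn' : ‖(a : Z.A.carrier)‖ₑ ≤ l := by
      rw [enorm_eq_nnnorm]
      exact_mod_cast hn
    exact (Z.modular_leibniz a ζ (hl.trans_lt ENNReal.coe_lt_top)
      (hζ.trans_lt ENNReal.coe_lt_top)).trans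
      (mul_le_mul' (mul_le_mul_right (add_le_add hn' hl) _) hζ)
  have hdec : Z.lact d ζ = Z.lact (ℜ d : Z.A.carrier) ζ +
      Complex.I • Z.lact (ℑ d : Z.A.carrier) ζ := by
    conv_lhs => rw [← realPart_add_I_smul_imaginaryPart d]
    rw [map_add, map_smul]
    rfl
  rw [hdec]
  push_cast
  refine (Z.dnorm_add_le _ _).trans (add_le_add
    (key _ ((realPart.norm_le d).trans hd.norm) hd.re) ?_)
  rw [Z.dnorm_smul, ← ofReal_norm, Complex.norm_I, ENNReal.ofReal_one, one_mul]
  exact key _ ((imaginaryPart.norm_le d).trans hd.norm) hd.im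

lemma IsLimit.lact {a : X.A.carrier × Y.A.carrier} {x : X.M × Y.M} (ha : 𝔗.left.IsLimit a)
    (hx : 𝔗.IsLimit x) : 𝔗.IsLimit (X.lact a.1 x.1, Y.lact a.2 x.2) := by
  obtain ⟨d, l, hl, h₁, h₂⟩ := ha
  obtain ⟨ζ, m, hm, h₁', h₂'⟩ := hx
  refine ⟨fun n => (𝔗.τ n).P.lact (d n) (ζ n), _, fun n => dnorm_lact_le (hl n) (hm n), ?_, ?_⟩
  · refine ((X.continuous_lact.tendsto (a.1, x.1)).comp
      (h₁.prodMk_nhds h₁')).congr fun n => ?_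
    exact ((𝔗.τ n).toX.map_lact _ _).symm
  · refine ((Y.continuous_lact.tendsto (a.2, x.2)).comp
      (h₂.prodMk_nhds h₂')).congr fun n => ?_
    exact ((𝔗.τ n).toY.map_lact _ _).symm

variable (𝔗)

/-- The pairs of limits form a vector space. -/
def limits : Submodule ℂ (X.M × Y.M) where
  carrier := {x | 𝔗.IsLimit x}
  add_mem' := by
    rintro x y ⟨ζ, l, hl, h₁, h₂⟩ ⟨ξ, m, hm, h₁', h₂'⟩
    refine ⟨fun n => ζ n + ξ n, l + m, fun n => ?_, ?_, ?_⟩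
    · push_cast
      exact ((𝔗.τ n).P.dnorm_add_le _ _).trans (add_le_add (hl n) (hm n))
    · simp only [map_add]
      exact h₁.add h₁'
    · simp only [map_add]
      exact h₂.add h₂'
  zero_mem' := ⟨fun _ => 0, 0, fun n => ((𝔗.τ n).P.dnorm_zero).le, by
    simp only [map_zero]
    exact tendsto_const_nhds, by
    simp only [map_zero]
    exact tendsto_const_nhds⟩
  smul_mem' := by
    rintro z x ⟨ζ, l, hl, h₁, h₂⟩
    refine ⟨fun n => z • ζ n, ‖z‖₊ * l, fun n => ?_, ?_, ?_⟩
    · push_cast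
      rw [(𝔗.τ n).P.dnorm_smul, enorm_eq_nnnorm]
      exact mul_le_mul_right (hl n) _
    · simp only [map_smul]
      exact h₁.const_smul z
    · simp only [map_smul]
      exact h₂.const_smul z

/-- As for the algebras, but compactness of the D-balls makes a separate control of the norms
unnecessary. -/
lemma exists_isLimit {ω : X.M} (hω : X.dnorm ω < ∞) :
    ∃ η : Y.M, 𝔗.IsLimit (ω, η) ∧ Y.dnorm η ≤ X.dnorm ω := by
  have hpos : ∀ n, X.dnorm ω < X.dnorm ω + bridgeSize n := fun n =>
    ENNReal.lt_add_right hω.ne (by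
      rw [ENNReal.coe_ne_zero, bridgeSize]
      positivity)
  choose ζ hζ hζl using fun n => (𝔗.τ n).toX.mod_quotient.lift ω _ (hpos n)
  obtain ⟨l, hl⟩ : ∃ l : ℝ≥0, (l : ℝ≥0∞) = X.dnorm ω := ⟨_, ENNReal.coe_toNNReal hω.ne⟩
  have hζl' : ∀ n, (𝔗.τ n).P.dnorm (ζ n) ≤ (l + 1 : ℝ≥0) := fun n => by
    refine (hζl n).le.trans ?_
    rw [← hl]
    exact_mod_cast add_le_add_right (bridgeSize_le_one n) l
  obtain ⟨η, -, hη⟩ := (Y.isCompact_sublevel (l := l + 1) (by positivity)).ultrafilter_le_nhds'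
    (limFilter.map fun n => (𝔗.τ n).toY.modMap (ζ n))
    (Ultrafilter.mem_map.2 (Filter.Eventually.of_forall fun n =>
      ((𝔗.τ n).toY.mod_quotient.le _).trans (hζl' n)))
  have hη' : Filter.Tendsto (fun n => (𝔗.τ n).toY.modMap (ζ n)) limFilter (𝓝 η) := hη
  refine ⟨η, ⟨ζ, l + 1, hζl', ?_, hη'⟩, ?_⟩
  · simp only [hζ]
    exact tendsto_const_nhds
  · refine le_of_tendsto_of_isClosed Y.dnorm_smul_real Y.isCompact_ball.isClosed hη' fun r hr => ?_
    filter_upwards [eventually_add_bridgeSize_le hr] with n hn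
    exact ((𝔗.τ n).toY.mod_quotient.le _).trans ((hζl n).le.trans hn)

lemma dense_fst_limits : Dense (Prod.fst '' (𝔗.limits : Set (X.M × Y.M))) :=
  X.dense_dom.mono fun _ hω => by
    obtain ⟨η, hη, -⟩ := 𝔗.exists_isLimit hω
    exact ⟨_, hη, rfl⟩

lemma exists_linearIsometryEquiv : ∃ Θ : X.M ≃ₗᵢ[ℂ] Y.M, (∀ ω, Y.dnorm (Θ ω) = X.dnorm ω) ∧
    ∀ x, x ∈ closure {x | 𝔗.IsLimit x} ↔ Θ x.1 = x.2 := by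
  have hdense₂ : Dense (Prod.snd '' (𝔗.limits : Set (X.M × Y.M))) :=
    𝔗.symm.dense_fst_limits.mono (by
      rintro _ ⟨x, hx, rfl⟩
      exact ⟨x.swap, IsLimit.symm hx, rfl⟩)
  let T := 𝔗.limits.topologicalClosure
  have hsub : (𝔗.limits : Set (X.M × Y.M)) ⊆ T := subset_closure
  have hnorm : ∀ x ∈ T, ‖x.1‖ = ‖x.2‖ := fun x hx =>
    closure_minimal (t := {x : X.M × Y.M | ‖x.1‖ = ‖x.2‖})
      (fun x (hx : 𝔗.IsLimit x) => hx.norm_eq)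
      (isClosed_eq continuous_fst.norm continuous_snd.norm) hx
  obtain ⟨Θ, hΘ⟩ := exists_linearIsometry_of_graph T isClosed_closure hnorm
    (𝔗.dense_fst_limits.mono (Set.image_mono hsub)) (hdense₂.mono (Set.image_mono hsub))
  have hlim : ∀ {ω η}, 𝔗.IsLimit (ω, η) → Θ ω = η := fun {ω η} h => (hΘ (ω, η)).1 (hsub h)
  refine ⟨Θ, fun ω => le_antisymm ?_ ?_, hΘ⟩
  · obtain h | h := lt_or_ge (X.dnorm ω) ∞
    · obtain ⟨η, hη, hle⟩ := 𝔗.exists_isLimit h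
      rwa [hlim hη]
    · exact le_top.trans h
  · obtain h | h := lt_or_ge (Y.dnorm (Θ ω)) ∞
    · obtain ⟨ω', hω', hle⟩ := 𝔗.symm.exists_isLimit h
      have h1 : Θ ω' = Θ ω := hlim (IsLimit.symm hω')
      rwa [Θ.injective h1] at hle
    · exact le_top.trans h

/-- The limit of a sequence of tunnels of vanishing extent is a full modular quantum isometry. -/
theorem exists_isFull : ∃ Φ : ModularQuantumIsometry X Y, Φ.IsFull ∧
    ∀ ω, (ω, Φ.modMap ω) ∈ closure {x | 𝔗.IsLimit x} := by
  obtain ⟨π, hπ, hπl, hπg⟩ := 𝔗.left.exists_starHom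
  obtain ⟨θ, hθ, hθl, hθg⟩ := 𝔗.right.exists_starHom
  obtain ⟨Θ, hΘl, hΘg⟩ := 𝔗.exists_linearIsometryEquiv
  have hmem : ∀ ω, (ω, Θ ω) ∈ closure {x | 𝔗.IsLimit x} := fun ω => (hΘg _).2 rfl
  have hlact : ∀ (a : X.A) (ω : X.M), Θ (X.lact a ω) = Y.lact (π a) (Θ ω) := by
    intro a ω
    refine (hΘg (X.lact a ω, Y.lact (π a) (Θ ω))).1 ?_
    exact map_mem_closure₂ (f := fun (a : X.A.carrier × Y.A.carrier) (x : X.M × Y.M) =>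
      (X.lact a.1 x.1, Y.lact a.2 x.2))
      ((X.continuous_lact.comp (by fun_prop : Continuous fun p : (X.A.carrier × Y.A.carrier) ×
        (X.M × Y.M) => (p.1.1, p.2.1))).prodMk (Y.continuous_lact.comp (by fun_prop : Continuous
        fun p : (X.A.carrier × Y.A.carrier) × (X.M × Y.M) => (p.1.2, p.2.2))))
      ((hπg (a, π a)).2 rfl) (hmem ω) fun a ha x hx => IsLimit.lact ha hx
  have hip : ∀ ω η : X.M, θ (X.ip ω η) = Y.ip (Θ ω) (Θ η) := by
    intro ω η
    refine (hθg (X.ip ω η, Y.ip (Θ ω) (Θ η))).1 ?_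
    exact map_mem_closure₂ (f := fun (x y : X.M × Y.M) => (X.ip x.1 y.1, Y.ip x.2 y.2))
      ((HilbertModule.continuous_inner.comp (by fun_prop : Continuous fun p : (X.M × Y.M) ×
        (X.M × Y.M) => (p.1.1, p.2.1))).prodMk (HilbertModule.continuous_inner.comp
        (by fun_prop : Continuous fun p : (X.M × Y.M) × (X.M × Y.M) => (p.1.2, p.2.2))))
      (hmem ω) (hmem η) fun x hx y hy => IsLimit.inner hx hy
  have hright : ∀ (b : X.B) (ω : X.M),
      Θ (MulOpposite.op b • ω) = MulOpposite.op (θ b) • Θ ω := by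
    intro b ω
    -- No Leibniz inequality is available for the right action, so limits are not used here. Right
    -- linearity follows from compatibility with inner products, tested against every vector of `Y`.
    refine sub_eq_zero.1 (HilbertModule.eq_zero_of_forall_inner Y.B.carrier fun y => ?_)
    obtain ⟨η, rfl⟩ := Θ.surjective y
    have h1 := hip η (MulOpposite.op b • ω)
    have h2 := hip η ω
    simp only [MetricalCorr.ip, HilbertModule.inner_op_smul_right, map_mul] at h1 h2
    rw [HilbertModule.inner_sub_right, HilbertModule.inner_op_smul_right, ← h1, ← h2, sub_self]
  refine ⟨.ofQuotient (Θ : X.M →L[ℂ] Y.M) π θ hlact hright hip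
    (isSeminormQuotient_of_surjective (saMap_surjective hπ) hπl)
    (isSeminormQuotient_of_surjective (saMap_surjective hθ) hθl)
    (isSeminormQuotient_of_surjective Θ.surjective hΘl),
    ⟨Θ.bijective, hπ, hθ, hπl, hθl, hΘl⟩, hmem⟩

/-- The limits of the pseudo-states which are close to a given one, when the separations of two
families of operators vanish at infinity. -/
lemma exists_pseudoState_eq {J : Type v} {a : J → X.Op} {b : J → Y.Op}
    (hsep : ∀ n, (𝔗.τ n).separation a b ≤ bridgeSize n) (μ : StateSpace X.B) {ω₀ : X.M}
    (hω₀ : X.dnorm ω₀ ≤ 1) : ∃ (ν : StateSpace Y.B) (η : Y.M), ∀ j,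
    ∀ x ∈ closure {x | 𝔗.IsLimit x},
      μ.1 (X.ip ω₀ ((a j).toCLM x.1)) = ν.1 (Y.ip η ((b j).toCLM x.2)) := by
  have hpos : ∀ n, 0 < bridgeSize n := fun n => by
    rw [bridgeSize]
    positivity
  -- The state and the vector depend on `n` but not on `j`, since the distance between families is a
  -- supremum over indices. One `bridgeSize n` is the separation, the other the slack in the
  -- Hausdorff distance.
  have hex : ∀ n, ∃ (ν : StateSpace Y.B) (η : Y.M), Y.dnorm η ≤ 1 ∧
      ∀ j ξ, (𝔗.τ n).P.dnorm ξ ≤ 1 → ‖μ.1 (X.ip ω₀ ((a j).toCLM ((𝔗.τ n).toX.modMap ξ))) -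
        ν.1 (Y.ip η ((b j).toCLM ((𝔗.τ n).toY.modMap ξ)))‖ₑ ≤ bridgeSize n + bridgeSize n := by
    intro n
    obtain ⟨_, ⟨ψ, ⟨ν, η, hη, hψ⟩, rfl⟩, h⟩ := exists_le_of_hausdorff_le (hsep n)
      ENNReal.coe_ne_top (mem_legFamilies (𝔗.τ n).toX a (X.pseudoState_mem μ hω₀)) (hpos n)
    refine ⟨ν, η, hη, fun j ξ hξ => ?_⟩
    have := (MetricalCorr.mkFamily_le_iff _).1 h j ξ hξ
    rwa [show ((ψ.comp (b j).toCLM).comp (𝔗.τ n).toY.modMap) ξ = _ from hψ _] at this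
  choose ν η hη hνη using hex
  obtain ⟨ν', -, hν'⟩ := isCompact_univ.ultrafilter_le_nhds' (limFilter.map ν)
    (Filter.univ_mem)
  obtain ⟨η', -, hη'⟩ := Y.isCompact_ball.ultrafilter_le_nhds' (limFilter.map η)
    (Ultrafilter.mem_map.2 (Filter.Eventually.of_forall hη))
  have hν' : Filter.Tendsto ν limFilter (𝓝 ν') := hν'
  have hη' : Filter.Tendsto η limFilter (𝓝 η') := hη'
  refine ⟨ν', η', fun j x hx => ?_⟩
  have hclosed : IsClosed {x : X.M × Y.M |
      μ.1 (X.ip ω₀ ((a j).toCLM x.1)) = ν'.1 (Y.ip η' ((b j).toCLM x.2))} := by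
    have c₁ : Continuous fun x : X.M × Y.M => μ.1 (X.ip ω₀ ((a j).toCLM x.1)) :=
      (X.pseudoState μ ω₀).continuous.comp ((a j).toCLM.continuous.comp continuous_fst)
    have c₂ : Continuous fun x : X.M × Y.M => ν'.1 (Y.ip η' ((b j).toCLM x.2)) :=
      (Y.pseudoState ν' η').continuous.comp ((b j).toCLM.continuous.comp continuous_snd)
    exact isClosed_eq c₁ c₂
  -- Each operator is continuous, so the identity need only hold at limits. No bound uniform in `j`
  -- is needed.
  refine closure_minimal (fun x hx => ?_) hclosed hx
  obtain ⟨ζ, l, hl, h₁, h₂⟩ := hx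
  have hl0 : (0 : ℝ≥0) < l + 1 := by positivity
  have hbound : ∀ n, ‖μ.1 (X.ip ω₀ ((a j).toCLM ((𝔗.τ n).toX.modMap (ζ n)))) -
      (ν n).1 (Y.ip (η n) ((b j).toCLM ((𝔗.τ n).toY.modMap (ζ n))))‖ ≤
      ((l + 1 : ℝ≥0) : ℝ) * (bridgeSize n + bridgeSize n) := by
    intro n
    have hζ : (𝔗.τ n).P.dnorm (((l + 1 : ℝ≥0) : ℝ)⁻¹ • ζ n) ≤ 1 :=
      (inv_smul_le_one_iff (𝔗.τ n).P.dnorm_smul_real hl0 _).2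
        ((hl n).trans (by exact_mod_cast le_self_add))
    have h := hνη n j _ hζ
    have hlin : ∀ (f : (𝔗.τ n).P.M →L[ℂ] ℂ) (t : ℝ) (ξ : (𝔗.τ n).P.M),
        f (t • ξ) = (t : ℂ) * f ξ := fun f t ξ => by
      rw [← Complex.coe_smul, map_smul, smul_eq_mul]
    have e₁ := hlin (legFamily (𝔗.τ n).toX a (X.pseudoState μ ω₀) j) (l + 1 : ℝ≥0)⁻¹ (ζ n)
    have e₂ := hlin (legFamily (𝔗.τ n).toY b (Y.pseudoState (ν n) (η n)) j)
      (l + 1 : ℝ≥0)⁻¹ (ζ n)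
    have h' := (congrArg (fun z => ‖z‖ₑ) (congrArg₂ (· - ·) e₁ e₂)).symm.trans_le h
    rw [← mul_sub, enorm_eq_nnnorm, ← ENNReal.coe_add, ENNReal.coe_le_coe,
      ← NNReal.coe_le_coe, coe_nnnorm, norm_mul, Complex.norm_real, norm_inv,
      Real.norm_of_nonneg (NNReal.coe_nonneg _),
      inv_mul_le_iff₀ (by exact_mod_cast hl0)] at h'
    exact_mod_cast h'
  have lim₁ : Filter.Tendsto (fun n => μ.1 (X.ip ω₀ ((a j).toCLM ((𝔗.τ n).toX.modMap (ζ n)))))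
      limFilter (𝓝 (μ.1 (X.ip ω₀ ((a j).toCLM x.1)))) :=
    (((X.pseudoState μ ω₀).continuous.comp (a j).toCLM.continuous).tendsto _).comp h₁
  have lim₂ : Filter.Tendsto
      (fun n => (ν n).1 (Y.ip (η n) ((b j).toCLM ((𝔗.τ n).toY.modMap (ζ n)))))
      limFilter (𝓝 (ν'.1 (Y.ip η' ((b j).toCLM x.2)))) := by
    have hip : Filter.Tendsto
        (fun n => Y.ip (η n) ((b j).toCLM ((𝔗.τ n).toY.modMap (ζ n)))) limFilter
        (𝓝 (Y.ip η' ((b j).toCLM x.2))) :=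
      (HilbertModule.continuous_inner.tendsto (η', (b j).toCLM x.2)).comp
        (hη'.prodMk_nhds (((b j).toCLM.continuous.tendsto _).comp h₂))
    have hfix := ((StateSpace.continuous_eval (Y.ip η' ((b j).toCLM x.2))).tendsto ν').comp hν'
    -- Both the states and their arguments vary. States being contractive, the change of argument
    -- contributes an error tending to zero, and weak* convergence handles the fixed argument.
    have hdiff : Filter.Tendsto (fun n => (ν n).1
        (Y.ip (η n) ((b j).toCLM ((𝔗.τ n).toY.modMap (ζ n))) - Y.ip η' ((b j).toCLM x.2)))
        limFilter (𝓝 0) :=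
      squeeze_zero_norm (fun n => (ν n).norm_apply_le _) (tendsto_iff_norm_sub_tendsto_zero.1 hip)
    refine (zero_add (ν'.1 (Y.ip η' ((b j).toCLM x.2))) ▸ hdiff.add hfix).congr fun n => ?_
    rw [Function.comp_apply, map_sub, sub_add_cancel]
  have hzero := squeeze_zero_norm hbound (by
    simpa using (tendsto_bridgeSize.add tendsto_bridgeSize).const_mul ((l + 1 : ℝ≥0) : ℝ))
  exact sub_eq_zero.1 (tendsto_nhds_unique (lim₁.sub lim₂) hzero)

end TunnelSequence

/-- States separate the elements of the algebra, rescaling reaches every vector of finite D-norm,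
and these are dense in the module. -/
lemma MetricalCorr.eq_of_forall_pseudoState {X : MetricalCorr.{u} F K G H} {x y : X.M}
    (h : ∀ (μ : StateSpace X.B) (ω : X.M), X.dnorm ω ≤ 1 → μ.1 (X.ip ω x) = μ.1 (X.ip ω y)) :
    x = y := by
  have h1 : ∀ ω : X.M, X.dnorm ω < ∞ → X.ip ω x = X.ip ω y := by
    intro ω hω
    obtain ⟨l, hl, -⟩ := ENNReal.lt_iff_exists_nnreal_btwn.1 hω
    have hl0 : (0 : ℝ≥0) < l + 1 := by positivity
    have hs := (inv_smul_le_one_iff X.dnorm_smul_real hl0 ω).2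
      (hl.le.trans (by exact_mod_cast le_self_add))
    have h2 := eq_of_forall_state fun μ => h μ _ hs
    have h3 : ∀ z, X.ip (((l + 1 : ℝ≥0) : ℝ)⁻¹ • ω) z = ((((l + 1 : ℝ≥0) : ℝ)⁻¹ : ℝ) : ℂ) •
        X.ip ω z := fun z => by
      simp only [MetricalCorr.ip]
      rw [← HilbertModule.star_inner, ← Complex.coe_smul, HilbertModule.inner_smul_right,
        star_smul, HilbertModule.star_inner, Complex.star_def, Complex.conj_ofReal]
    rw [h3, h3] at h2
    refine smul_right_injective _ ?_ h2
    exact_mod_cast inv_ne_zero hl0.ne'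
  have h2 : ∀ ω : X.M, X.ip ω x = X.ip ω y := by
    have hc : ∀ z : X.M, Continuous fun ω : X.M => X.ip ω z := fun z =>
      HilbertModule.continuous_inner.comp (by fun_prop : Continuous fun ω : X.M => (ω, z))
    exact fun ω => congrFun (Continuous.ext_on X.dense_dom (hc x) (hc y) fun ω hω => h1 ω hω) ω
  refine sub_eq_zero.1 (HilbertModule.eq_zero_of_forall_inner X.B.carrier fun ω => ?_)
  rw [HilbertModule.inner_sub_right]
  exact sub_eq_zero.2 (h2 ω)

/-- Families which contain the identity and are at distance zero are conjugate by a full modular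
quantum isometry. -/
theorem exists_isFull_of_opPropinquity_eq_zero {X Y : MetricalCorr.{u} F K G H} {J : Type v}
    {a : J → X.Op} {b : J → Y.Op} {j₀ : J} (ha : a j₀ = Adjoinable.id X.B.carrier X.M)
    (hb : b j₀ = Adjoinable.id Y.B.carrier Y.M) (h : opPropinquity a b = 0) :
    ∃ Φ : ModularQuantumIsometry X Y, Φ.IsFull ∧
      ∀ (j : J) (ω : X.M), Φ.modMap ((a j).toCLM ω) = (b j).toCLM (Φ.modMap ω) := by
  have hex : ∀ n, ∃ τ : Tunnel X Y, τ.dispersion a b < bridgeSize n := fun n => by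
    have : opPropinquity a b < bridgeSize n := by
      rw [h, ENNReal.coe_pos, bridgeSize]
      positivity
    exact iInf_lt_iff.1 this
  choose τ hτ using hex
  let 𝔗 : TunnelSequence X Y := ⟨τ, fun n => (le_max_left _ _).trans (hτ n).le⟩
  obtain ⟨Φ, hΦ, hlim⟩ := 𝔗.exists_isFull
  refine ⟨Φ, hΦ, fun j ω => ?_⟩
  -- Pulling `b j (Φ ω)` back to `ω'` reduces the claim to `a j ω = ω'` in `X`, which can be tested
  -- on pseudo-states of `X`.
  obtain ⟨ω', hω'⟩ := hΦ.bij_mod.2 ((b j).toCLM (Φ.modMap ω))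
  rw [← hω']
  congr 1
  refine MetricalCorr.eq_of_forall_pseudoState fun μ ω₀ hω₀ => ?_
  obtain ⟨ν, η, hνη⟩ := 𝔗.exists_pseudoState_eq (a := a) (b := b)
    (fun n => (le_max_right _ _).trans (hτ n).le) μ hω₀
  have h₁ := hνη j _ (hlim ω)
  -- The same `ν` and `η` serve for `j` at `ω` and for `j₀` at `ω'`. As the operators at `j₀` are
  -- identities, both pseudo-state values equal that of `ν` at `⟨η, b j (Φ ω)⟩`.
  have h₂ := hνη j₀ _ (hlim ω')
  rw [ha, hb] at h₂
  rw [h₁, ← hω']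
  exact h₂.symm

end

end OpPropinquity

end

theorem mainTheorem11 (F K G H : ℝ≥0) (hF : 1 ≤ F) (hG : 1 ≤ G) (hH : 2 ≤ H)
    (J : Type v) [Nonempty J] :
    -- self-distance zero, symmetry, triangle inequality, finiteness
    (∀ (X : OpPropinquity.MetricalCorr.{u} F K G H) (a : J → X.Op),
      OpPropinquity.opPropinquity a a = 0) ∧
    (∀ (X Y : OpPropinquity.MetricalCorr.{u} F K G H) (a : J → X.Op) (b : J → Y.Op),
      OpPropinquity.opPropinquity a b = OpPropinquity.opPropinquity b a) ∧
    (∀ (X Y Z : OpPropinquity.MetricalCorr.{u} F K G H)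
      (a : J → X.Op) (b : J → Y.Op) (c : J → Z.Op), OpPropinquity.IsBoundedFamily b →
      OpPropinquity.opPropinquity a c ≤
        OpPropinquity.opPropinquity a b + OpPropinquity.opPropinquity b c) ∧
    (∀ (X Y : OpPropinquity.MetricalCorr.{u} F K G H) (a : J → X.Op) (b : J → Y.Op),
      OpPropinquity.IsBoundedFamily a → OpPropinquity.IsBoundedFamily b →
      OpPropinquity.opPropinquity a b < ∞) ∧
    -- coincidence property for families which contain the identity at the index `j₀`
    (∀ (j₀ : J) (X Y : OpPropinquity.MetricalCorr.{u} F K G H) (a : J → X.Op) (b : J → Y.Op),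
      a j₀ = OpPropinquity.Adjoinable.id X.B.carrier X.M →
      b j₀ = OpPropinquity.Adjoinable.id Y.B.carrier Y.M →
      (OpPropinquity.opPropinquity a b = 0 ↔
        ∃ Φ : OpPropinquity.ModularQuantumIsometry X Y, Φ.IsFull ∧
          ∀ (j : J) (ω : X.M), Φ.modMap ((a j).toCLM ω) = (b j).toCLM (Φ.modMap ω))) := by
  refine ⟨fun X a => OpPropinquity.opPropinquity_self a,
    fun X Y a b => OpPropinquity.opPropinquity_symm,
    fun X Y Z a b c hb => OpPropinquity.opPropinquity_triangle hF hG hH hb,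
    fun X Y a b ha hb => OpPropinquity.opPropinquity_lt_top hF hG hH ha hb,
    fun j₀ X Y a b ha hb =>
      ⟨fun h => OpPropinquity.exists_isFull_of_opPropinquity_eq_zero ha hb h,
        fun ⟨Φ, hΦ, h⟩ => OpPropinquity.opPropinquity_eq_zero_of_isFull Φ hΦ h⟩⟩
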